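/- **Setting.** Let $f(z)=\sum_{n\ge 0}\phi_n z^n$ be a formal power series with complex coefficients and fix integers $m\ge m^*\ge 1$. For each $n\ge m$ choose polynomials $P_n,Q_n$ with $\deg P_n\le n-m^*$, $\deg Q_n\le m$, $Q_n\not\equiv 0$ and $Q_nf-P_n=O(z^{n+1})$ as formal power series, and let $r_{n,m}=P_n/Q_n$ (an incomplete Padé approximant of type $(n,m,m^*)$ of $f$). Cancel all common factors and write $r_{n,m}=p_{n,m}/q_{n,m}$, where $q_{n,m}$ is normalized by $$q_{n,m}(z)=\prod_{|\zeta_{n,k}|\le 1}(z-\zeta_{n,k})\prod_{|\zeta_{n,k}|>1}\Bigl(1-\frac{z}{\zeta_{n,k}}\Bigr),$$ and let $\lambda_n$ be the order of the common zero of $P_n$ and $Q_n$ at $0$. Then $$r_{n+1,m}(z)-r_{n,m}(z)=\frac{A_{n,m}\,z^{\,n+1-\lambda_n-\lambda_{n+1}}\,q^*_{n,m-m^*}(z)}{q_{n,m}(z)\,q_{n+1,m}(z)},$$ with a constant $A_{n,m}$ and a polynomial $q^*_{n,m-m^*}$ of degree at most $m-m^*$ normalized in the same way (take $A_{n,m}=0$,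 $q^*_{n,m-m^*}=1$ if the left side vanishes). Put $R_m^*(f)=\bigl(\limsup_n|A_{n,m}|^{1/n}\bigr)^{-1}$, $D_m^*(f)=\{|z|<R_m^*(f)\}$, and assume $0<R:=R_m^*(f)<\infty$. A regularization is a sequence $A_n^*>0$ $(n\ge m)$ together with an infinite set $\Lambda$ of indices $n\ge m$ such that (i) $A_n^*/A_{n+1}^*\to 1$; (ii) $\log(A_n^*/n!)$ is concave in $n$; (iii) $|A_{n,m}|R^n\le A_n^*$ for all $n\ge m$; (iv) $|A_{n,m}|R^n\ge cA_n^*$ for all $n\in\Lambda$ and some $c>0$. Distances to the empty set are $+\infty$. For $\zeta\in\mathbb C$, $\lambda(\zeta)$ is the number of zeros of $q_{n,m}$, with multiplicity, that tend to $\zeta$, i.e. the largest $k$ such that the $k$-th closest zero of $q_{n,m}$ to $\zeta$ tends to $\zeta$ as $n\to\infty$. Poles and singular points of $f$ in the closed disk $\overline{D_m^*(f)}$ refer to the meromorphic extension of $f$ to $D_m^*(f)$; a point of the closed disk is singular if this extension does not continue holomorphically to a neighbourhood of the point (so poles are singular). **Theorem.** Regularizations exist. For every regularization $(A_n^*)$,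 $\Lambda$ and every $\zeta\in\mathbb C$ whose distance to the set of zeros of $q_{n,m}$ tends to $0$ as $n\to\infty$, consider the property $$(\ast)\qquad \lim_{n\in\Lambda}\operatorname{dist}\bigl(\zeta,\{z: q^*_{n,m-m^*}(z)=0\}\bigr)=0 .$$ 1. If $|\zeta|>R$, then $(\ast)$ holds. 2. If $|\zeta|<R$, then $(\ast)$ holds or $\zeta$ is a pole of $f$ of order at least $\lambda(\zeta)$. 3. If $|\zeta|=R$ and $q_{n,m}\to q_m$ (coefficientwise) for a polynomial $q_m$ with $\deg q_m=m$ and $q_m(0)\ne 0$, then $(\ast)$ holds or $\zeta$ is a singular point of $f$. Moreover, if $q_{n,m}\to q_m$ with $\deg q_m=m$, $q_m(0)\neq0$, and the zeros of $q_m$ are distinct, then at least $m^*$ zeros of $q_m$ are singular points of $f$ lying in $\overline{D_m^*(f)}$, and those of them that lie in $D_m^*(f)$ are simple poles of $f$. -/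

import Mathlib

open Filter Topology Polynomial

noncomputable section

namespace IncompletePade

/-- The pair `(p, q)` defines an incomplete Padé approximation `p / q` of type `(n, m, m')` of the
formal power series `f`: `deg p ≤ n - m'`, `deg q ≤ m`, `q ≢ 0` and `q f - p = A z ^ (n + 1) + ⋯`.
(It is only used for `n ≥ m ≥ m'`, so the subtraction is the true one.) -/
structure IsApproximant (f : PowerSeries ℂ) (n m m' : ℕ) (p q : ℂ[X]) : Prop where
  natDegree_num_le : p.natDegree ≤ n - m'
  natDegree_den_le : q.natDegree ≤ m
  den_ne_zero : q ≠ 0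
  dvd_remainder : (PowerSeries.X : PowerSeries ℂ) ^ (n + 1) ∣
    (q : PowerSeries ℂ) * f - (p : PowerSeries ℂ)

open Classical in
/-- The normalized polynomial with the multiset of zeros `s`:
`∏_{|ζ| ≤ 1} (z - ζ) ∏_{|ζ| > 1} (1 - z / ζ)`. -/
def normPoly (s : Multiset ℂ) : ℂ[X] :=
  (s.map fun ζ => if ‖ζ‖ ≤ 1 then X - C ζ else 1 - C ζ⁻¹ * X).prod

open Classical in
/-- The greatest common divisor of numerator and denominator. -/
def commonFactor (p q : ℂ[X]) : ℂ[X] := EuclideanDomain.gcd p q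

/-- The order `λ` of the common zero of `p` and `q` at the origin. -/
def commonOrder (p q : ℂ[X]) : ℕ := (commonFactor p q).rootMultiplicity 0

/-- The normalized denominator of `p / q` after cancelling common factors. -/
def redDen (p q : ℂ[X]) : ℂ[X] := normPoly (q / commonFactor p q).roots

/-- The numerator of `p / q` that goes with the denominator `redDen p q` (the division is
exact). -/
def redNum (p q : ℂ[X]) : ℂ[X] := p * redDen p q / q

section Sequences

variable (P Q : ℕ → ℂ[X])

/-- The polynomial `A_n q*_n`, that is, the polynomial `T_n` for which
`r_{n+1} - r_n = z ^ (n + 1 - λ_n - λ_{n+1}) T_n / (q_n q_{n+1})`,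
where `r_n = P_n / Q_n = p_n / q_n` (the division is exact). -/
def teleNum (n : ℕ) : ℂ[X] :=
  (X ^ (commonOrder (P n) (Q n) + commonOrder (P (n + 1)) (Q (n + 1))) *
    (redNum (P (n + 1)) (Q (n + 1)) * redDen (P n) (Q n) -
      redNum (P n) (Q n) * redDen (P (n + 1)) (Q (n + 1)))) /ₘ X ^ (n + 1)

/-- The normalized polynomial `q*_n` (equal to `1` when `r_{n+1} = r_n`). -/
def qStar (n : ℕ) : ℂ[X] := normPoly (teleNum P Q n).roots

/-- The constant `A_n`, which satisfies `teleNum n = A_n q*_n`. -/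
def teleConst (n : ℕ) : ℂ := (teleNum P Q n).leadingCoeff / (qStar P Q n).leadingCoeff

/-- `R* = (limsup |A_n| ^ (1 / n))⁻¹`, an element of `[0, ∞]`. -/
def RStar : ENNReal :=
  (limsup (fun n : ℕ => ENNReal.ofReal (‖teleConst P Q n‖ ^ (1 / (n : ℝ)))) atTop)⁻¹

/-- The distance from `ζ` to the set of zeros of `q_n` tends to zero (the distance to the empty
set is `∞`). -/
def IsLimitOfPoles (ζ : ℂ) : Prop :=
  Tendsto (fun n => Metric.infEDist ζ {z | (redDen (P n) (Q n)).IsRoot z}) atTop (𝓝 0)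

/-- The distance from `ζ` to the set of zeros of `q*_n` tends to zero as `n → ∞` along `Λ` (the
distance to the empty set is `∞`). -/
def IsLimitOfStarZeros (Λ : Set ℕ) (ζ : ℂ) : Prop :=
  Tendsto (fun n => Metric.infEDist ζ {z | (qStar P Q n).IsRoot z}) (atTop ⊓ 𝓟 Λ) (𝓝 0)

open Classical in
/-- The number `λ(ζ)` of zeros of `q_n`, counted with multiplicity, that tend to `ζ`: the largest
`k` such that every neighbourhood of `ζ` contains, for all large `n`, at least `k` zeros of `q_n`,
that is, such that the `k`-th closest zero of `q_n` to `ζ` tends to `ζ`. -/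
def limitCount (ζ : ℂ) : ℕ :=
  sSup {k : ℕ | ∀ ε > 0, ∀ᶠ n in atTop,
    k ≤ (redDen (P n) (Q n)).roots.countP fun z => dist z ζ < ε}

/-- `q_n → L` as `n → ∞`, coefficientwise (all `q_n` have degree at most `m`). -/
def DenTendsto (L : ℂ[X]) : Prop :=
  ∀ i, Tendsto (fun n => (redDen (P n) (Q n)).coeff i) atTop (𝓝 (L.coeff i))

end Sequences

/-- `B` is a regularizing sequence of `(a_n)_{n ≥ m}`, and `Λ` is an infinite sequence of indices
along which `|a_n|` is comparable with `B_n`. -/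
structure IsRegularization (m : ℕ) (a B : ℕ → ℝ) (Λ : Set ℕ) : Prop where
  pos : ∀ n, m ≤ n → 0 < B n
  ratio : Tendsto (fun n => B n / B (n + 1)) atTop (𝓝 1)
  concave : ∀ n, m ≤ n →
    Real.log (B n / (n.factorial : ℝ)) + Real.log (B (n + 2) / ((n + 2).factorial : ℝ)) ≤
      2 * Real.log (B (n + 1) / ((n + 1).factorial : ℝ))
  le : ∀ n, m ≤ n → |a n| ≤ B n
  infinite : Λ.Infinite
  ge : ∃ c > 0, ∀ n ∈ Λ, m ≤ n ∧ c * B n ≤ |a n|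

/-- The function `g` represents the formal power series `f` near the origin. -/
def Represents (f : PowerSeries ℂ) (g : ℂ → ℂ) : Prop :=
  ∀ᶠ z in 𝓝 (0 : ℂ), HasSum (fun n => PowerSeries.coeff n f * z ^ n) (g z)

/-- `ζ` is a pole of order `k` of `f`: `f` extends to a meromorphic function in an open disk centered
at the origin that contains `ζ`, with a pole of order exactly `k ≥ 1` at `ζ`. -/
def IsPoleOfOrder (f : PowerSeries ℂ) (ζ : ℂ) (k : ℕ) : Prop :=
  1 ≤ k ∧ ∃ ρ > ‖ζ‖, ∃ g : ℂ → ℂ, MeromorphicOn g (Metric.ball 0 ρ) ∧ Represents f g ∧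
    meromorphicOrderAt g ζ = ((-(k : ℤ) : ℤ) : WithTop ℤ)

/-- `ζ` (a point of the closed disk of radius `ρ`) is a regular point of `f`: the meromorphic
extension of `f` to the open disk of radius `ρ` extends holomorphically to a neighbourhood of
`ζ`. -/
def IsRegularPoint (f : PowerSeries ℂ) (ρ : ℝ) (ζ : ℂ) : Prop :=
  ∃ ε > 0, ∃ g : ℂ → ℂ, MeromorphicOn g (Metric.ball 0 ρ ∪ Metric.ball ζ ε) ∧
    AnalyticOnNhd ℂ g (Metric.ball ζ ε) ∧ Represents f g

/-- `f` extends to a meromorphic function in the open disk of radius `ρ`, and `ζ` is a point of the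
closed disk of radius `ρ` which is singular (not regular) for this extension. -/
def IsSingularPoint (f : PowerSeries ℂ) (ρ : ℝ) (ζ : ℂ) : Prop :=
  (∃ g : ℂ → ℂ, MeromorphicOn g (Metric.ball 0 ρ) ∧ Represents f g) ∧
    ‖ζ‖ ≤ ρ ∧ ¬ IsRegularPoint f ρ ζ

end IncompletePade

end

/-!
# Zeros of incomplete Padé denominators and singularities

For a row of incomplete Padé approximants `r_n = p_n / q_n` the differences telescope:
`r_{n+1} - r_n = A_n z ^ (n + 1 - λ_n - λ_{n+1}) q*_n / (q_n q_{n+1})`.  The first part of the file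
extracts this and the order of contact of `q_n f - p_n` from the definitions (`IsRow`,
`isRow_of_isApproximant`); afterwards only these two facts about the row are used.

*Meromorphic continuation.* The zeros of the `q_n` cannot spoil all circles around a point at once,
even geometrically as the index moves away from a given one (`exists_good_radius`). On good circles
the telescoping series converges, whence `q f` converges in `|z| < R` for a limit point `q` of the
denominators (`exists_denominator`), and `r_n → f` at good points (`tendsto_rat`).

*How `q*_n` sees the zeros of `q_n`.* Let `H` be holomorphic near `ζ`, let
`F_n = q_n H - (z - ζ) ^ κ p_n`, and suppose that at least `κ + 1` zeros of `q_n` tend to `ζ`.  Then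
`(q_{n+1} F_n - q_n F_{n+1}) / (z - ζ) ^ (κ + 1)` is, up to a power of `z`, equal to
`A_n q*_n / (z - ζ)`, and it is nearly holomorphic because `q_n / (z - ζ) ^ (κ + 1)` nearly is.
Comparing residues, `A_n q*_n(ζ)` is small compared with the size of the `F_n` near `ζ`.  So if
`F_n = O(B_n (|z| / R) ^ n)` near `ζ` for a regularizing sequence `B`, then `q*_n` has zeros that
tend to `ζ` along `Λ` (`eventually_exists_star_zero`).  It remains to prove this bound, where
`H = (z - ζ) ^ κ f` if `|ζ| < R`, `H = 0` if `|ζ| > R`, and `H` is the continuation of `f` if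
`|ζ| = R`.  For `|ζ| ≠ R` the telescoping sums on good circles are dominated by their terms of
index near `n`.

*The critical circle.* In the coordinate `z = ζ exp w` the increments of `u_n = f - r_n` are of
order `B_n exp (n re w)`, and concavity of `log (B_n / n!)` makes these weights behave, for indices
`k` near `n`, like a geometric sequence whose ratio is critical on the line `re w = -τ_n`,
`τ_n = log (B_{n+1} / B_n)`, up to the factor `exp (2 (k - n) ^ 2 / n)` (`gaussian_growth`).  Away
from this line a crude bound of `u_k` for indices `k` comparable with `n` becomes sharp
(`norm_le_of_crude`), and in a thin strip around the line a maximum principle damps a crude bound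
(`norm_le_of_thin_rectangle`).  Alternating between the two on finer and finer scales yields
`|re w + τ_n| |u_n| = O(B_n exp (n re w))` on horizontal segments
(`exists_bound_near_critical_line`); multiplying by a polynomial which vanishes at the two critical
points of the boundary of a rectangle gives the required bound inside
(`exists_bound_across_critical_line`).

*Existence of regularizing sequences.* `log B` is the least concave majorant of `log a_n + γ_n`
minus `γ_n`, where `γ` is a slowly varying correction which makes `log a_n + γ_n` unbounded
(`exists_slowly_decreasing`, `exists_concave_majorant`).

*Convergent denominators.* The zeros of the limit of the denominators which are regular points all
satisfy the first alternative, so that there are at most as many of them as `q*_n` has zeros.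
-/

namespace IncompletePade

/-! ### Normalized polynomials -/

open Classical in
/-- The factor of a normalized polynomial that belongs to the zero `ζ`. -/
noncomputable def normFactor (ζ : ℂ) : ℂ[X] := if ‖ζ‖ ≤ 1 then X - C ζ else 1 - C ζ⁻¹ * X

open Classical in
/-- The leading coefficient of `normFactor ζ`. -/
noncomputable def normScale (ζ : ℂ) : ℂ := if ‖ζ‖ ≤ 1 then 1 else -ζ⁻¹

lemma normScale_ne_zero (ζ : ℂ) : normScale ζ ≠ 0 := by
  unfold normScale
  split_ifs with h
  · exact one_ne_zero
  · have : ζ ≠ 0 := by rintro rfl; simp at h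
    simpa using this

lemma norm_normScale_le (ζ : ℂ) : ‖normScale ζ‖ ≤ 1 := by
  unfold normScale
  split_ifs with h
  · simp
  · rw [norm_neg, norm_inv]
    exact inv_le_one_of_one_le₀ (not_le.1 h).le

lemma normFactor_eq (ζ : ℂ) : normFactor ζ = C (normScale ζ) * (X - C ζ) := by
  unfold normFactor normScale
  split_ifs with h
  · simp
  · have h0 : ζ ≠ 0 := by rintro rfl; simp at h
    rw [mul_sub, ← C_mul, neg_mul, inv_mul_cancel₀ h0]
    simp only [C_neg, C_1]; ring

lemma normPoly_eq_prod (s : Multiset ℂ) : normPoly s = (s.map normFactor).prod := by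
  unfold normPoly normFactor
  rfl

@[simp] lemma normPoly_zero : normPoly 0 = 1 := by simp [normPoly]

lemma normPoly_cons (a : ℂ) (s : Multiset ℂ) : normPoly (a ::ₘ s) = normFactor a * normPoly s := by
  simp [normPoly_eq_prod]

lemma normPoly_add (s t : Multiset ℂ) : normPoly (s + t) = normPoly s * normPoly t := by
  simp [normPoly_eq_prod]

lemma normPoly_eq_C_mul (s : Multiset ℂ) :
    normPoly s = C (s.map normScale).prod * (s.map fun a => X - C a).prod := by
  induction s using Multiset.induction_on with
  | empty => simp
  | cons a s ih =>
    rw [normPoly_cons, ih, normFactor_eq]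
    simp only [Multiset.map_cons, Multiset.prod_cons, C_mul]; ring

lemma prod_normScale_ne_zero (s : Multiset ℂ) : (s.map normScale).prod ≠ 0 := by
  refine Multiset.prod_ne_zero fun h => ?_
  obtain ⟨a, -, ha⟩ := Multiset.mem_map.1 h
  exact normScale_ne_zero a ha

lemma norm_prod_normScale_le (s : Multiset ℂ) : ‖(s.map normScale).prod‖ ≤ 1 := by
  induction s using Multiset.induction_on with
  | empty => simp
  | cons a s ih =>
    simp only [Multiset.map_cons, Multiset.prod_cons, norm_mul]
    exact mul_le_one₀ (norm_normScale_le a) (norm_nonneg _) ih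

lemma monic_prod_X_sub_C (s : Multiset ℂ) : (s.map fun a => X - C a).prod.Monic :=
  monic_multiset_prod_of_monic _ _ fun a _ => monic_X_sub_C a

lemma leadingCoeff_normPoly (s : Multiset ℂ) :
    (normPoly s).leadingCoeff = (s.map normScale).prod := by
  rw [normPoly_eq_C_mul, leadingCoeff_mul, leadingCoeff_C, (monic_prod_X_sub_C s).leadingCoeff,
    mul_one]

lemma normPoly_ne_zero (s : Multiset ℂ) : normPoly s ≠ 0 := by
  rw [← leadingCoeff_ne_zero, leadingCoeff_normPoly]
  exact prod_normScale_ne_zero s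

@[simp] lemma roots_normPoly (s : Multiset ℂ) : (normPoly s).roots = s := by
  rw [normPoly_eq_C_mul, roots_C_mul _ (prod_normScale_ne_zero s), roots_multiset_prod_X_sub_C]

lemma natDegree_normPoly (s : Multiset ℂ) : (normPoly s).natDegree = s.card := by
  rw [← IsAlgClosed.card_roots_eq_natDegree, roots_normPoly]

lemma eq_C_mul_normPoly_roots (q : ℂ[X]) :
    q = C (q.leadingCoeff / (normPoly q.roots).leadingCoeff) * normPoly q.roots := by
  conv_lhs => rw [(IsAlgClosed.splits q).eq_prod_roots]
  rw [leadingCoeff_normPoly]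
  conv_rhs => rw [normPoly_eq_C_mul]
  rw [← mul_assoc, ← C_mul, div_mul_cancel₀ _ (prod_normScale_ne_zero _)]

lemma eval_normFactor_norm_le (a z : ℂ) : ‖(normFactor a).eval z‖ ≤ 1 + ‖z‖ := by
  unfold normFactor
  split_ifs with h
  · simp only [eval_sub, eval_X, eval_C]
    linarith [norm_sub_le z a]
  · simp only [eval_sub, eval_mul, eval_X, eval_C, eval_one]
    have h1 := norm_sub_le (1 : ℂ) (a⁻¹ * z)
    have h2 : ‖a⁻¹ * z‖ ≤ ‖z‖ := by
      rw [norm_mul, norm_inv]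
      exact mul_le_of_le_one_left (norm_nonneg _) (inv_le_one_of_one_le₀ (not_le.1 h).le)
    rw [norm_one] at h1; linarith

lemma eval_normFactor_norm_ge {a z : ℂ} {ε : ℝ} (hε0 : 0 ≤ ε) (hε1 : ε ≤ 1) (h : ε ≤ dist z a) :
    ε / (1 + ‖z‖) ≤ ‖(normFactor a).eval z‖ := by
  rw [dist_eq_norm] at h
  have hz : 0 < 1 + ‖z‖ := by positivity
  rw [normFactor_eq]
  simp only [eval_mul, eval_sub, eval_X, eval_C, norm_mul]
  unfold normScale
  split_ifs with ha
  · rw [norm_one, one_mul, div_le_iff₀ hz]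
    nlinarith [norm_nonneg z, norm_nonneg (z - a)]
  · rw [norm_neg, norm_inv, div_le_iff₀ hz, inv_mul_eq_div, div_mul_eq_mul_div,
      le_div_iff₀ (by linarith)]
    have h3 : ‖a‖ ≤ ‖z‖ + ‖z - a‖ := by
      have := norm_sub_le z (z - a); simpa using this
    nlinarith [norm_nonneg z, norm_nonneg (z - a)]

lemma norm_eval_normPoly_le (s : Multiset ℂ) (z : ℂ) {m : ℕ} (hs : s.card ≤ m) :
    ‖(normPoly s).eval z‖ ≤ (1 + ‖z‖) ^ m := by
  have h : ‖(normPoly s).eval z‖ ≤ (1 + ‖z‖) ^ s.card := by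
    clear hs
    induction s using Multiset.induction_on with
    | empty => simp
    | cons a s ih =>
      rw [normPoly_cons, eval_mul, norm_mul, Multiset.card_cons, pow_succ']
      exact mul_le_mul (eval_normFactor_norm_le a z) ih (norm_nonneg _) (by positivity)
  exact h.trans (pow_le_pow_right₀ (by linarith [norm_nonneg z]) hs)

/-- A normalized polynomial is bounded below at distance `ε` from its zeros, uniformly in the
zeros: this is what the normalization is for. -/
lemma le_norm_eval_normPoly {s : Multiset ℂ} {z : ℂ} {m : ℕ} (hs : s.card ≤ m) {ε : ℝ}
    (hε0 : 0 ≤ ε) (hε1 : ε ≤ 1) (h : ∀ a ∈ s, ε ≤ dist z a) :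
    (ε / (1 + ‖z‖)) ^ m ≤ ‖(normPoly s).eval z‖ := by
  have h1 : (ε / (1 + ‖z‖)) ^ s.card ≤ ‖(normPoly s).eval z‖ := by
    clear hs
    induction s using Multiset.induction_on with
    | empty => simp
    | cons a s ih =>
      rw [normPoly_cons, eval_mul, norm_mul, Multiset.card_cons, pow_succ']
      exact mul_le_mul (eval_normFactor_norm_ge hε0 hε1 (h a (Multiset.mem_cons_self a s)))
        (ih fun b hb => h b (Multiset.mem_cons_of_mem hb)) (by positivity) (norm_nonneg _)
  refine (pow_le_pow_of_le_one (by positivity) ?_ hs).trans h1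
  rw [div_le_one (by positivity)]
  linarith [norm_nonneg z]

/-- A monic polynomial with all zeros near `ζ` is near `(z - ζ) ^ k` on the unit disk around `ζ`. -/
lemma norm_prod_sub_pow_le (s : Multiset ℂ) {ζ z : ℂ} {ε : ℝ} (hε : ε ≤ 1)
    (hz : dist z ζ ≤ 1) (h : ∀ a ∈ s, dist a ζ ≤ ε) :
    ‖((s.map fun a => X - C a).prod).eval z - (z - ζ) ^ s.card‖ ≤ (2 ^ s.card - 1) * ε := by
  induction s using Multiset.induction_on with
  | empty => simp
  | cons a s ih =>
    have ih' := ih fun b hb => h b (Multiset.mem_cons_of_mem hb)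
    have ha := h a (Multiset.mem_cons_self a s)
    simp only [Multiset.map_cons, Multiset.prod_cons, eval_mul, eval_sub, eval_X, eval_C,
      Multiset.card_cons]
    set p := ((s.map fun a => X - C a).prod).eval z
    rw [dist_eq_norm] at hz ha
    have e : (z - a) * p - (z - ζ) ^ (s.card + 1)
        = (z - a) * (p - (z - ζ) ^ s.card) - (z - ζ) ^ s.card * (a - ζ) := by ring
    rw [e]
    refine (norm_sub_le _ _).trans ?_
    rw [norm_mul, norm_mul, norm_pow]
    have h1 : ‖z - a‖ ≤ 2 := by
      have := norm_sub_le (z - ζ) (a - ζ)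
      rw [show z - ζ - (a - ζ) = z - a by ring] at this; linarith
    have h2 : ‖z - ζ‖ ^ s.card ≤ 1 := pow_le_one₀ (norm_nonneg _) hz
    have h3 : ‖z - a‖ * ‖p - (z - ζ) ^ s.card‖ ≤ 2 * ((2 ^ s.card - 1) * ε) :=
      mul_le_mul h1 ih' (norm_nonneg _) (by norm_num)
    have h4 : ‖z - ζ‖ ^ s.card * ‖a - ζ‖ ≤ 1 * ε :=
      mul_le_mul h2 ha (norm_nonneg _) (by norm_num)
    calc _ ≤ 2 * ((2 ^ s.card - 1) * ε) + 1 * ε := add_le_add h3 h4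
      _ = _ := by ring

/-- If `k` zeros of a normalized polynomial lie near `ζ`, the polynomial is near a multiple of
`(z - ζ) ^ k`. -/
lemma exists_norm_eval_sub_pow_mul_le {s : Multiset ℂ} {m k : ℕ} (hs : s.card ≤ m) {ζ : ℂ} {ε : ℝ}
    (hε0 : 0 ≤ ε) (hε : ε ≤ 1) (hk : k ≤ s.countP fun a => dist a ζ < ε) :
    ∃ u : ℂ[X], ∀ z, dist z ζ ≤ 1 →
      ‖(normPoly s).eval z - (z - ζ) ^ k * u.eval z‖ ≤ 2 ^ m * ε * (2 + ‖ζ‖) ^ m := by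
  rw [Multiset.countP_eq_card_filter] at hk
  obtain ⟨t, ht⟩ := Multiset.card_pos_iff_exists_mem.1
    ((Multiset.card_powersetCard k _).symm ▸ Nat.choose_pos hk)
  obtain ⟨ht, htk⟩ := Multiset.mem_powersetCard.1 ht
  have hts : t ≤ s := ht.trans (Multiset.filter_le _ _)
  obtain ⟨s', rfl⟩ := Multiset.le_iff_exists_add.1 hts
  refine ⟨C (t.map normScale).prod * normPoly s', fun z hz => ?_⟩
  rw [normPoly_add, normPoly_eq_C_mul t]
  simp only [eval_mul, eval_C]
  set c := (t.map normScale).prod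
  set p := ((t.map fun a => X - C a).prod).eval z
  set v := (normPoly s').eval z
  have e : c * p * v - (z - ζ) ^ k * (c * v) = c * (p - (z - ζ) ^ k) * v := by ring
  rw [e, norm_mul, norm_mul]
  rw [Multiset.card_add] at hs
  have h1 : ‖p - (z - ζ) ^ k‖ ≤ 2 ^ m * ε := by
    have := norm_prod_sub_pow_le t hε hz fun a ha =>
      (Multiset.mem_filter.1 (Multiset.mem_of_le ht ha)).2.le
    rw [htk] at this
    refine this.trans ?_
    have h2 : (2 : ℝ) ^ k ≤ 2 ^ m := pow_le_pow_right₀ (by norm_num) (by omega)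
    nlinarith
  have h2 : ‖v‖ ≤ (2 + ‖ζ‖) ^ m := by
    refine (norm_eval_normPoly_le s' z (by omega : s'.card ≤ m)).trans ?_
    refine pow_le_pow_left₀ (by positivity) ?_ _
    have := norm_sub_norm_le z ζ
    rw [dist_eq_norm] at hz; linarith
  have h3 : ‖c‖ ≤ 1 := norm_prod_normScale_le t
  calc ‖c‖ * ‖p - (z - ζ) ^ k‖ * ‖v‖ ≤ 1 * (2 ^ m * ε) * (2 + ‖ζ‖) ^ m := by gcongr
    _ = _ := by ring

/-! ### Rows of approximants in lowest terms -/

/-- What the analysis uses about a row of approximants in lowest terms: denominators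
`q n = normPoly (s n)`, numerators `p n`, common orders `lam n`, telescoping constants `A n` and
telescoping polynomials `normPoly (t n)`. -/
structure IsRow (f : PowerSeries ℂ) (m m' : ℕ) (s : ℕ → Multiset ℂ) (p : ℕ → ℂ[X]) (lam : ℕ → ℕ)
    (A : ℕ → ℂ) (t : ℕ → Multiset ℂ) : Prop where
  card_le : ∀ n, m ≤ n → (s n).card ≤ m
  lam_le : ∀ n, m ≤ n → lam n ≤ m
  dvd : ∀ n, m ≤ n → (PowerSeries.X : PowerSeries ℂ) ^ (n + 1) ∣
    PowerSeries.X ^ lam n * ((normPoly (s n) : PowerSeries ℂ) * f - (p n : PowerSeries ℂ))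
  tele : ∀ n, m ≤ n → X ^ (lam n + lam (n + 1)) *
    (p (n + 1) * normPoly (s n) - p n * normPoly (s (n + 1))) =
      X ^ (n + 1) * (C (A n) * normPoly (t n))
  card_star_le : ∀ n, m ≤ n → (t n).card ≤ m - m'

lemma exists_eq_C_mul_commonFactor_mul (p : ℂ[X]) {q : ℂ[X]} (hq : q ≠ 0) :
    ∃ c : ℂ, c ≠ 0 ∧ q = C c * (commonFactor p q * redDen p q) ∧
      p = C c * (commonFactor p q * redNum p q) := by
  classical
  obtain ⟨p', hp'⟩ : commonFactor p q ∣ p := EuclideanDomain.gcd_dvd_left p q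
  obtain ⟨q', hq'⟩ : commonFactor p q ∣ q := EuclideanDomain.gcd_dvd_right p q
  set g := commonFactor p q with hg
  have hg0 : g ≠ 0 := by rintro h; rw [h, zero_mul] at hq'; exact hq hq'
  have hq'0 : q' ≠ 0 := by rintro h; rw [h, mul_zero] at hq'; exact hq hq'
  have hdiv : q / g = q' := by
    conv_lhs => rw [hq']
    exact mul_div_cancel_left₀ q' hg0
  have hred : redDen p q = normPoly q'.roots := by rw [redDen, ← hg, hdiv]
  set c := q'.leadingCoeff / (normPoly q'.roots).leadingCoeff with hc
  have hc0 : c ≠ 0 := div_ne_zero (leadingCoeff_ne_zero.2 hq'0)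
    (leadingCoeff_ne_zero.2 (normPoly_ne_zero _))
  have hqc : q' = C c * redDen p q := by rw [hred]; exact eq_C_mul_normPoly_roots q'
  have hcc : (C c : ℂ[X]) * C c⁻¹ = 1 := by rw [← C_mul, mul_inv_cancel₀ hc0, C_1]
  have hnum : redNum p q = C c⁻¹ * p' := by
    have : p * redDen p q = q * (C c⁻¹ * p') := by
      linear_combination redDen p q * hp' - C c⁻¹ * p' * hq' - C c⁻¹ * p' * g * hqc -
        g * p' * redDen p q * hcc
    rw [redNum, this]
    exact mul_div_cancel_left₀ _ hq
  refine ⟨c, hc0, ?_, ?_⟩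
  · conv_lhs => rw [hq', hqc]
    ring
  · rw [hnum]
    conv_lhs => rw [hp']
    linear_combination (-(g * p')) * hcc

/-- The common factor is `z ^ λ` times a factor that is invertible as a power series; only the power
of `z` can reduce the order of contact when it is cancelled. -/
lemma exists_commonFactor_eq_pow_mul (p : ℂ[X]) {q : ℂ[X]} (hq : q ≠ 0) :
    ∃ g : ℂ[X], g.coeff 0 ≠ 0 ∧ commonFactor p q = X ^ commonOrder p q * g := by
  have h0 : commonFactor p q ≠ 0 := by
    rintro h
    obtain ⟨c, -, h1, -⟩ := exists_eq_C_mul_commonFactor_mul p hq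
    rw [h, zero_mul, mul_zero] at h1
    exact hq h1
  obtain ⟨g, hg, hnd⟩ := exists_eq_pow_rootMultiplicity_mul_and_not_dvd _ h0 0
  rw [C_0, sub_zero] at hg hnd
  exact ⟨g, fun h => hnd (X_dvd_iff.2 h), hg⟩

/-- The order of contact after cancellation of common factors. -/
lemma IsApproximant.dvd_reduced {f : PowerSeries ℂ} {n m m' : ℕ} {p q : ℂ[X]}
    (h : IsApproximant f n m m' p q) : (PowerSeries.X : PowerSeries ℂ) ^ (n + 1) ∣
      PowerSeries.X ^ commonOrder p q *
        ((redDen p q : PowerSeries ℂ) * f - (redNum p q : PowerSeries ℂ)) := by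
  obtain ⟨c, hc, hq, hp⟩ := exists_eq_C_mul_commonFactor_mul p h.den_ne_zero
  obtain ⟨g, hg, hgX⟩ := exists_commonFactor_eq_pow_mul p h.den_ne_zero
  have h1 := h.dvd_remainder
  generalize redDen p q = d at *
  generalize redNum p q = e at *
  generalize commonOrder p q = l at *
  rw [hgX] at hq hp
  have hu : IsUnit ((C c * g : ℂ[X]) : PowerSeries ℂ) := by
    rw [PowerSeries.isUnit_iff_constantCoeff, ← PowerSeries.coeff_zero_eq_constantCoeff_apply,
      Polynomial.coeff_coe, coeff_C_mul]
    exact (mul_ne_zero hc hg).isUnit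
  rw [← hu.dvd_mul_left]
  convert h1 using 1
  rw [hq, hp]
  push_cast
  ring

lemma IsApproximant.natDegree_commonFactor_add_le {f : PowerSeries ℂ} {n m m' : ℕ} {p q : ℂ[X]}
    (h : IsApproximant f n m m' p q) :
    (commonFactor p q).natDegree + (redDen p q).natDegree ≤ m := by
  obtain ⟨c, hc, hq, hp⟩ := exists_eq_C_mul_commonFactor_mul p h.den_ne_zero
  have h0 := h.den_ne_zero
  rw [hq] at h0
  have := h.natDegree_den_le
  rwa [hq, natDegree_C_mul hc, natDegree_mul (left_ne_zero_of_mul (right_ne_zero_of_mul h0))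
    (right_ne_zero_of_mul (right_ne_zero_of_mul h0))] at this

lemma X_pow_dvd_of_coe {k : ℕ} {p : ℂ[X]}
    (h : (PowerSeries.X : PowerSeries ℂ) ^ k ∣ (p : PowerSeries ℂ)) : X ^ k ∣ p := by
  rw [PowerSeries.X_pow_dvd_iff] at h
  rw [Polynomial.X_pow_dvd_iff]
  intro d hd
  rw [← Polynomial.coeff_coe]
  exact h d hd

lemma redDen_eq_normPoly_roots (p q : ℂ[X]) : redDen p q = normPoly (redDen p q).roots := by
  rw [redDen, roots_normPoly]

lemma commonOrder_le_natDegree (p : ℂ[X]) {q : ℂ[X]} (hq : q ≠ 0) :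
    commonOrder p q ≤ (commonFactor p q).natDegree := by
  obtain ⟨g, hg, hgX⟩ := exists_commonFactor_eq_pow_mul p hq
  have hg0 : g ≠ 0 := by rintro rfl; simp at hg
  rw [hgX, natDegree_mul (pow_ne_zero _ X_ne_zero) hg0, natDegree_X_pow]
  omega

/-- Incomplete Padé approximants of a power series form a row in lowest terms. -/
theorem isRow_of_isApproximant {f : PowerSeries ℂ} {m m' : ℕ} (hm : m' ≤ m) {P Q : ℕ → ℂ[X]}
    (hPQ : ∀ n, m ≤ n → IsApproximant f n m m' (P n) (Q n)) :
    IsRow f m m' (fun n => (redDen (P n) (Q n)).roots) (fun n => redNum (P n) (Q n))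
      (fun n => commonOrder (P n) (Q n)) (teleConst P Q) (fun n => (teleNum P Q n).roots) := by
  have key : ∀ n, m ≤ n → X ^ (commonOrder (P n) (Q n) + commonOrder (P (n + 1)) (Q (n + 1))) *
      (redNum (P (n + 1)) (Q (n + 1)) * redDen (P n) (Q n) -
        redNum (P n) (Q n) * redDen (P (n + 1)) (Q (n + 1))) = X ^ (n + 1) * teleNum P Q n := by
    intro n hn
    have h0 := (hPQ n hn).dvd_reduced
    have h1 := (hPQ (n + 1) (by omega)).dvd_reduced
    set l0 := commonOrder (P n) (Q n)
    set l1 := commonOrder (P (n + 1)) (Q (n + 1))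
    set q0 := redDen (P n) (Q n)
    set q1 := redDen (P (n + 1)) (Q (n + 1))
    set p0 := redNum (P n) (Q n)
    set p1 := redNum (P (n + 1)) (Q (n + 1))
    have h1' : (PowerSeries.X : PowerSeries ℂ) ^ (n + 1) ∣ _ :=
      (pow_dvd_pow _ (by omega : n + 1 ≤ n + 1 + 1)).trans h1
    have h2 := (h0.mul_left (PowerSeries.X ^ l1 * (q1 : PowerSeries ℂ))).sub
      (h1'.mul_left (PowerSeries.X ^ l0 * (q0 : PowerSeries ℂ)))
    have h3 : X ^ (n + 1) ∣ X ^ (l0 + l1) * (p1 * q0 - p0 * q1) := by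
      apply X_pow_dvd_of_coe
      convert h2 using 1
      push_cast
      ring
    obtain ⟨T, hT⟩ := h3
    have : teleNum P Q n = T := by
      change (X ^ (l0 + l1) * (p1 * q0 - p0 * q1)) /ₘ X ^ (n + 1) = T
      rw [hT]
      exact mul_divByMonic_cancel_left _ (monic_X_pow _)
    rw [this, hT]
  refine ⟨fun n hn => ?_, fun n hn => ?_, fun n hn => ?_, fun n hn => ?_, fun n hn => ?_⟩
  · have := (hPQ n hn).natDegree_commonFactor_add_le
    rw [← IsAlgClosed.card_roots_eq_natDegree (p := redDen _ _)] at this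
    omega
  · have := (hPQ n hn).natDegree_commonFactor_add_le
    have := commonOrder_le_natDegree (P n) (hPQ n hn).den_ne_zero
    omega
  · rw [← redDen_eq_normPoly_roots]
    exact (hPQ n hn).dvd_reduced
  · simp only [← redDen_eq_normPoly_roots]
    rw [key n hn, teleConst, qStar, ← eq_C_mul_normPoly_roots]
  · rw [IsAlgClosed.card_roots_eq_natDegree]
    rcases eq_or_ne (teleNum P Q n) 0 with hT | hT
    · simp [hT]
    obtain ⟨c0, hc0, hq0, hp0⟩ := exists_eq_C_mul_commonFactor_mul (P n) (hPQ n hn).den_ne_zero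
    obtain ⟨g0, hg0, hg0X⟩ := exists_commonFactor_eq_pow_mul (P n) (hPQ n hn).den_ne_zero
    obtain ⟨c1, hc1, hq1, hp1⟩ := exists_eq_C_mul_commonFactor_mul (P (n + 1))
      (hPQ (n + 1) (by omega)).den_ne_zero
    obtain ⟨g1, hg1, hg1X⟩ := exists_commonFactor_eq_pow_mul (P (n + 1))
      (hPQ (n + 1) (by omega)).den_ne_zero
    have hk := key n hn
    rw [hg0X] at hq0 hp0
    rw [hg1X] at hq1 hp1
    have e : P (n + 1) * Q n - P n * Q (n + 1) =
        (C c0 * C c1 * g0 * g1) * (X ^ (n + 1) * teleNum P Q n) := by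
      rw [← hk]
      clear hk hT key hg0X hg1X
      generalize redDen (P n) (Q n) = d0 at *
      generalize redNum (P n) (Q n) = e0 at *
      generalize commonOrder (P n) (Q n) = l0 at *
      generalize redDen (P (n + 1)) (Q (n + 1)) = d1 at *
      generalize redNum (P (n + 1)) (Q (n + 1)) = e1 at *
      generalize commonOrder (P (n + 1)) (Q (n + 1)) = l1 at *
      rw [hq0, hp0, hq1, hp1]
      ring
    have hg0' : g0 ≠ 0 := by rintro rfl; simp at hg0
    have hg1' : g1 ≠ 0 := by rintro rfl; simp at hg1
    have hd : (n + 1) + (teleNum P Q n).natDegree ≤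
        (P (n + 1) * Q n - P n * Q (n + 1)).natDegree := by
      rw [e, natDegree_mul, natDegree_mul (pow_ne_zero _ X_ne_zero) hT, natDegree_X_pow]
      · omega
      · simp [hc0, hc1, hg0', hg1']
      · simp [hT]
    have b1 := (hPQ n hn).natDegree_num_le
    have b2 := (hPQ n hn).natDegree_den_le
    have b3 := (hPQ (n + 1) (by omega)).natDegree_num_le
    have b4 := (hPQ (n + 1) (by omega)).natDegree_den_le
    have c1 : (P (n + 1) * Q n).natDegree ≤ (n + 1 - m') + m :=
      natDegree_mul_le.trans (by omega)
    have c2 : (P n * Q (n + 1)).natDegree ≤ (n + 1 - m') + m :=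
      natDegree_mul_le.trans (by omega)
    have := natDegree_sub_le_of_le c1 c2
    simp only [max_self] at this
    omega

/-! ### Good circles -/

open MeasureTheory in
/-- A radius that stays away from prescribed numbers, with geometrically decreasing tolerances:
the excluded intervals are too short to cover `(a, b)`. -/
lemma exists_good_radius {a b : ℝ} (hab : a < b) (m : ℕ) {θ : ℝ} (h0 : 0 < θ) (h1 : θ < 1) :
    ∃ δ, 0 < δ ∧ δ ≤ 1 ∧ ∀ (φ : ℂ → ℝ) (s : ℕ → Multiset ℂ), (∀ k, (s k).card ≤ m) →
      ∃ r ∈ Set.Ioo a b, ∀ k, ∀ ξ ∈ s k, δ * θ ^ k ≤ |r - φ ξ| := by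
  classical
  set D : ℝ := min 1 ((b - a) * (1 - θ) / (4 * (m + 1))) with hD
  have hD0 : 0 < D := lt_min one_pos (by
    have : 0 < b - a := by linarith
    have : 0 < 1 - θ := by linarith
    positivity)
  refine ⟨D, hD0, min_le_left _ _, fun φ s hs => ?_⟩
  by_contra! hcon
  have hsub : Set.Ioo a b ⊆ ⋃ k, ⋃ ξ ∈ (s k).toFinset, Metric.ball (φ ξ) (D * θ ^ k) := by
    intro r hr
    obtain ⟨k, ξ, hξ, h⟩ := hcon r hr
    simp only [Set.mem_iUnion]
    exact ⟨k, ξ, Multiset.mem_toFinset.2 hξ, by rwa [Metric.mem_ball, Real.dist_eq]⟩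
  have hterm : ∀ k, volume (⋃ ξ ∈ (s k).toFinset, Metric.ball (φ ξ) (D * θ ^ k)) ≤
      ENNReal.ofReal (2 * m * D * θ ^ k) := by
    intro k
    refine (measure_biUnion_finset_le _ _).trans ?_
    simp only [Real.volume_ball, Finset.sum_const, nsmul_eq_mul]
    rw [← ENNReal.ofReal_natCast, ← ENNReal.ofReal_mul (by positivity)]
    refine ENNReal.ofReal_le_ofReal ?_
    have : ((s k).toFinset.card : ℝ) ≤ m := by
      exact_mod_cast (Multiset.toFinset_card_le _).trans (hs k)
    have h2 : 0 ≤ D * θ ^ k := by positivity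
    nlinarith
  have hsum : HasSum (fun k : ℕ => 2 * m * D * θ ^ k) (2 * m * D * (1 - θ)⁻¹) :=
    (hasSum_geometric_of_lt_one h0.le h1).mul_left _
  have hle : ENNReal.ofReal (b - a) ≤ ENNReal.ofReal (2 * m * D * (1 - θ)⁻¹) := by
    calc ENNReal.ofReal (b - a) = volume (Set.Ioo a b) := by rw [Real.volume_Ioo]
      _ ≤ _ := measure_mono hsub
      _ ≤ _ := measure_iUnion_le _
      _ ≤ ∑' k, ENNReal.ofReal (2 * m * D * θ ^ k) := ENNReal.tsum_le_tsum hterm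
      _ = _ := by
        rw [← ENNReal.ofReal_tsum_of_nonneg (fun k => by positivity) hsum.summable, hsum.tsum_eq]
  have h3 : 0 < 1 - θ := by linarith
  rw [ENNReal.ofReal_le_ofReal_iff (by positivity), ← div_eq_mul_inv, le_div_iff₀ h3] at hle
  have h4 : D ≤ (b - a) * (1 - θ) / (4 * (m + 1)) := min_le_right _ _
  rw [le_div_iff₀ (by positivity)] at h4
  have h5 : 0 < (b - a) * (1 - θ) := mul_pos (by linarith) h3
  nlinarith

/-- Around any center there is a circle, of radius in a given interval, on which all members of a
sequence of normalized polynomials are bounded below, with a geometric loss at an arbitrarily slow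
rate. -/
lemma exists_good_sphere (ζ : ℂ) {a b : ℝ} (ha : 0 ≤ a) (hab : a < b) (m : ℕ) {θ : ℝ} (h0 : 0 < θ)
    (h1 : θ < 1) :
    ∃ c, 0 < c ∧ ∀ s : ℕ → Multiset ℂ, (∀ k, (s k).card ≤ m) → ∃ r ∈ Set.Ioo a b,
      ∀ z, dist z ζ = r → ∀ k, c * θ ^ k ≤ ‖(normPoly (s k)).eval z‖ := by
  set η : ℝ := 1 - (1 - θ) / (m + 1) with hη
  have hfrac : (1 - θ) / (m + 1) ≤ 1 - θ := div_le_self (by linarith) (by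
    have : (0 : ℝ) ≤ m := Nat.cast_nonneg m
    linarith)
  have hfrac0 : 0 < (1 - θ) / (m + 1) := div_pos (by linarith) (by positivity)
  have hη0 : 0 < η := by linarith
  have hη1 : η < 1 := by linarith
  have hηm : θ ≤ η ^ m := by
    have h2 := one_add_mul_le_pow (a := -((1 - θ) / (m + 1))) (by linarith) m
    have h3 : (m : ℝ) * ((1 - θ) / (m + 1)) ≤ 1 - θ := by
      rw [mul_div_assoc', div_le_iff₀ (by positivity)]
      nlinarith
    calc θ ≤ 1 + (m : ℝ) * -((1 - θ) / (m + 1)) := by linarith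
      _ ≤ _ := h2
      _ = η ^ m := by rw [hη]; ring
  obtain ⟨δ, hδ0, hδ1, hδ⟩ := exists_good_radius hab m hη0 hη1
  set M := 1 + (‖ζ‖ + b) with hM
  have hM0 : 0 < M := by
    have := norm_nonneg ζ
    linarith
  refine ⟨(δ / M) ^ m, by positivity, fun s hs => ?_⟩
  obtain ⟨r, hr, h⟩ := hδ (fun ξ => dist ξ ζ) s hs
  refine ⟨r, hr, fun z hz k => ?_⟩
  have hzM : 1 + ‖z‖ ≤ M := by
    have h3 := norm_sub_norm_le z ζ
    rw [dist_eq_norm] at hz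
    linarith [hr.2]
  have hk1 : δ * η ^ k ≤ 1 := mul_le_one₀ hδ1 (by positivity) (pow_le_one₀ hη0.le hη1.le)
  refine le_trans ?_
    (le_norm_eval_normPoly (hs k) (by positivity : 0 ≤ δ * η ^ k) hk1 fun ξ hξ => ?_)
  · calc (δ / M) ^ m * θ ^ k ≤ (δ / M) ^ m * (η ^ m) ^ k := by gcongr
      _ = (δ * η ^ k / M) ^ m := by rw [← pow_mul, mul_comm m k, pow_mul, ← mul_pow]; congr 1; ring
      _ ≤ _ := by gcongr
  · refine (h k ξ hξ).trans ?_
    rw [← hz]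
    exact abs_dist_sub_le z ξ ζ

/-! ### Coefficient estimates and sums of power series -/

lemma iteratedDeriv_eval (p : ℂ[X]) (j : ℕ) :
    iteratedDeriv j (fun z => p.eval z) = fun z => (derivative^[j] p).eval z := by
  induction j generalizing p with
  | zero => simp
  | succ j ih =>
    rw [iteratedDeriv_succ', Function.iterate_succ_apply, ← ih]
    congr 1
    ext z
    exact p.deriv

lemma norm_coeff_le_of_forall_norm_eval_le (p : ℂ[X]) {ρ C : ℝ} (hρ : 0 < ρ)
    (h : ∀ z : ℂ, ‖z‖ = ρ → ‖p.eval z‖ ≤ C) (j : ℕ) : ‖p.coeff j‖ * ρ ^ j ≤ C := by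
  have h1 := Complex.norm_iteratedDeriv_le_of_forall_mem_sphere_norm_le (c := 0) (C := C) j hρ
    (f := fun z => p.eval z) p.differentiable.diffContOnCl (fun z hz => h z (by simpa using hz))
  rw [iteratedDeriv_eval] at h1
  simp only [← coeff_zero_eq_eval_zero, coeff_iterate_derivative, zero_add,
    Nat.descFactorial_self, nsmul_eq_mul, norm_mul, Complex.norm_natCast] at h1
  have hj : (0 : ℝ) < j.factorial := by exact_mod_cast j.factorial_pos
  rw [mul_div_assoc, mul_le_mul_iff_right₀ hj, le_div_iff₀ (by positivity)] at h1
  exact h1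

lemma hasSum_coe_mul (q : ℂ[X]) {g : PowerSeries ℂ} {z S : ℂ}
    (h : HasSum (fun j => PowerSeries.coeff j g * z ^ j) S) :
    HasSum (fun j => PowerSeries.coeff j ((q : PowerSeries ℂ) * g) * z ^ j) (q.eval z * S) := by
  have hX : ∀ {g : PowerSeries ℂ} {S : ℂ}, HasSum (fun j => PowerSeries.coeff j g * z ^ j) S →
      HasSum (fun j => PowerSeries.coeff j (PowerSeries.X * g) * z ^ j) (z * S) := by
    intro g S h
    rw [← hasSum_nat_add_iff' 1]
    simp only [PowerSeries.coeff_succ_X_mul, Finset.range_one, Finset.sum_singleton,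
      PowerSeries.coeff_zero_X_mul, zero_mul, sub_zero]
    have e : (fun j => PowerSeries.coeff j g * z ^ (j + 1)) =
        fun j => z * (PowerSeries.coeff j g * z ^ j) := by ext j; ring
    rw [e]
    exact h.mul_left z
  induction q using Polynomial.induction_on generalizing g S with
  | C a =>
    simp only [Polynomial.coe_C, PowerSeries.coeff_C_mul, eval_C, mul_assoc]
    exact h.mul_left a
  | add p q hp hq =>
    simp only [Polynomial.coe_add, add_mul, map_add, eval_add]
    exact (hp h).add (hq h)
  | monomial n a ih =>
    have := hX (ih h)
    convert this using 1
    · ext j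
      congr 2
      push_cast
      ring
    · simp only [eval_mul, eval_C, eval_pow, eval_X]; ring

/-- `PowerBound g ρ C`: the terms of the power series `g` at radius `ρ` are bounded by `C`. -/
def PowerBound (g : PowerSeries ℂ) (ρ C : ℝ) : Prop := ∀ j, ‖PowerSeries.coeff j g‖ * ρ ^ j ≤ C

lemma PowerBound.coe_mul {g : PowerSeries ℂ} {ρ C : ℝ} (hρ : 0 ≤ ρ) (h : PowerBound g ρ C)
    (q : ℂ[X]) {d : ℕ} (hd : q.natDegree ≤ d) :
    PowerBound (q * g) ρ ((∑ i ∈ Finset.range (d + 1), ‖q.coeff i‖ * ρ ^ i) * C) := by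
  have hC : 0 ≤ C := le_trans (by positivity) (h 0)
  intro j
  rw [PowerSeries.coeff_mul]
  calc ‖∑ x ∈ Finset.HasAntidiagonal.antidiagonal j, PowerSeries.coeff x.1 (q : PowerSeries ℂ) *
        PowerSeries.coeff x.2 g‖ * ρ ^ j
      ≤ (∑ x ∈ Finset.HasAntidiagonal.antidiagonal j,
          ‖q.coeff x.1‖ * ‖PowerSeries.coeff x.2 g‖) * ρ ^ j := by
        gcongr
        refine (norm_sum_le _ _).trans (le_of_eq ?_)
        exact Finset.sum_congr rfl fun x _ => by rw [norm_mul, Polynomial.coeff_coe]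
    _ = ∑ x ∈ Finset.HasAntidiagonal.antidiagonal j, (‖q.coeff x.1‖ * ρ ^ x.1) *
        (‖PowerSeries.coeff x.2 g‖ * ρ ^ x.2) := by
        rw [Finset.sum_mul]
        refine Finset.sum_congr rfl fun x hx => ?_
        rw [← Finset.HasAntidiagonal.mem_antidiagonal.1 hx, pow_add]; ring
    _ ≤ ∑ x ∈ Finset.HasAntidiagonal.antidiagonal j, (‖q.coeff x.1‖ * ρ ^ x.1) * C := by
        gcongr with x hx
        exact h x.2
    _ = (∑ i ∈ Finset.range (j + 1), ‖q.coeff i‖ * ρ ^ i) * C := by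
        rw [← Finset.sum_mul,
          Finset.Nat.sum_antidiagonal_eq_sum_range_succ (fun i _ => ‖q.coeff i‖ * ρ ^ i)]
    _ ≤ _ := by
        refine mul_le_mul_of_nonneg_right ?_ hC
        rcases le_total (j + 1) (d + 1) with hjd | hjd
        · exact Finset.sum_le_sum_of_subset_of_nonneg (Finset.range_mono hjd)
            fun _ _ _ => by positivity
        · refine le_of_eq (Finset.sum_subset (Finset.range_mono hjd) fun i _ hi => ?_).symm
          rw [Finset.mem_range, not_lt] at hi
          rw [coeff_eq_zero_of_natDegree_lt (by omega), norm_zero, zero_mul]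

lemma PowerBound.sub {g h : PowerSeries ℂ} {ρ C D : ℝ} (hρ : 0 ≤ ρ) (hg : PowerBound g ρ C)
    (hh : PowerBound h ρ D) : PowerBound (g - h) ρ (C + D) := by
  intro j
  rw [map_sub]
  calc _ ≤ (‖PowerSeries.coeff j g‖ + ‖PowerSeries.coeff j h‖) * ρ ^ j := by
        gcongr; exact norm_sub_le _ _
    _ ≤ _ := by rw [add_mul]; exact add_le_add (hg j) (hh j)

lemma PowerBound.of_X_pow_mul {g : PowerSeries ℂ} {ρ C : ℝ} (hρ : 0 < ρ) {n : ℕ}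
    (h : PowerBound (PowerSeries.X ^ n * g) ρ C) : PowerBound g ρ (C / ρ ^ n) := by
  intro j
  rw [le_div_iff₀ (by positivity), mul_assoc, ← pow_add]
  have := h (j + n)
  rwa [PowerSeries.coeff_X_pow_mul] at this

lemma PowerBound.summable_norm {g : PowerSeries ℂ} {ρ C : ℝ} (h : PowerBound g ρ C) {x : ℝ}
    (hx0 : 0 ≤ x) (hx : x < ρ) : Summable fun j => ‖PowerSeries.coeff j g‖ * x ^ j := by
  have hρ : 0 < ρ := hx0.trans_lt hx
  refine Summable.of_nonneg_of_le (fun j => by positivity) (fun j => ?_)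
    ((summable_geometric_of_lt_one (div_nonneg hx0 hρ.le) ((div_lt_one hρ).2 hx)).mul_left C)
  calc ‖PowerSeries.coeff j g‖ * x ^ j = (‖PowerSeries.coeff j g‖ * ρ ^ j) * (x / ρ) ^ j := by
        rw [div_pow]; field_simp
    _ ≤ _ := by gcongr; exact h j

/-- The sum of a power series. -/
noncomputable def psum (g : PowerSeries ℂ) (z : ℂ) : ℂ := ∑' j, PowerSeries.coeff j g * z ^ j

lemma PowerBound.hasSum {g : PowerSeries ℂ} {ρ C : ℝ} (h : PowerBound g ρ C) {z : ℂ}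
    (hz : ‖z‖ < ρ) : HasSum (fun j => PowerSeries.coeff j g * z ^ j) (psum g z) := by
  refine Summable.hasSum (Summable.of_norm ?_)
  simpa only [norm_mul, norm_pow] using h.summable_norm (norm_nonneg z) hz

lemma PowerBound.norm_psum_le {g : PowerSeries ℂ} {ρ C : ℝ} (h : PowerBound g ρ C) {x : ℝ} {z : ℂ}
    (hz : ‖z‖ ≤ x) (hx : x < ρ) : ‖psum g z‖ ≤ C * (1 - x / ρ)⁻¹ := by
  have hx0 : 0 ≤ x := (norm_nonneg z).trans hz
  have hρ : 0 < ρ := hx0.trans_lt hx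
  refine tsum_of_norm_bounded
    ((hasSum_geometric_of_lt_one (div_nonneg hx0 hρ.le) ((div_lt_one hρ).2 hx)).mul_left C)
    fun j => ?_
  rw [norm_mul, norm_pow]
  calc ‖PowerSeries.coeff j g‖ * ‖z‖ ^ j ≤ ‖PowerSeries.coeff j g‖ * x ^ j := by gcongr
    _ = (‖PowerSeries.coeff j g‖ * ρ ^ j) * (x / ρ) ^ j := by
        rw [div_pow]; field_simp
    _ ≤ _ := by gcongr; exact h j

lemma PowerBound.differentiableOn_psum {g : PowerSeries ℂ} {ρ C : ℝ} (h : PowerBound g ρ C) :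
    DifferentiableOn ℂ (psum g) (Metric.ball 0 ρ) := by
  intro z hz
  rw [mem_ball_zero_iff] at hz
  obtain ⟨x, hzx, hxρ⟩ := exists_between hz
  have hd : DifferentiableOn ℂ (psum g) (Metric.ball 0 x) := by
    refine Complex.differentiableOn_tsum_of_summable_norm
      (h.summable_norm ((norm_nonneg z).trans hzx.le) hxρ)
      (fun j => ((differentiable_id.pow j).const_mul _).differentiableOn) Metric.isOpen_ball
      fun j w hw => ?_
    rw [mem_ball_zero_iff] at hw
    rw [norm_mul, norm_pow]
    gcongr
  exact (hd.differentiableAt (Metric.isOpen_ball.mem_nhds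
    (mem_ball_zero_iff.2 hzx))).differentiableWithinAt

/-! ### Meromorphic continuation of the power series -/

/-- The value of the `n`-th approximant. -/
noncomputable def rat (s : ℕ → Multiset ℂ) (p : ℕ → ℂ[X]) (n : ℕ) (z : ℂ) : ℂ :=
  (p n).eval z / (normPoly (s n)).eval z

lemma exists_lt_pow {x : ℝ} (hx : x < 1) (N : ℕ) : ∃ θ : ℝ, 0 < θ ∧ θ < 1 ∧ x < θ ^ N := by
  have h1 : Tendsto (fun θ : ℝ => θ ^ N) (𝓝[<] 1) (𝓝 1) := by
    have : Tendsto (fun θ : ℝ => θ ^ N) (𝓝 1) (𝓝 (1 ^ N)) := (continuous_pow N).tendsto 1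
    rw [one_pow] at this
    exact this.mono_left nhdsWithin_le_nhds
  have h2 : ∀ᶠ θ : ℝ in 𝓝[<] 1, θ ∈ Set.Ioo (0 : ℝ) 1 := Ioo_mem_nhdsLT one_pos
  obtain ⟨θ, h3, h4⟩ := ((h1.eventually (lt_mem_nhds hx)).and h2).exists
  exact ⟨θ, h4.1, h4.2, h3⟩

lemma norm_inv_pow_le {μ : ℝ} (hμ : 0 < μ) {z : ℂ} (hz : μ ≤ ‖z‖) {l N : ℕ} (hl : l ≤ N) :
    (‖z‖ ^ l)⁻¹ ≤ (max 1 μ⁻¹) ^ N := by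
  rw [← inv_pow]
  have h1 : ‖z‖⁻¹ ≤ max 1 μ⁻¹ := (inv_anti₀ hμ hz).trans (le_max_right _ _)
  exact (pow_le_pow_left₀ (by positivity) h1 l).trans (pow_le_pow_right₀ (le_max_left _ _) hl)

namespace IsRow

variable {f : PowerSeries ℂ} {m m' : ℕ} {s : ℕ → Multiset ℂ} {p : ℕ → ℂ[X]} {lam : ℕ → ℕ}
  {A : ℕ → ℂ} {t : ℕ → Multiset ℂ} {R : ℝ}

/-- On an annulus the increments of the approximants are controlled by the telescoping constants
and lower bounds of the denominators. -/
lemma exists_norm_rat_sub_le (h : IsRow f m m' s p lam A t) {μ : ℝ} (hμ : 0 < μ) (M : ℝ) :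
    ∃ K, 0 ≤ K ∧ ∀ n, m ≤ n → ∀ z : ℂ, μ ≤ ‖z‖ → ‖z‖ ≤ M → ∀ c c' : ℝ, 0 < c → 0 < c' →
      c ≤ ‖(normPoly (s n)).eval z‖ → c' ≤ ‖(normPoly (s (n + 1))).eval z‖ →
      ‖rat s p (n + 1) z - rat s p n z‖ ≤ K * (‖A n‖ * ‖z‖ ^ n) / (c * c') := by
  refine ⟨|M| * (max 1 μ⁻¹) ^ (2 * m) * (1 + |M|) ^ m, by positivity,
    fun n hn z hzμ hzM c c' hc hc' hq hq' => ?_⟩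
  have hz0 : 0 < ‖z‖ := hμ.trans_le hzμ
  have hz0' : z ≠ 0 := norm_pos_iff.1 hz0
  have e := congrArg (Polynomial.eval z) (h.tele n hn)
  simp only [eval_mul, eval_pow, eval_X, eval_sub, eval_C] at e
  have hq0 : (normPoly (s n)).eval z ≠ 0 := norm_pos_iff.1 (hc.trans_le hq)
  have hq0' : (normPoly (s (n + 1))).eval z ≠ 0 := norm_pos_iff.1 (hc'.trans_le hq')
  set l := lam n + lam (n + 1) with hl
  have e2 : rat s p (n + 1) z - rat s p n z = z ^ (n + 1) * (A n * (normPoly (t n)).eval z) *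
      (z ^ l)⁻¹ / ((normPoly (s n)).eval z * (normPoly (s (n + 1))).eval z) := by
    rw [← e, rat, rat]
    field_simp
  rw [e2, norm_div, norm_mul, norm_mul, norm_mul, norm_mul, norm_inv, norm_pow, norm_pow]
  have hM : ‖z‖ ≤ |M| := hzM.trans (le_abs_self M)
  have ht : ‖(normPoly (t n)).eval z‖ ≤ (1 + |M|) ^ m :=
    (norm_eval_normPoly_le (t n) z ((h.card_star_le n hn).trans (Nat.sub_le _ _))).trans
      (by gcongr)
  have hl2 : l ≤ 2 * m := by
    have := h.lam_le n hn
    have := h.lam_le (n + 1) (by omega)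
    omega
  have hinv := norm_inv_pow_le hμ hzμ hl2
  calc ‖z‖ ^ (n + 1) * (‖A n‖ * ‖(normPoly (t n)).eval z‖) * (‖z‖ ^ l)⁻¹ /
        (‖(normPoly (s n)).eval z‖ * ‖(normPoly (s (n + 1))).eval z‖)
      = ‖z‖ * (‖z‖ ^ l)⁻¹ * ‖(normPoly (t n)).eval z‖ * (‖A n‖ * ‖z‖ ^ n) /
        (‖(normPoly (s n)).eval z‖ * ‖(normPoly (s (n + 1))).eval z‖) := by
        rw [pow_succ]; ring
    _ ≤ _ := by gcongr

lemma norm_coeff_normPoly_le {u : Multiset ℂ} (hu : u.card ≤ m) (i : ℕ) :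
    ‖(normPoly u).coeff i‖ ≤ 2 ^ m := by
  have := norm_coeff_le_of_forall_norm_eval_le (normPoly u) one_pos (C := 2 ^ m) (fun z hz => by
    refine (norm_eval_normPoly_le u z hu).trans (le_of_eq ?_)
    rw [hz]; norm_num) i
  simpa using this

/-- The numerators are bounded on every closed disk inside the disk of convergence. -/
lemma exists_powerBound_num (h : IsRow f m m' s p lam A t)
    (hA : ∀ r, 0 < r → r < R → ∃ C, ∀ n, m ≤ n → ‖A n‖ * r ^ n ≤ C) {r : ℝ} (hr : 0 < r)
    (hrR : r < R) : ∃ C, ∀ n, m ≤ n → PowerBound (p n) r C := by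
  obtain ⟨r1, hr1, hr1R⟩ := exists_between hrR
  obtain ⟨r2, hr2, hr2R⟩ := exists_between hr1R
  have hr10 : 0 < r1 := hr.trans hr1
  have hr20 : 0 < r2 := hr10.trans hr2
  obtain ⟨θ, hθ0, hθ1, hθ⟩ := exists_lt_pow ((div_lt_one hr20).2 hr2) 2
  obtain ⟨c, hc, hsph⟩ := exists_good_sphere 0 hr.le hr1 m hθ0 hθ1
  obtain ⟨ρ, ⟨hρ, hρ1⟩, hq⟩ := hsph (fun k => s (m + k)) fun k => h.card_le _ (by omega)
  have hρ0 : 0 < ρ := hr.trans hρ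
  obtain ⟨C2, hC2⟩ := hA r2 hr20 hr2R
  have hC20 : 0 ≤ C2 := le_trans (by positivity) (hC2 m le_rfl)
  obtain ⟨K, hK0, hK⟩ := h.exists_norm_rat_sub_le hr r1
  obtain ⟨D, hD⟩ := (isCompact_closedBall (0 : ℂ) r1).exists_bound_of_continuousOn
    (p m).continuous.continuousOn
  -- `y` is the ratio of the geometric series that dominates the telescoping sum
  set y : ℝ := (r1 / r2) / θ ^ 2 with hy
  have hy0 : 0 < y := by positivity
  have hy1 : y < 1 := (div_lt_one (by positivity)).2 hθ
  set E : ℝ := K * C2 * (r1 / r2) ^ m / (c * c * θ) with hE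
  have hE0 : 0 ≤ E := by positivity
  have hstep : ∀ z : ℂ, ‖z‖ = ρ → ∀ i, dist (rat s p (m + i) z) (rat s p (m + (i + 1)) z) ≤
      E * y ^ i := by
    intro z hz i
    rw [dist_comm, dist_eq_norm]
    have hz' : dist z 0 = ρ := by simpa using hz
    refine (hK (m + i) (by omega) z (by rw [hz]; exact hρ.le) (by rw [hz]; exact hρ1.le)
      (c * θ ^ i) (c * θ ^ (i + 1)) (by positivity) (by positivity) (hq z hz' i)
      (hq z hz' (i + 1))).trans ?_
    have h3 : ‖A (m + i)‖ * ‖z‖ ^ (m + i) ≤ C2 * (r1 / r2) ^ (m + i) := by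
      rw [hz]
      calc ‖A (m + i)‖ * ρ ^ (m + i) ≤ ‖A (m + i)‖ * r1 ^ (m + i) := by gcongr
        _ = (‖A (m + i)‖ * r2 ^ (m + i)) * (r1 / r2) ^ (m + i) := by
          rw [div_pow]; field_simp
        _ ≤ _ := by gcongr; exact hC2 _ (by omega)
    calc K * (‖A (m + i)‖ * ‖z‖ ^ (m + i)) / (c * θ ^ i * (c * θ ^ (i + 1)))
        ≤ K * (C2 * (r1 / r2) ^ (m + i)) / (c * θ ^ i * (c * θ ^ (i + 1))) := by gcongr
      _ = E * y ^ i := by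
        rw [hE, hy, div_pow (r1 / r2), ← pow_mul, pow_add (r1 / r2), pow_succ, mul_comm 2 i,
          pow_mul]
        generalize (r1 / r2) ^ m = a1
        generalize (r1 / r2) ^ i = a2
        field_simp
  have hrat : ∀ z : ℂ, ‖z‖ = ρ → ∀ n, m ≤ n → ‖rat s p n z‖ ≤ D / c + E * (1 - y)⁻¹ := by
    intro z hz n hn
    obtain ⟨i, rfl⟩ := Nat.exists_eq_add_of_le hn
    have h4 := dist_le_range_sum_of_dist_le (f := fun i => rat s p (m + i) z) i
      (fun {k} _ => hstep z hz k)
    have h5 : ∑ k ∈ Finset.range i, E * y ^ k ≤ E * (1 - y)⁻¹ :=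
      sum_le_hasSum _ (fun k _ => by positivity)
        ((hasSum_geometric_of_lt_one hy0.le hy1).mul_left E)
    have h6 : ‖rat s p m z‖ ≤ D / c := by
      rw [rat, norm_div]
      have h7 := hD z (by rw [mem_closedBall_zero_iff, hz]; exact hρ1.le)
      have h8 := hq z (by simpa using hz) 0
      simp only [pow_zero, mul_one, add_zero] at h8
      gcongr
      exact (norm_nonneg _).trans h7
    rw [dist_comm, dist_eq_norm] at h4
    simp only [add_zero] at h4
    have h9 := norm_sub_norm_le (rat s p (m + i) z) (rat s p m z)
    linarith
  refine ⟨(D / c + E * (1 - y)⁻¹) * (1 + r1) ^ m, fun n hn j => ?_⟩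
  have hp : ∀ z : ℂ, ‖z‖ = ρ → ‖(p n).eval z‖ ≤ (D / c + E * (1 - y)⁻¹) * (1 + r1) ^ m := by
    intro z hz
    have hq0 : (normPoly (s n)).eval z ≠ 0 := by
      obtain ⟨i, rfl⟩ := Nat.exists_eq_add_of_le hn
      have := hq z (by simpa using hz) i
      exact norm_pos_iff.1 (lt_of_lt_of_le (by positivity) this)
    have e : (p n).eval z = rat s p n z * (normPoly (s n)).eval z := by
      rw [rat, div_mul_cancel₀ _ hq0]
    rw [e, norm_mul]
    have := hrat z hz n hn
    have h10 := norm_eval_normPoly_le (s n) z (h.card_le n hn)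
    have h11 : (1 + ‖z‖) ^ m ≤ (1 + r1) ^ m := by rw [hz]; gcongr
    exact mul_le_mul this (h10.trans h11) (norm_nonneg _) ((norm_nonneg _).trans this)
  rw [Polynomial.coeff_coe]
  refine le_trans ?_ (norm_coeff_le_of_forall_norm_eval_le (p n) hρ0 hp j)
  gcongr

/-- The low coefficients of `q_n f` and `p_n` agree: by `λ_n ≤ m`, cancellation costs at most `m`
orders of contact. -/
lemma coeff_mul_eq_coeff_num (h : IsRow f m m' s p lam A t) {n j : ℕ} (hn : m ≤ n)
    (hj : j + m ≤ n) : PowerSeries.coeff j ((normPoly (s n) : PowerSeries ℂ) * f) =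
      (p n).coeff j := by
  have h1 := h.dvd n hn
  rw [PowerSeries.X_pow_dvd_iff] at h1
  have h2 := h1 (j + lam n) (by have := h.lam_le n hn; omega)
  rwa [PowerSeries.coeff_X_pow_mul, map_sub, sub_eq_zero, Polynomial.coeff_coe] at h2

/-- A subsequence of the denominators converges to a polynomial `q ≠ 0`, and `q f` converges
wherever the numerators are bounded; common zeros at the origin are removed. -/
theorem exists_denominator (h : IsRow f m m' s p lam A t)
    (hA : ∀ r, 0 < r → r < R → ∃ C, ∀ n, m ≤ n → ‖A n‖ * r ^ n ≤ C) :
    ∃ q : ℂ[X], q.coeff 0 ≠ 0 ∧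
      (∀ L : ℂ[X], (∀ i, Tendsto (fun n => (normPoly (s n)).coeff i) atTop (𝓝 (L.coeff i))) →
        L.coeff 0 ≠ 0 → q = L) ∧
      ∀ r, 0 < r → r < R → ∃ C, PowerBound (q * f) r C := by
  -- extraction of a convergent subsequence of coefficient vectors
  set v : ℕ → Fin (m + 1) → ℂ := fun k i => (normPoly (s (m + k))).coeff i with hv
  have hvb : ∀ k, v k ∈ Metric.closedBall (0 : Fin (m + 1) → ℂ) (2 ^ m) := by
    intro k
    rw [mem_closedBall_zero_iff, pi_norm_le_iff_of_nonneg (by positivity)]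
    exact fun i => norm_coeff_normPoly_le (h.card_le _ (by omega)) _
  obtain ⟨a, -, φ, hφ, hlim⟩ := tendsto_subseq_of_bounded Metric.isBounded_closedBall hvb
  set q0 : ℂ[X] := ∑ i : Fin (m + 1), C (a i) * X ^ (i : ℕ) with hq0
  have hcoeff : ∀ i, Tendsto (fun k => (normPoly (s (m + φ k))).coeff i) atTop
      (𝓝 (q0.coeff i)) := by
    intro i
    by_cases hi : i < m + 1
    · have e : q0.coeff i = a ⟨i, hi⟩ := by
        rw [hq0, finsetSum_coeff]
        simp only [coeff_C_mul, coeff_X_pow]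
        rw [Finset.sum_eq_single ⟨i, hi⟩]
        · simp
        · intro b _ hb
          rw [if_neg, mul_zero]
          rintro rfl
          exact hb rfl
        · simp
      rw [e]
      exact (tendsto_pi_nhds.1 hlim) ⟨i, hi⟩
    · have e : q0.coeff i = 0 := by
        rw [hq0, finsetSum_coeff]
        refine Finset.sum_eq_zero fun b _ => ?_
        rw [coeff_C_mul, coeff_X_pow, if_neg, mul_zero]
        have := b.2
        omega
      rw [e]
      refine tendsto_const_nhds.congr fun k => (coeff_eq_zero_of_natDegree_lt ?_).symm
      rw [natDegree_normPoly]
      have := h.card_le (m + φ k) (by omega)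
      omega
  have hq0ne : q0 ≠ 0 := by
    intro hzero
    obtain ⟨c, hc, hsph⟩ := exists_good_sphere 0 le_rfl one_pos m (by norm_num : (0 : ℝ) < 1 / 2)
      (by norm_num)
    have hlow : ∀ k, c ≤ ∑ i ∈ Finset.range (m + 1), ‖(normPoly (s (m + φ k))).coeff i‖ := by
      intro k
      have hcard := h.card_le (m + φ k) (by omega)
      obtain ⟨r, hr, hz⟩ := hsph (fun _ => s (m + φ k)) fun _ => hcard
      have h1 := hz (r : ℂ) (by simp [abs_of_pos hr.1]) 0
      rw [pow_zero, mul_one] at h1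
      refine h1.trans ?_
      rw [eval_eq_sum_range' (n := m + 1) (by rw [natDegree_normPoly]; omega)]
      refine (norm_sum_le _ _).trans (Finset.sum_le_sum fun i _ => ?_)
      rw [norm_mul, norm_pow, Complex.norm_real, Real.norm_of_nonneg hr.1.le]
      exact mul_le_of_le_one_right (norm_nonneg _) (pow_le_one₀ hr.1.le hr.2.le)
    have hl0 : Tendsto (fun k => ∑ i ∈ Finset.range (m + 1), ‖(normPoly (s (m + φ k))).coeff i‖)
        atTop (𝓝 (∑ i ∈ Finset.range (m + 1), ‖q0.coeff i‖)) :=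
      tendsto_finsetSum _ fun i _ => (hcoeff i).norm
    have := ge_of_tendsto' hl0 hlow
    simp [hzero] at this
    linarith
  have hbound : ∀ r, 0 < r → r < R → ∃ C, PowerBound (q0 * f) r C := by
    intro r hr hrR
    obtain ⟨C, hC⟩ := h.exists_powerBound_num hA hr hrR
    refine ⟨C, fun j => ?_⟩
    have hl : Tendsto (fun k => PowerSeries.coeff j ((normPoly (s (m + φ k)) : PowerSeries ℂ) * f))
        atTop (𝓝 (PowerSeries.coeff j ((q0 : PowerSeries ℂ) * f))) := by
      simp only [PowerSeries.coeff_mul, Polynomial.coeff_coe]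
      exact tendsto_finsetSum _ fun x _ => (hcoeff x.1).mul tendsto_const_nhds
    refine le_of_tendsto (hl.norm.mul_const (r ^ j)) ?_
    filter_upwards [eventually_ge_atTop j] with k hk
    have : k ≤ φ k := hφ.le_apply
    rw [h.coeff_mul_eq_coeff_num (by omega) (by omega), ← Polynomial.coeff_coe]
    exact hC _ (by omega) j
  obtain ⟨q, hq, hnd⟩ := exists_eq_pow_rootMultiplicity_mul_and_not_dvd q0 hq0ne 0
  rw [C_0, sub_zero] at hq hnd
  rw [X_dvd_iff] at hnd
  refine ⟨q, hnd, fun L hL hL0 => ?_, fun r hr hrR => ?_⟩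
  · have e : q0 = L := by
      ext i
      refine tendsto_nhds_unique (hcoeff i) ((hL i).comp ?_)
      exact tendsto_atTop_mono
        (fun k => by have : k ≤ φ k := hφ.le_apply; simp only [id]; omega) tendsto_id
    have hr0 : q0.rootMultiplicity 0 = 0 := by
      refine rootMultiplicity_eq_zero ?_
      rwa [IsRoot.def, ← coeff_zero_eq_eval_zero, e]
    rw [hr0, pow_zero, one_mul] at hq
    rw [← hq, e]
  · obtain ⟨C, hC⟩ := hbound r hr hrR
    rw [hq] at hC
    push_cast at hC
    rw [mul_assoc] at hC
    exact ⟨_, hC.of_X_pow_mul hr⟩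

/-- The remainders `q_n (q f) - q p_n`, divided by their zero at the origin, as power series. -/
theorem exists_remainder (h : IsRow f m m' s p lam A t)
    (hA : ∀ r, 0 < r → r < R → ∃ C, ∀ n, m ≤ n → ‖A n‖ * r ^ n ≤ C) {q : ℂ[X]}
    (hq : ∀ r, 0 < r → r < R → ∃ C, PowerBound (q * f) r C) :
    ∃ G : ℕ → PowerSeries ℂ,
      (∀ n, m ≤ n → ∀ z : ℂ, ‖z‖ < R → z ^ (n + 1) * psum (G n) z =
        z ^ lam n * ((normPoly (s n)).eval z * psum ((q : PowerSeries ℂ) * f) z -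
          q.eval z * (p n).eval z)) ∧
      ∀ r, 0 < r → r < R → ∃ K, ∀ n, m ≤ n → PowerBound (G n) r (K / r ^ (n + 1)) := by
  have hex : ∀ n, ∃ G : PowerSeries ℂ, m ≤ n → ((X ^ lam n : ℂ[X]) : PowerSeries ℂ) *
      ((normPoly (s n) : PowerSeries ℂ) * ((q : PowerSeries ℂ) * f) -
        (q : PowerSeries ℂ) * (p n : PowerSeries ℂ)) =
        PowerSeries.X ^ (n + 1) * G := by
    intro n
    by_cases hn : m ≤ n
    · obtain ⟨G, hG⟩ := (h.dvd n hn).mul_left (q : PowerSeries ℂ)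
      refine ⟨G, fun _ => ?_⟩
      rw [← hG]
      push_cast
      ring
    · exact ⟨0, fun hn' => absurd hn' hn⟩
  choose G hG using hex
  have hb : ∀ r, 0 < r → r < R → ∃ K, ∀ n, m ≤ n → PowerBound (G n) r (K / r ^ (n + 1)) := by
    intro r hr hrR
    obtain ⟨C1, hC1⟩ := hq r hr hrR
    obtain ⟨C2, hC2⟩ := h.exists_powerBound_num hA hr hrR
    have hC10 : 0 ≤ C1 := le_trans (by positivity) (hC1 0)
    have hC20 : 0 ≤ C2 := le_trans (by positivity) (hC2 m le_rfl 0)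
    set S : ℝ := ∑ i ∈ Finset.range (m + 1), 2 ^ m * r ^ i with hS
    set Q : ℝ := ∑ i ∈ Finset.range (q.natDegree + 1), ‖q.coeff i‖ * r ^ i with hQ
    refine ⟨S * (S * C1 + Q * C2), fun n hn => PowerBound.of_X_pow_mul hr ?_⟩
    rw [← hG n hn]
    have b1 := hC1.coe_mul hr.le (normPoly (s n))
      ((natDegree_normPoly _).trans_le (h.card_le n hn))
    have b2 := (hC2 n hn).coe_mul hr.le q le_rfl
    have b3 := (b1.sub hr.le b2).coe_mul hr.le (X ^ lam n)
      ((natDegree_X_pow _).trans_le (h.lam_le n hn))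
    intro j
    refine (b3 j).trans ?_
    have c1 : ∑ i ∈ Finset.range (m + 1), ‖(normPoly (s n)).coeff i‖ * r ^ i ≤ S :=
      Finset.sum_le_sum fun i _ => by
        gcongr
        exact norm_coeff_normPoly_le (h.card_le n hn) i
    have c2 : ∑ i ∈ Finset.range (m + 1), ‖(X ^ lam n : ℂ[X]).coeff i‖ * r ^ i ≤ S :=
      Finset.sum_le_sum fun i _ => by
        gcongr
        rw [coeff_X_pow]
        split_ifs
        · rw [norm_one]; exact one_le_pow₀ (by norm_num)
        · rw [norm_zero]; positivity
    have hS0 : 0 ≤ S := Finset.sum_nonneg fun i _ => by positivity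
    have hQ0 : 0 ≤ Q := Finset.sum_nonneg fun i _ => by positivity
    gcongr
  refine ⟨G, fun n hn z hz => ?_, hb⟩
  obtain ⟨r, hzr, hrR⟩ := exists_between hz
  have hr : 0 < r := (norm_nonneg z).trans_lt hzr
  obtain ⟨K, hK⟩ := hb r hr hrR
  obtain ⟨C, hC⟩ := hq r hr hrR
  have s1 := hasSum_coe_mul (X ^ (n + 1)) ((hK n hn).hasSum hzr)
  have s2 := hasSum_coe_mul (normPoly (s n)) (hC.hasSum hzr)
  have s3 : HasSum
      (fun j => PowerSeries.coeff j ((q : PowerSeries ℂ) * (p n : PowerSeries ℂ)) * z ^ j)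
      (q.eval z * (p n).eval z) := by
    have h1 : HasSum (fun j => PowerSeries.coeff j (1 : PowerSeries ℂ) * z ^ j) 1 := by
      have : (fun j => PowerSeries.coeff j (1 : PowerSeries ℂ) * z ^ j) =
          fun j => if j = 0 then 1 else 0 := by
        ext j
        rw [PowerSeries.coeff_one]
        split_ifs with hj
        · simp [hj]
        · simp
      rw [this]
      exact hasSum_ite_eq 0 1
    have := hasSum_coe_mul (q * p n) h1
    simpa using this
  have s4 : HasSum (fun j => PowerSeries.coeff j
      ((normPoly (s n) : PowerSeries ℂ) * ((q : PowerSeries ℂ) * f) -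
      (q : PowerSeries ℂ) * (p n : PowerSeries ℂ)) * z ^ j)
      ((normPoly (s n)).eval z * psum ((q : PowerSeries ℂ) * f) z - q.eval z * (p n).eval z) := by
    simp only [map_sub, sub_mul]
    exact s2.sub s3
  have s5 := hasSum_coe_mul (X ^ lam n) s4
  rw [hG n hn] at s5
  push_cast at s1
  simp only [eval_pow, eval_X] at s1 s5
  exact s1.unique s5

/-- The approximants converge at points of the disk where the denominators do not decay too fast. -/
theorem tendsto_rat (h : IsRow f m m' s p lam A t) {q : ℂ[X]} {G : ℕ → PowerSeries ℂ}
    (hG : ∀ n, m ≤ n → ∀ z : ℂ, ‖z‖ < R → z ^ (n + 1) * psum (G n) z =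
        z ^ lam n * ((normPoly (s n)).eval z * psum ((q : PowerSeries ℂ) * f) z -
          q.eval z * (p n).eval z))
    (hb : ∀ r, 0 < r → r < R → ∃ K, ∀ n, m ≤ n → PowerBound (G n) r (K / r ^ (n + 1)))
    {z : ℂ} (hz0 : z ≠ 0) (hzR : ‖z‖ < R) (hqz : q.eval z ≠ 0) {c θ : ℝ} (hc : 0 < c)
    (hθ0 : 0 < θ) (hθ : ‖z‖ / θ < R) (hlow : ∀ᶠ n in atTop, c * θ ^ n ≤ ‖(normPoly (s n)).eval z‖) :
    Tendsto (fun n => rat s p n z) atTop (𝓝 (psum ((q : PowerSeries ℂ) * f) z / q.eval z)) := by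
  have hzp : 0 < ‖z‖ := norm_pos_iff.2 hz0
  obtain ⟨r, hr1, hrR⟩ := exists_between (max_lt hzR hθ)
  have hzr : ‖z‖ < r := (le_max_left _ _).trans_lt hr1
  have hzθ : ‖z‖ / θ < r := (le_max_right _ _).trans_lt hr1
  have hr : 0 < r := hzp.trans hzr
  obtain ⟨K, hK⟩ := hb r hr hrR
  have hK0 : 0 ≤ K := by
    have := le_trans (by positivity) (hK m le_rfl 0)
    rwa [le_div_iff₀ (by positivity), zero_mul] at this
  have hy : ‖z‖ / r / θ < 1 := by
    rw [div_div, mul_comm, ← div_div, div_lt_one hr]; exact hzθ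
  have hx1 : 0 < 1 - ‖z‖ / r := by rw [sub_pos, div_lt_one hr]; exact hzr
  rw [tendsto_iff_norm_sub_tendsto_zero]
  set B : ℝ := (max 1 ‖z‖⁻¹) ^ m * (‖z‖ / r * K * (1 - ‖z‖ / r)⁻¹) / (‖q.eval z‖ * c) with hB
  have hB0 : Tendsto (fun n : ℕ => B * (‖z‖ / r / θ) ^ n) atTop (𝓝 0) := by
    have := (tendsto_pow_atTop_nhds_zero_of_lt_one (by positivity) hy).const_mul B
    rwa [mul_zero] at this
  refine squeeze_zero' (Eventually.of_forall fun _ => norm_nonneg _) ?_ hB0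
  filter_upwards [hlow, eventually_ge_atTop m] with n hn hmn
  have hqn : (normPoly (s n)).eval z ≠ 0 :=
    norm_pos_iff.1 (lt_of_lt_of_le (by positivity) hn)
  have e1 := hG n hmn z hzR
  have e2 : rat s p n z - psum ((q : PowerSeries ℂ) * f) z / q.eval z =
      -(z ^ (n + 1) * psum (G n) z * (z ^ lam n)⁻¹) / (q.eval z * (normPoly (s n)).eval z) := by
    rw [e1, rat]
    field_simp
    ring
  have hps := (hK n hmn).norm_psum_le le_rfl hzr
  have hinv := norm_inv_pow_le hzp le_rfl (h.lam_le n hmn)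
  have hqz0 : 0 < ‖q.eval z‖ := norm_pos_iff.2 hqz
  rw [e2, norm_div, norm_neg, norm_mul, norm_mul, norm_mul, norm_inv, norm_pow, norm_pow]
  calc ‖z‖ ^ (n + 1) * ‖psum (G n) z‖ * (‖z‖ ^ lam n)⁻¹ / (‖q.eval z‖ * ‖(normPoly (s n)).eval z‖)
      ≤ ‖z‖ ^ (n + 1) * (K / r ^ (n + 1) * (1 - ‖z‖ / r)⁻¹) * (max 1 ‖z‖⁻¹) ^ m /
        (‖q.eval z‖ * (c * θ ^ n)) := by gcongr
    _ = _ := by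
      rw [hB, div_pow, div_pow, pow_succ, pow_succ]
      generalize (1 - ‖z‖ / r)⁻¹ = a1
      field_simp

end IsRow

/-! ### Zeros of the telescoping polynomials from bounds on the remainders -/

/-- If `t / (z - ζ)` is uniformly near a holomorphic function on a circle around `ζ`, then `t ζ` is
small: the residue of `t / (z - ζ)` at `ζ` is `t ζ`, that of a holomorphic function is zero. -/
lemma norm_center_le_of_near_holomorphic {ζ : ℂ} {a b δ : ℝ} (ha : 0 < a) (hab : a < b)
    {t W : ℂ → ℂ}
    (ht : Differentiable ℂ t) (hW : DifferentiableOn ℂ W (Metric.ball ζ b))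
    (h : ∀ z, dist z ζ = a → ‖(z - ζ)⁻¹ * t z - W z‖ ≤ δ) : ‖t ζ‖ ≤ a * δ := by
  have hsub : Metric.closedBall ζ a ⊆ Metric.ball ζ b := Metric.closedBall_subset_ball hab
  have h1 : (∮ z in C(ζ, a), (z - ζ)⁻¹ * t z) = (2 * Real.pi * Complex.I) * t ζ := by
    have := ht.diffContOnCl.circleIntegral_sub_inv_smul (c := ζ) (R := a) (Metric.mem_ball_self ha)
    simpa only [smul_eq_mul] using this
  have h2 : (∮ z in C(ζ, a), W z) = 0 :=
    (DifferentiableOn.diffContOnCl (by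
      rw [closure_ball _ ha.ne']; exact hW.mono hsub)).circleIntegral_eq_zero ha.le
  have hcW : CircleIntegrable W ζ a :=
    (hW.continuousOn.mono (Metric.sphere_subset_closedBall.trans hsub)).circleIntegrable ha.le
  have hct : CircleIntegrable (fun z => (z - ζ)⁻¹ * t z) ζ a := by
    refine ContinuousOn.circleIntegrable ha.le (ContinuousOn.mul (ContinuousOn.inv₀
      (by fun_prop) fun z hz => ?_) ht.continuous.continuousOn)
    rw [sub_ne_zero]
    rintro rfl
    rw [Metric.mem_sphere, dist_self] at hz
    exact ha.ne hz
  have h3 := circleIntegral.norm_integral_le_of_norm_le_const (f := fun z => (z - ζ)⁻¹ * t z - W z)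
    (c := ζ) (R := a) (C := δ) ha.le (fun z hz => h z hz)
  rw [circleIntegral.integral_sub hct hcW, h1, h2, sub_zero, norm_mul] at h3
  have h4 : ‖(2 * Real.pi * Complex.I : ℂ)‖ = 2 * Real.pi := by
    simp [abs_of_pos Real.pi_pos]
  rw [h4, mul_assoc, mul_assoc] at h3
  have h5 := le_of_mul_le_mul_left (by linarith : 2 * (Real.pi * ‖t ζ‖) ≤ 2 * (Real.pi * (a * δ)))
    two_pos
  exact le_of_mul_le_mul_left h5 Real.pi_pos

/-- The properties of a regularization that matter here. -/
structure Dominates (m : ℕ) (R : ℝ) (A : ℕ → ℂ) (B : ℕ → ℝ) : Prop where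
  pos : ∀ n, m ≤ n → 0 < B n
  ratio : Tendsto (fun n => B n / B (n + 1)) atTop (𝓝 1)
  le : ∀ n, m ≤ n → ‖A n‖ * R ^ n ≤ B n

namespace IsRow

variable {f : PowerSeries ℂ} {m m' : ℕ} {s : ℕ → Multiset ℂ} {p : ℕ → ℂ[X]} {lam : ℕ → ℕ}
  {A : ℕ → ℂ} {t : ℕ → Multiset ℂ} {R : ℝ}

/-- The residue comparison: with `F_n = q_n H - (z - ζ) ^ κ p_n` and `z ^ (n + 1) G = z ^ λ_n F_n`, the
telescoping identity turns `q_{n+1} F_n - q_n F_{n+1}` into `A_n q*_n (z - ζ) ^ κ`, up to a power of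
`z`.  Near the circle of radius `a`, both `q_n` and `q_{n+1}` are within `O(ε)` of
`(z - ζ) ^ (κ + 1)` times a polynomial. -/
lemma norm_eval_center_le_of_bounds (h : IsRow f m m' s p lam A t) {ζ : ℂ} {κ n : ℕ} (hn : m ≤ n)
    {a b : ℝ}
    (ha : 0 < a) (hab : a < b) (ha1 : a ≤ 1) (h0 : ∀ z : ℂ, dist z ζ = a → z ≠ 0) {H G G' : ℂ → ℂ}
    (hG : DifferentiableOn ℂ G (Metric.ball ζ b)) (hG' : DifferentiableOn ℂ G' (Metric.ball ζ b))
    (e : ∀ z ∈ Metric.ball ζ b, z ^ (n + 1) * G z = z ^ lam n *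
      ((normPoly (s n)).eval z * H z - (z - ζ) ^ κ * (p n).eval z))
    (e' : ∀ z ∈ Metric.ball ζ b, z ^ (n + 2) * G' z = z ^ lam (n + 1) *
      ((normPoly (s (n + 1))).eval z * H z - (z - ζ) ^ κ * (p (n + 1)).eval z))
    {ε : ℝ} (hε0 : 0 ≤ ε) (hε : ε ≤ 1) (hc : κ + 1 ≤ (s n).countP fun z => dist z ζ < ε)
    (hc' : κ + 1 ≤ (s (n + 1)).countP fun z => dist z ζ < ε) {D : ℝ}
    (hD : ∀ z, dist z ζ = a → ‖G z‖ ≤ D) (hD' : ∀ z, dist z ζ = a → ‖G' z‖ ≤ D) :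
    ‖A n‖ * ‖(normPoly (t n)).eval ζ‖ ≤
      a * (ε * (2 * 2 ^ m * (2 + ‖ζ‖) ^ (2 * m + 1) / a ^ (κ + 1)) * D) := by
  obtain ⟨u, hu⟩ := exists_norm_eval_sub_pow_mul_le (h.card_le n hn) hε0 hε hc
  obtain ⟨u', hu'⟩ := exists_norm_eval_sub_pow_mul_le (h.card_le (n + 1) (by omega)) hε0 hε hc'
  have key := norm_center_le_of_near_holomorphic ha hab
    (t := fun z => A n * (normPoly (t n)).eval z)
    (W := fun z => u'.eval z * (z ^ lam (n + 1) * G z) - u.eval z * (z ^ (1 + lam n) * G' z))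
    (δ := ε * (2 * 2 ^ m * (2 + ‖ζ‖) ^ (2 * m + 1) / a ^ (κ + 1)) * D)
    ((differentiable_const _).mul (normPoly (t n)).differentiable)
    ((u'.differentiable.differentiableOn.mul
      ((differentiable_id.pow _).differentiableOn.mul hG)).sub
      (u.differentiable.differentiableOn.mul
      ((differentiable_id.pow _).differentiableOn.mul hG'))) ?_
  · rwa [norm_mul] at key
  intro z hz
  have hzb : z ∈ Metric.ball ζ b := by rw [Metric.mem_ball, hz]; exact hab
  have hz0 := h0 z hz
  have hzζ : z - ζ ≠ 0 := by
    rw [sub_ne_zero]; rintro rfl; rw [dist_self] at hz; exact ha.ne hz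
  have i1 := e z hzb
  have i2 := e' z hzb
  have i3 := congrArg (Polynomial.eval z) (h.tele n hn)
  simp only [eval_mul, eval_pow, eval_X, eval_sub, eval_C] at i3
  set q := (normPoly (s n)).eval z
  set q' := (normPoly (s (n + 1))).eval z
  have i4 : (z - ζ) ^ κ * (A n * (normPoly (t n)).eval z) =
      q' * (z ^ lam (n + 1) * G z) - q * (z ^ (1 + lam n) * G' z) := by
    refine mul_left_cancel₀ (pow_ne_zero (n + 1) hz0) ?_
    have e1 : z ^ (n + 1) * (q' * (z ^ lam (n + 1) * G z) - q * (z ^ (1 + lam n) * G' z)) =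
        q' * z ^ lam (n + 1) * (z ^ (n + 1) * G z) - q * z ^ lam n * (z ^ (n + 2) * G' z) := by ring
    rw [e1, i1, i2]
    linear_combination (-(z - ζ) ^ κ) * i3
  have i5 : (z - ζ)⁻¹ * (A n * (normPoly (t n)).eval z) =
      ((z - ζ) ^ (κ + 1))⁻¹ * (q' * (z ^ lam (n + 1) * G z) - q * (z ^ (1 + lam n) * G' z)) := by
    rw [← i4, pow_succ]
    field_simp
  have i6 : (z - ζ)⁻¹ * (A n * (normPoly (t n)).eval z) -
      (u'.eval z * (z ^ lam (n + 1) * G z) - u.eval z * (z ^ (1 + lam n) * G' z)) =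
      ((z - ζ) ^ (κ + 1))⁻¹ * ((q' - (z - ζ) ^ (κ + 1) * u'.eval z) * (z ^ lam (n + 1) * G z) -
        (q - (z - ζ) ^ (κ + 1) * u.eval z) * (z ^ (1 + lam n) * G' z)) := by
    rw [i5]
    field_simp
    ring
  rw [i6, norm_mul, norm_inv, norm_pow, ← dist_eq_norm, hz]
  have hz1 : dist z ζ ≤ 1 := by rw [hz]; exact ha1
  have hzn : ‖z‖ ≤ 2 + ‖ζ‖ := by
    have := norm_sub_norm_le z ζ
    rw [dist_eq_norm] at hz1; linarith
  have hM : 1 ≤ 2 + ‖ζ‖ := by linarith [norm_nonneg ζ]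
  have b1 : ‖z ^ lam (n + 1)‖ ≤ (2 + ‖ζ‖) ^ (m + 1) := by
    rw [norm_pow]
    exact (pow_le_pow_left₀ (norm_nonneg _) hzn _).trans
      (pow_le_pow_right₀ hM (by have := h.lam_le (n + 1) (by omega); omega))
  have b2 : ‖z ^ (1 + lam n)‖ ≤ (2 + ‖ζ‖) ^ (m + 1) := by
    rw [norm_pow]
    exact (pow_le_pow_left₀ (norm_nonneg _) hzn _).trans
      (pow_le_pow_right₀ hM (by have := h.lam_le n hn; omega))
  have hD0 : 0 ≤ D := (norm_nonneg _).trans (hD z hz)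
  calc (a ^ (κ + 1))⁻¹ * ‖(q' - (z - ζ) ^ (κ + 1) * u'.eval z) * (z ^ lam (n + 1) * G z) -
        (q - (z - ζ) ^ (κ + 1) * u.eval z) * (z ^ (1 + lam n) * G' z)‖
      ≤ (a ^ (κ + 1))⁻¹ * (2 ^ m * ε * (2 + ‖ζ‖) ^ m * ((2 + ‖ζ‖) ^ (m + 1) * D) +
        2 ^ m * ε * (2 + ‖ζ‖) ^ m * ((2 + ‖ζ‖) ^ (m + 1) * D)) := by
        gcongr
        refine (norm_sub_le _ _).trans ?_
        simp only [norm_mul]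
        have := hu z hz1
        have := hu' z hz1
        have := hD z hz
        have := hD' z hz
        gcongr
    _ = _ := by rw [two_mul m, pow_add, pow_add, pow_add]; field_simp; ring

/-- If the remainders `q_n H - (z - ζ) ^ κ p_n` are dominated by `B_n |z / R| ^ n` on circles around
`ζ`, and more than `κ` zeros of the denominators tend to `ζ`, then zeros of the telescoping
polynomials tend to `ζ` along `Λ`. -/
theorem eventually_exists_star_zero (h : IsRow f m m' s p lam A t) {B : ℕ → ℝ} (hR : 0 < R)
    (hB : Dominates m R A B) {Λ : Set ℕ} {c : ℝ} (hc : 0 < c)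
    (hΛ : ∀ n ∈ Λ, m ≤ n ∧ c * B n ≤ ‖A n‖ * R ^ n) {ζ : ℂ} {κ : ℕ}
    (hcount : ∀ ε > 0, ∀ᶠ n in atTop, κ + 1 ≤ (s n).countP fun z => dist z ζ < ε)
    {a b μ C : ℝ} (ha : 0 < a) (hab : a < b) (ha1 : a ≤ 1) (hμ : 0 < μ)
    (hsep : ∀ z : ℂ, a ≤ dist z ζ → dist z ζ < b → μ ≤ ‖z‖) {H : ℂ → ℂ}
    (hG : ∀ᶠ n in atTop, ∃ G : ℂ → ℂ, DifferentiableOn ℂ G (Metric.ball ζ b) ∧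
      ∀ z ∈ Metric.ball ζ b, z ^ (n + 1) * G z = z ^ lam n *
        ((normPoly (s n)).eval z * H z - (z - ζ) ^ κ * (p n).eval z))
    (hbd : ∀ᶠ n in atTop, ∃ ρ, a ≤ ρ ∧ ρ < b ∧ ∀ z, dist z ζ = ρ →
      ‖(normPoly (s n)).eval z * H z - (z - ζ) ^ κ * (p n).eval z‖ ≤ C * (B n * (‖z‖ / R) ^ n)) :
    ∀ ε > 0, ∀ᶠ n in atTop ⊓ 𝓟 Λ, ∃ ξ ∈ t n, dist ζ ξ < ε := by
  -- a bound for the quotients `G` on the circle of radius `a`, by the maximum principle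
  set K : ℝ := |C| * (1 + (‖ζ‖ + b)) ^ m * μ⁻¹ with hK
  have hK0 : 0 ≤ K := by
    have := norm_nonneg ζ
    have : 0 ≤ 1 + (‖ζ‖ + b) := by linarith
    positivity
  have hGb : ∀ᶠ n in atTop, m ≤ n ∧ ∃ G : ℂ → ℂ, DifferentiableOn ℂ G (Metric.ball ζ b) ∧
      (∀ z ∈ Metric.ball ζ b, z ^ (n + 1) * G z = z ^ lam n *
        ((normPoly (s n)).eval z * H z - (z - ζ) ^ κ * (p n).eval z)) ∧
      ∀ z, dist z ζ = a → ‖G z‖ ≤ K * (B n / R ^ n) := by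
    filter_upwards [hG, hbd, eventually_ge_atTop m] with n h1 h2 hmn
    obtain ⟨G, hGd, hGe⟩ := h1
    obtain ⟨ρ, haρ, hρb, hρ⟩ := h2
    refine ⟨hmn, G, hGd, hGe, fun z hz => ?_⟩
    have hρ0 : 0 < ρ := ha.trans_le haρ
    have hBn := hB.pos n hmn
    refine Complex.norm_le_of_forall_mem_frontier_norm_le (U := Metric.ball ζ ρ)
      Metric.isBounded_ball (DifferentiableOn.diffContOnCl ?_) (fun w hw => ?_) ?_
    · rw [closure_ball _ hρ0.ne']
      exact hGd.mono (Metric.closedBall_subset_ball hρb)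
    · rw [frontier_ball _ hρ0.ne', Metric.mem_sphere] at hw
      have hwb : w ∈ Metric.ball ζ b := by rw [Metric.mem_ball, hw]; exact hρb
      have hwμ : μ ≤ ‖w‖ := hsep w (by rw [hw]; exact haρ) (by rw [hw]; exact hρb)
      have hw0 : 0 < ‖w‖ := hμ.trans_le hwμ
      have hwM : ‖w‖ ≤ 1 + (‖ζ‖ + b) := by
        have := norm_sub_norm_le w ζ
        rw [dist_eq_norm] at hw; linarith
      have e1 := congrArg norm (hGe w hwb)
      rw [norm_mul, norm_mul, norm_pow, norm_pow] at e1
      have e2 : ‖w‖ ^ (n + 1) * ‖G w‖ ≤ (1 + (‖ζ‖ + b)) ^ m * (|C| * (B n * (‖w‖ / R) ^ n)) := by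
        rw [e1]
        have h3 := hρ w hw
        have h4 : C * (B n * (‖w‖ / R) ^ n) ≤ |C| * (B n * (‖w‖ / R) ^ n) := by
          gcongr; exact le_abs_self C
        have h5 : ‖w‖ ^ lam n ≤ (1 + (‖ζ‖ + b)) ^ m :=
          (pow_le_pow_left₀ hw0.le hwM _).trans (pow_le_pow_right₀ (by
            have := norm_nonneg ζ; linarith) (h.lam_le n hmn))
        exact mul_le_mul h5 (h3.trans h4) (norm_nonneg _) (by
          have := norm_nonneg ζ
          have : 0 ≤ 1 + (‖ζ‖ + b) := by linarith
          positivity)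
      have e3 : ‖G w‖ ≤ |C| * (1 + (‖ζ‖ + b)) ^ m * ‖w‖⁻¹ * (B n / R ^ n) := by
        rw [← mul_le_mul_iff_right₀ (pow_pos hw0 (n + 1))]
        refine e2.trans (le_of_eq ?_)
        rw [div_pow, pow_succ]
        field_simp
      refine e3.trans ?_
      rw [hK]
      have : 0 ≤ 1 + (‖ζ‖ + b) := by have := norm_nonneg ζ; linarith
      gcongr
    · rw [closure_ball _ hρ0.ne', Metric.mem_closedBall, hz]
      exact haρ
  intro ε hε
  set η : ℝ := min ε 1 with hη
  have hη0 : 0 < η := lt_min hε one_pos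
  set v : ℝ := (η / (1 + ‖ζ‖)) ^ m with hv
  have hv0 : 0 < v := by positivity
  set L : ℝ := a * (2 * 2 ^ m * (2 + ‖ζ‖) ^ (2 * m + 1) / a ^ (κ + 1)) * (K * max 1 (2 / R)) / c
    with hL
  have hL0 : 0 ≤ L := by positivity
  set δ : ℝ := min 1 (v / (2 * (L + 1))) with hδ
  have hδ0 : 0 < δ := lt_min one_pos (by positivity)
  have hratio : ∀ᶠ n in atTop, 1 / 2 < B n / B (n + 1) :=
    hB.ratio.eventually (lt_mem_nhds (by norm_num))
  have hev := hGb.and (((tendsto_add_atTop_nat 1).eventually hGb).and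
    ((hcount δ hδ0).and (((tendsto_add_atTop_nat 1).eventually (hcount δ hδ0)).and hratio)))
  rw [eventually_inf_principal]
  filter_upwards [hev] with n hn hnΛ
  obtain ⟨⟨hmn, G, hGd, hGe, hGn⟩, ⟨-, G', hGd', hGe', hGn'⟩, hc0, hc1, hr⟩ := hn
  have hBn := hB.pos n hmn
  have hBn1 := hB.pos (n + 1) (by omega)
  rw [lt_div_iff₀ hBn1] at hr
  have hD : ∀ z, dist z ζ = a → ‖G z‖ ≤ K * max 1 (2 / R) * (B n / R ^ n) := fun z hz => by
    refine (hGn z hz).trans ?_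
    rw [mul_assoc K]
    refine mul_le_mul_of_nonneg_left ?_ hK0
    exact le_mul_of_one_le_left (by positivity) (le_max_left _ _)
  have hD' : ∀ z, dist z ζ = a → ‖G' z‖ ≤ K * max 1 (2 / R) * (B n / R ^ n) := fun z hz => by
    refine (hGn' z hz).trans ?_
    rw [mul_assoc K]
    refine mul_le_mul_of_nonneg_left ?_ hK0
    calc B (n + 1) / R ^ (n + 1) ≤ (2 * B n) / R ^ (n + 1) := by gcongr; linarith
      _ = 2 / R * (B n / R ^ n) := by rw [pow_succ]; field_simp
      _ ≤ _ := by gcongr; exact le_max_right _ _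
  have key := h.norm_eval_center_le_of_bounds hmn ha hab ha1 (fun z hz => by
    have := hsep z hz.ge (by rw [hz]; exact hab)
    exact norm_pos_iff.1 (hμ.trans_le this)) hGd hGd' hGe hGe' hδ0.le (min_le_left _ _) hc0 hc1
    hD hD'
  have hΛn := (hΛ n hnΛ).2
  by_contra! hcon
  have hlow : v ≤ ‖(normPoly (t n)).eval ζ‖ :=
    le_norm_eval_normPoly ((h.card_star_le n hmn).trans (Nat.sub_le _ _)) hη0.le
      (min_le_right _ _) fun ξ hξ => (min_le_left _ _).trans (hcon ξ hξ)
  have h1 : c * B n / R ^ n * v ≤ c * B n / R ^ n * (δ * L) := by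
    calc c * B n / R ^ n * v ≤ ‖A n‖ * ‖(normPoly (t n)).eval ζ‖ := by
          have : c * B n / R ^ n ≤ ‖A n‖ := by rwa [div_le_iff₀ (by positivity)]
          gcongr
      _ ≤ _ := key
      _ = _ := by rw [hL]; field_simp
  have h2 : v ≤ δ * L := le_of_mul_le_mul_left h1 (by positivity)
  have h3 : δ ≤ v / (2 * (L + 1)) := min_le_right _ _
  rw [le_div_iff₀ (by positivity)] at h3
  nlinarith

end IsRow

/-! ### Sharp bounds inside and outside the disk -/

lemma Dominates.exists_growth {m : ℕ} {R : ℝ} {A : ℕ → ℂ} {B : ℕ → ℝ} (hB : Dominates m R A B)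
    {x : ℝ} (hx0 : 0 < x) (hx1 : x < 1) :
    ∃ N, m ≤ N ∧ ∀ n, N ≤ n → ∀ i, B (n + i) * x ^ i ≤ B n ∧ B n * x ^ i ≤ B (n + i) := by
  have h1 : ∀ᶠ n in atTop, x < B n / B (n + 1) := hB.ratio.eventually (lt_mem_nhds hx1)
  have h2 : ∀ᶠ n in atTop, B n / B (n + 1) < x⁻¹ :=
    hB.ratio.eventually (gt_mem_nhds ((one_lt_inv₀ hx0).2 hx1))
  obtain ⟨N, hN⟩ := eventually_atTop.1 ((h1.and h2).and (eventually_ge_atTop m))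
  refine ⟨N, (hN N le_rfl).2, fun n hn i => ?_⟩
  induction i with
  | zero => simp
  | succ i ih =>
    obtain ⟨⟨h3, h4⟩, h5⟩ := hN (n + i) (by omega)
    have hp := hB.pos (n + i + 1) (by omega)
    rw [lt_div_iff₀ hp] at h3
    rw [div_lt_iff₀ hp, inv_mul_eq_div, lt_div_iff₀ hx0] at h4
    rw [← add_assoc]
    have hxi : 0 < x ^ i := pow_pos hx0 i
    constructor
    · calc B (n + i + 1) * x ^ (i + 1) = (x * B (n + i + 1)) * x ^ i := by ring
        _ ≤ B (n + i) * x ^ i := by gcongr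
        _ ≤ B n := ih.1
    · calc B n * x ^ (i + 1) = (B n * x ^ i) * x := by ring
        _ ≤ B (n + i) * x := by gcongr; exact ih.2
        _ ≤ _ := h4.le

lemma Dominates.exists_bound {m : ℕ} {R : ℝ} {A : ℕ → ℂ} {B : ℕ → ℝ} (hB : Dominates m R A B)
    {r : ℝ} (hr : 0 < r) (hrR : r < R) : ∃ C, ∀ n, m ≤ n → ‖A n‖ * r ^ n ≤ C := by
  have hR : 0 < R := hr.trans hrR
  have hx0 : 0 < r / R := by positivity
  obtain ⟨N, hmN, hN⟩ := hB.exists_growth hx0 ((div_lt_one hR).2 hrR)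
  refine ⟨∑ n ∈ Finset.range N, ‖A n‖ * r ^ n + B N * (r / R) ^ N, fun n hn => ?_⟩
  have hBN := hB.pos N hmN
  rcases lt_or_ge n N with hlt | hge
  · have := Finset.single_le_sum (f := fun n => ‖A n‖ * r ^ n) (fun i _ => by positivity)
      (Finset.mem_range.2 hlt)
    have : 0 ≤ B N * (r / R) ^ N := by positivity
    linarith
  · obtain ⟨i, rfl⟩ := Nat.exists_eq_add_of_le hge
    have h1 := (hN N le_rfl i).1
    have h2 : ‖A (N + i)‖ * r ^ (N + i) ≤ B N * (r / R) ^ N := by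
      calc ‖A (N + i)‖ * r ^ (N + i) = (‖A (N + i)‖ * R ^ (N + i)) * (r / R) ^ (N + i) := by
            rw [div_pow]; field_simp
        _ ≤ B (N + i) * (r / R) ^ (N + i) := by gcongr; exact hB.le _ hn
        _ = (B (N + i) * (r / R) ^ i) * (r / R) ^ N := by rw [pow_add]; ring
        _ ≤ _ := by gcongr
    have : 0 ≤ ∑ n ∈ Finset.range N, ‖A n‖ * r ^ n := Finset.sum_nonneg fun i _ => by positivity
    linarith

namespace IsRow

variable {f : PowerSeries ℂ} {m m' : ℕ} {s : ℕ → Multiset ℂ} {p : ℕ → ℂ[X]} {lam : ℕ → ℕ}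
  {A : ℕ → ℂ} {t : ℕ → Multiset ℂ} {R : ℝ}

/-- Inside the disk the remainder is the tail of the telescoping series, which is dominated by its
first term on good circles. -/
theorem exists_interior_bound (h : IsRow f m m' s p lam A t) {B : ℕ → ℝ} (hR : 0 < R)
    (hB : Dominates m R A B) {q : ℂ[X]} {G : ℕ → PowerSeries ℂ}
    (hG : ∀ n, m ≤ n → ∀ z : ℂ, ‖z‖ < R → z ^ (n + 1) * psum (G n) z = z ^ lam n *
      ((normPoly (s n)).eval z * psum ((q : PowerSeries ℂ) * f) z - q.eval z * (p n).eval z))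
    (hb : ∀ r, 0 < r → r < R → ∃ K, ∀ n, m ≤ n → PowerBound (G n) r (K / r ^ (n + 1)))
    {ζ : ℂ} {a b μ M : ℝ} (ha : 0 ≤ a) (hab : a < b) (hμ : 0 < μ) (hM0 : 0 < M) (hM : M < R)
    (hsep : ∀ z : ℂ, a < dist z ζ → dist z ζ < b → μ ≤ ‖z‖ ∧ ‖z‖ ≤ M ∧ q.eval z ≠ 0) :
    ∃ C, 0 ≤ C ∧ ∀ᶠ n in atTop, ∃ ρ, a < ρ ∧ ρ < b ∧ ∀ z, dist z ζ = ρ →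
      ‖(normPoly (s n)).eval z * (psum ((q : PowerSeries ℂ) * f) z / q.eval z) - (p n).eval z‖ ≤
        C * (B n * (‖z‖ / R) ^ n) := by
  have hx0 : 0 < M / R := by positivity
  obtain ⟨θ, hθ0, hθ1, hθ⟩ := exists_lt_pow ((div_lt_one hR).2 hM) 4
  obtain ⟨c, hc, hsph⟩ := exists_good_sphere ζ ha hab m hθ0 hθ1
  obtain ⟨N, hmN, hN⟩ := hB.exists_growth hθ0 hθ1
  obtain ⟨K, hK0, hK⟩ := h.exists_norm_rat_sub_le hμ M
  have hθ3 : M / R < θ ^ 3 := hθ.trans_le (pow_le_pow_of_le_one hθ0.le hθ1.le (by norm_num))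
  have hθ1' : M / R < θ := hθ.trans_le (by
    simpa using pow_le_pow_of_le_one hθ0.le hθ1.le (by norm_num : 1 ≤ 4))
  set y : ℝ := M / R / θ ^ 3 with hy
  have hy0 : 0 < y := by positivity
  have hy1 : y < 1 := (div_lt_one (by positivity)).2 hθ3
  refine ⟨(1 + M) ^ m * (K / (c * c * θ) / (1 - y)), by
    have : 0 < 1 - y := by linarith
    positivity, ?_⟩
  filter_upwards [eventually_ge_atTop N] with n hn
  have hmn : m ≤ n := hmN.trans hn
  obtain ⟨ρ, ⟨haρ, hρb⟩, hρ⟩ := hsph (fun i => s (n + i)) fun i => h.card_le _ (by omega)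
  refine ⟨ρ, haρ, hρb, fun z hz => ?_⟩
  obtain ⟨hzμ, hzM, hqz⟩ := hsep z (by rw [hz]; exact haρ) (by rw [hz]; exact hρb)
  have hz0 : 0 < ‖z‖ := hμ.trans_le hzμ
  have hlow := hρ z hz
  have hBn := hB.pos n hmn
  have hlim : Tendsto (fun n => rat s p n z) atTop
      (𝓝 (psum ((q : PowerSeries ℂ) * f) z / q.eval z)) := by
    refine h.tendsto_rat hG hb (norm_pos_iff.1 hz0) (hzM.trans_lt hM) hqz hc hθ0 ?_ ?_
    · rw [div_lt_iff₀ hθ0]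
      rw [div_lt_iff₀ hR] at hθ1'
      linarith
    · filter_upwards [eventually_ge_atTop n] with k hk
      obtain ⟨i, rfl⟩ := Nat.exists_eq_add_of_le hk
      refine le_trans ?_ (hlow i)
      gcongr ?_ * ?_
      exact pow_le_pow_of_le_one hθ0.le hθ1.le (by omega)
  have hstep : ∀ i, dist (rat s p (n + i) z) (rat s p (n + (i + 1)) z) ≤
      K / (c * c * θ) * (B n * (‖z‖ / R) ^ n) * y ^ i := by
    intro i
    rw [dist_comm, dist_eq_norm]
    refine (hK (n + i) (by omega) z hzμ hzM (c * θ ^ i) (c * θ ^ (i + 1)) (by positivity)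
      (by positivity) (hlow i) (hlow (i + 1))).trans ?_
    have h1 : ‖A (n + i)‖ * ‖z‖ ^ (n + i) ≤ B n / θ ^ i * ((‖z‖ / R) ^ n * (M / R) ^ i) := by
      have h2 : B (n + i) ≤ B n / θ ^ i := by
        rw [le_div_iff₀ (by positivity)]; exact (hN n hn i).1
      calc ‖A (n + i)‖ * ‖z‖ ^ (n + i) = (‖A (n + i)‖ * R ^ (n + i)) * (‖z‖ / R) ^ (n + i) := by
            rw [div_pow]; field_simp
        _ ≤ B n / θ ^ i * (‖z‖ / R) ^ (n + i) := by
            gcongr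
            exact (hB.le _ (by omega)).trans h2
        _ ≤ _ := by rw [pow_add]; gcongr
    calc K * (‖A (n + i)‖ * ‖z‖ ^ (n + i)) / (c * θ ^ i * (c * θ ^ (i + 1)))
        ≤ K * (B n / θ ^ i * ((‖z‖ / R) ^ n * (M / R) ^ i)) / (c * θ ^ i * (c * θ ^ (i + 1))) := by
          gcongr
      _ = _ := by
          rw [hy, div_pow (M / R), ← pow_mul, mul_comm 3 i, pow_mul, pow_succ]
          generalize (M / R) ^ i = a1
          generalize (‖z‖ / R) ^ n = a2
          field_simp
  have hd := dist_le_of_le_geometric_of_tendsto₀ (f := fun i => rat s p (n + i) z) y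
    (K / (c * c * θ) * (B n * (‖z‖ / R) ^ n)) hy1 hstep
    ((tendsto_add_atTop_iff_nat n).2 hlim |>.congr fun i => by rw [add_comm])
  have hqn : (normPoly (s n)).eval z ≠ 0 := by
    have := hlow 0
    exact norm_pos_iff.1 (lt_of_lt_of_le (by positivity) this)
  have e : (normPoly (s n)).eval z * (psum ((q : PowerSeries ℂ) * f) z / q.eval z) - (p n).eval z =
      (normPoly (s n)).eval z * (psum ((q : PowerSeries ℂ) * f) z / q.eval z - rat s p n z) := by
    rw [mul_sub, rat, mul_div_cancel₀ _ hqn]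
  rw [e, norm_mul]
  rw [dist_comm, dist_eq_norm, add_zero] at hd
  have hqM : ‖(normPoly (s n)).eval z‖ ≤ (1 + M) ^ m :=
    (norm_eval_normPoly_le _ _ (h.card_le n hmn)).trans (by gcongr)
  calc _ ≤ (1 + M) ^ m * (K / (c * c * θ) * (B n * (‖z‖ / R) ^ n) / (1 - y)) := by gcongr
    _ = _ := by ring

/-- Outside the disk the approximants are dominated by the last term of the telescoping sum on good
circles. -/
theorem exists_exterior_bound (h : IsRow f m m' s p lam A t) {B : ℕ → ℝ} (hR : 0 < R)
    (hB : Dominates m R A B) {ζ : ℂ} {a b μ M : ℝ} (ha : 0 ≤ a) (hab : a < b) (hμ : R < μ)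
    (hsep : ∀ z : ℂ, a < dist z ζ → dist z ζ < b → μ ≤ ‖z‖ ∧ ‖z‖ ≤ M) :
    ∃ C, 0 ≤ C ∧ ∀ᶠ n in atTop, ∃ ρ, a < ρ ∧ ρ < b ∧ ∀ z, dist z ζ = ρ →
      ‖(p n).eval z‖ ≤ C * (B n * (‖z‖ / R) ^ n) := by
  have hμ0 : 0 < μ := hR.trans hμ
  obtain ⟨θ, hθ0, hθ1, hθ⟩ := exists_lt_pow ((div_lt_one hμ0).2 hμ) 3
  obtain ⟨c, hc, hsph⟩ := exists_good_sphere ζ ha hab m hθ0 hθ1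
  obtain ⟨N, hmN, hN⟩ := hB.exists_growth hθ0 hθ1
  obtain ⟨K, hK0, hK⟩ := h.exists_norm_rat_sub_le hμ0 M
  have hθ2 : R / μ < θ ^ 2 := hθ.trans_le (pow_le_pow_of_le_one hθ0.le hθ1.le (by norm_num))
  have hx0 : 0 < R / μ := by positivity
  set y : ℝ := R / μ / θ ^ 3 with hy
  have hy0 : 0 < y := by positivity
  have hy1 : y < 1 := (div_lt_one (by positivity)).2 hθ
  have hy1' : 0 < 1 - y := by linarith
  obtain ⟨D, hD⟩ := (isCompact_closedBall (0 : ℂ) |M|).exists_bound_of_continuousOn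
    (p N).continuous.continuousOn
  have hD0 : 0 ≤ D := (norm_nonneg _).trans (hD 0 (by simp))
  have hBN := hB.pos N hmN
  refine ⟨(1 + |M|) ^ m * (D / (c * B N) + K / (c * c) * (1 - y)⁻¹), by positivity, ?_⟩
  filter_upwards [eventually_ge_atTop N] with n hn
  obtain ⟨l, rfl⟩ := Nat.exists_eq_add_of_le hn
  have hmn : m ≤ N + l := hmN.trans hn
  obtain ⟨ρ, ⟨haρ, hρb⟩, hρ⟩ := hsph (fun i => s (N + (l - i))) fun i => h.card_le _ (by omega)
  refine ⟨ρ, haρ, hρb, fun z hz => ?_⟩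
  obtain ⟨hzμ, hzM⟩ := hsep z (by rw [hz]; exact haρ) (by rw [hz]; exact hρb)
  have hz0 : 0 < ‖z‖ := hμ0.trans_le hzμ
  have hlow : ∀ j, j ≤ l → c * θ ^ (l - j) ≤ ‖(normPoly (s (N + j))).eval z‖ := by
    intro j hj
    have := hρ z hz (l - j)
    rwa [Nat.sub_sub_self hj] at this
  have hBn := hB.pos _ hmn
  set w : ℝ := ‖z‖ / R with hw
  have hw0 : 0 < w := by positivity
  have hw1 : 1 ≤ w := by rw [hw, one_le_div hR]; linarith
  have hwx : w⁻¹ ≤ R / μ := by rw [hw, inv_div]; gcongr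
  -- passing from the index `N + j` to the last index `N + l`
  have htrans : ∀ j, j ≤ l → B (N + j) * w ^ (N + j) ≤
      B (N + l) * w ^ (N + l) * ((R / μ) ^ (l - j) / θ ^ (l - j)) := by
    intro j hj
    obtain ⟨i, rfl⟩ := Nat.exists_eq_add_of_le hj
    rw [Nat.add_sub_cancel_left]
    have h1 := (hN (N + j) (by omega) i).2
    rw [← le_div_iff₀ (by positivity)] at h1
    calc B (N + j) * w ^ (N + j) ≤ B (N + j + i) / θ ^ i * w ^ (N + j) := by gcongr
      _ = B (N + (j + i)) * w ^ (N + (j + i)) * ((w⁻¹) ^ i / θ ^ i) := by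
        rw [← add_assoc, pow_add w (N + j) i, inv_pow]; field_simp
      _ ≤ _ := by gcongr
  have hstep : ∀ j, j < l → dist (rat s p (N + j) z) (rat s p (N + (j + 1)) z) ≤
      K / (c * c) * (B (N + l) * w ^ (N + l)) * y ^ (l - 1 - j) := by
    intro j hj
    rw [dist_comm, dist_eq_norm]
    have hlow1 : c * θ ^ (l - j) ≤ ‖(normPoly (s (N + (j + 1)))).eval z‖ := by
      refine le_trans ?_ (hlow (j + 1) hj)
      gcongr ?_ * ?_
      exact pow_le_pow_of_le_one hθ0.le hθ1.le (by omega)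
    refine (hK (N + j) (by omega) z hzμ hzM (c * θ ^ (l - j)) (c * θ ^ (l - j)) (by positivity)
      (by positivity) (hlow j hj.le) hlow1).trans ?_
    have h1 : ‖A (N + j)‖ * ‖z‖ ^ (N + j) ≤ B (N + j) * w ^ (N + j) := by
      calc ‖A (N + j)‖ * ‖z‖ ^ (N + j) = (‖A (N + j)‖ * R ^ (N + j)) * w ^ (N + j) := by
            rw [hw, div_pow]; field_simp
        _ ≤ _ := by gcongr; exact hB.le _ (by omega)
    have h2 := h1.trans (htrans j hj.le)
    calc K * (‖A (N + j)‖ * ‖z‖ ^ (N + j)) / (c * θ ^ (l - j) * (c * θ ^ (l - j)))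
        ≤ K * (B (N + l) * w ^ (N + l) * ((R / μ) ^ (l - j) / θ ^ (l - j))) /
          (c * θ ^ (l - j) * (c * θ ^ (l - j))) := by gcongr
      _ = K / (c * c) * (B (N + l) * w ^ (N + l)) * y ^ (l - j) := by
          rw [hy, div_pow (R / μ), ← pow_mul, mul_comm 3, pow_mul]
          generalize (R / μ) ^ (l - j) = a1
          generalize w ^ (N + l) = a2
          field_simp
      _ ≤ _ := by
          gcongr ?_ * ?_
          exact pow_le_pow_of_le_one hy0.le hy1.le (by omega)
  have hsum : ∑ j ∈ Finset.range l, K / (c * c) * (B (N + l) * w ^ (N + l)) * y ^ (l - 1 - j) ≤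
      K / (c * c) * (B (N + l) * w ^ (N + l)) * (1 - y)⁻¹ := by
    rw [Finset.sum_range_reflect (fun j => K / (c * c) * (B (N + l) * w ^ (N + l)) * y ^ j)]
    exact sum_le_hasSum _ (fun k _ => by positivity)
      ((hasSum_geometric_of_lt_one hy0.le hy1).mul_left _)
  have hd := dist_le_range_sum_of_dist_le (f := fun j => rat s p (N + j) z) l
    (fun {k} hk => hstep k hk)
  have hzM' : ‖z‖ ≤ |M| := hzM.trans (le_abs_self M)
  have hfirst : ‖rat s p N z‖ ≤ D / (c * B N) * (B (N + l) * w ^ (N + l)) := by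
    have h1 := hlow 0 (Nat.zero_le l)
    rw [Nat.sub_zero, add_zero] at h1
    have h2 := htrans 0 (Nat.zero_le l)
    rw [Nat.sub_zero, add_zero] at h2
    have h3 : B N ≤ B N * w ^ N := le_mul_of_one_le_right hBN.le (one_le_pow₀ hw1)
    have h4 : B N * θ ^ l ≤ θ ^ l * B N * w ^ N := by
      rw [mul_comm (B N), mul_assoc]; gcongr
    have h5 : (R / μ) ^ l ≤ (θ ^ 2) ^ l := by gcongr
    have h6 : (1 : ℝ) / θ ^ l ≤ (B (N + l) * w ^ (N + l)) / B N := by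
      rw [div_le_div_iff₀ (by positivity) hBN]
      calc 1 * B N ≤ B (N + l) * w ^ (N + l) * ((R / μ) ^ l / θ ^ l) := by
            rw [one_mul]; exact h3.trans h2
        _ ≤ B (N + l) * w ^ (N + l) * ((θ ^ 2) ^ l / θ ^ l) := by gcongr
        _ = _ := by rw [← pow_mul, mul_comm 2, pow_mul, sq]; field_simp
    rw [rat, norm_div]
    calc ‖(p N).eval z‖ / ‖(normPoly (s N)).eval z‖ ≤ D / (c * θ ^ l) := by
          gcongr
          exact hD z (by simpa using hzM')
      _ = D / c * (1 / θ ^ l) := by field_simp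
      _ ≤ D / c * ((B (N + l) * w ^ (N + l)) / B N) := by gcongr
      _ = _ := by field_simp
  have hrat : ‖rat s p (N + l) z‖ ≤
      (D / (c * B N) + K / (c * c) * (1 - y)⁻¹) * (B (N + l) * w ^ (N + l)) := by
    rw [dist_comm, dist_eq_norm, add_zero] at hd
    have := norm_sub_norm_le (rat s p (N + l) z) (rat s p N z)
    calc _ ≤ D / (c * B N) * (B (N + l) * w ^ (N + l)) +
          K / (c * c) * (B (N + l) * w ^ (N + l)) * (1 - y)⁻¹ := by linarith
      _ = _ := by ring
  have hqn : (normPoly (s (N + l))).eval z ≠ 0 := by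
    have := hlow l le_rfl
    exact norm_pos_iff.1 (lt_of_lt_of_le (by positivity) this)
  have e : (p (N + l)).eval z = (normPoly (s (N + l))).eval z * rat s p (N + l) z := by
    rw [rat, mul_div_cancel₀ _ hqn]
  rw [e, norm_mul]
  have hqM : ‖(normPoly (s (N + l))).eval z‖ ≤ (1 + |M|) ^ m :=
    (norm_eval_normPoly_le _ _ (h.card_le _ hmn)).trans (by gcongr)
  calc _ ≤ (1 + |M|) ^ m *
        ((D / (c * B N) + K / (c * c) * (1 - y)⁻¹) * (B (N + l) * w ^ (N + l))) := by gcongr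
    _ = _ := by ring

/-! ### Limits of poles off the critical circle -/

/-- In a disk that does not contain the origin the divisibility of the remainder by `z ^ (n + 1)` is
no restriction. -/
lemma exists_quotient (s : ℕ → Multiset ℂ) (p : ℕ → ℂ[X]) (lam : ℕ → ℕ) {ζ : ℂ} {b : ℝ}
    (hb : b ≤ ‖ζ‖) {κ : ℕ} {H : ℂ → ℂ}
    (hH : DifferentiableOn ℂ H (Metric.ball ζ b)) (n : ℕ) :
    ∃ G : ℂ → ℂ, DifferentiableOn ℂ G (Metric.ball ζ b) ∧ ∀ z ∈ Metric.ball ζ b,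
      z ^ (n + 1) * G z = z ^ lam n *
        ((normPoly (s n)).eval z * H z - (z - ζ) ^ κ * (p n).eval z) := by
  have h0 : ∀ z ∈ Metric.ball ζ b, z ^ (n + 1) ≠ 0 := by
    intro z hz
    refine pow_ne_zero _ ?_
    rintro rfl
    rw [Metric.mem_ball, dist_zero_left] at hz
    linarith
  refine ⟨fun z => z ^ lam n * ((normPoly (s n)).eval z * H z - (z - ζ) ^ κ * (p n).eval z) /
    z ^ (n + 1), ?_, fun z hz => mul_div_cancel₀ _ (h0 z hz)⟩
  refine DifferentiableOn.div ?_ (by fun_prop) h0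
  exact (by fun_prop : DifferentiableOn ℂ (fun z : ℂ => z ^ lam n) _).mul
    (((normPoly (s n)).differentiable.differentiableOn.mul hH).sub
      ((by fun_prop : DifferentiableOn ℂ (fun z : ℂ => (z - ζ) ^ κ) _).mul
        (p n).differentiable.differentiableOn))

/-- Outside the disk the remainder is the numerator itself: take `H = 0`. -/
theorem star_zero_of_exterior (h : IsRow f m m' s p lam A t) {B : ℕ → ℝ} (hR : 0 < R)
    (hB : Dominates m R A B) {Λ : Set ℕ} {c : ℝ} (hc : 0 < c)
    (hΛ : ∀ n ∈ Λ, m ≤ n ∧ c * B n ≤ ‖A n‖ * R ^ n) {ζ : ℂ} (hζ : R < ‖ζ‖)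
    (hcount : ∀ ε > 0, ∀ᶠ n in atTop, 1 ≤ (s n).countP fun z => dist z ζ < ε) :
    ∀ ε > 0, ∀ᶠ n in atTop ⊓ 𝓟 Λ, ∃ ξ ∈ t n, dist ζ ξ < ε := by
  set b : ℝ := min 1 ((‖ζ‖ - R) / 2) with hb
  have hb0 : 0 < b := lt_min one_pos (by linarith)
  have hb1 : b ≤ 1 := min_le_left _ _
  have hb2 : b ≤ (‖ζ‖ - R) / 2 := min_le_right _ _
  have hsep : ∀ z : ℂ, dist z ζ < b → R < ‖ζ‖ - b ∧ ‖ζ‖ - b ≤ ‖z‖ ∧ ‖z‖ ≤ ‖ζ‖ + b := by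
    intro z hz
    rw [dist_eq_norm] at hz
    have h1 := norm_sub_norm_le ζ z
    have h2 := norm_sub_norm_le z ζ
    rw [norm_sub_rev] at h1
    exact ⟨by linarith, by linarith, by linarith⟩
  obtain ⟨C, hC0, hC⟩ := h.exists_exterior_bound hR hB (ζ := ζ) (a := b / 2) (b := b)
    (μ := ‖ζ‖ - b) (M := ‖ζ‖ + b) (by linarith) (by linarith)
    (hsep ζ (by simpa using hb0)).1 (fun z _ hz => (hsep z hz).2)
  refine h.eventually_exists_star_zero hR hB hc hΛ (κ := 0) (by simpa using hcount) (a := b / 2)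
    (b := b)
    (μ := R) (C := C) (H := fun _ => 0) (by linarith) (by linarith) (by linarith) hR
    (fun z _ hz => by have := hsep z hz; linarith) (Eventually.of_forall fun n => ?_) ?_
  · exact exists_quotient s p lam (by linarith) (differentiableOn_const _) n
  · filter_upwards [hC] with n hn
    obtain ⟨ρ, h1, h2, h3⟩ := hn
    refine ⟨ρ, h1.le, h2, fun z hz => ?_⟩
    simpa using h3 z hz

lemma eventually_eval_ne_zero {q : ℂ[X]} (hq : q ≠ 0) (ζ : ℂ) :
    ∀ᶠ z in 𝓝[≠] ζ, q.eval z ≠ 0 := by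
  have hfin : ({z : ℂ | q.IsRoot z} \ {ζ}).Finite :=
    (finite_setOfPred_isRoot hq).subset Set.sdiff_subset
  have : ({z : ℂ | q.IsRoot z} \ {ζ})ᶜ ∈ 𝓝 ζ := hfin.isClosed.isOpen_compl.mem_nhds (by simp)
  filter_upwards [mem_nhdsWithin_of_mem_nhds this, self_mem_nhdsWithin] with z hz hzζ hqz
  exact hz ⟨hqz, hzζ⟩

/-- The case of a point of the open disk: `κ` is (at least) the order of the pole. -/
theorem star_zero_of_interior (h : IsRow f m m' s p lam A t) {B : ℕ → ℝ} (hR : 0 < R)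
    (hB : Dominates m R A B) {Λ : Set ℕ} {c : ℝ} (hc : 0 < c)
    (hΛ : ∀ n ∈ Λ, m ≤ n ∧ c * B n ≤ ‖A n‖ * R ^ n) {q : ℂ[X]} (hq0 : q.coeff 0 ≠ 0)
    (hq : ∀ r, 0 < r → r < R → ∃ C, PowerBound (q * f) r C) {ζ : ℂ} (hζ : ‖ζ‖ < R) {κ : ℕ}
    (hcount : ∀ ε > 0, ∀ᶠ n in atTop, κ + 1 ≤ (s n).countP fun z => dist z ζ < ε) {H : ℂ → ℂ}
    (hH : AnalyticAt ℂ H ζ)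
    (hHF : ∀ᶠ z in 𝓝[≠] ζ, (z - ζ) ^ κ * (psum ((q : PowerSeries ℂ) * f) z / q.eval z) = H z)
    (hκ : ζ = 0 → κ = 0 ∧ H = fun z => psum ((q : PowerSeries ℂ) * f) z / q.eval z) :
    ∀ ε > 0, ∀ᶠ n in atTop ⊓ 𝓟 Λ, ∃ ξ ∈ t n, dist ζ ξ < ε := by
  have hqne : q ≠ 0 := by rintro rfl; simp at hq0
  obtain ⟨G, hG, hGb⟩ := h.exists_remainder (fun r hr hrR => hB.exists_bound hr hrR) hq
  -- a ball on which all local conditions hold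
  have hloc : ∀ᶠ z in 𝓝 ζ,
      (z ≠ ζ → (z - ζ) ^ κ * (psum ((q : PowerSeries ℂ) * f) z / q.eval z) = H z
      ∧ q.eval z ≠ 0) ∧ AnalyticAt ℂ H z ∧ (ζ = 0 → q.eval z ≠ 0) := by
    refine (eventually_nhdsWithin_iff.1 (hHF.and (eventually_eval_ne_zero hqne ζ))).and
      (hH.eventually_analyticAt.and ?_)
    by_cases h0 : ζ = 0
    · subst h0
      rw [coeff_zero_eq_eval_zero] at hq0
      filter_upwards [q.continuous.continuousAt.eventually_ne hq0] with z hz _ using hz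
    · exact Eventually.of_forall fun z hz => absurd hz h0
  obtain ⟨b0, hb00, hb0⟩ := Metric.eventually_nhds_iff_ball.1 hloc
  obtain ⟨b1, hb1, hb1'⟩ : ∃ b1 > 0, ζ ≠ 0 → b1 ≤ ‖ζ‖ / 2 := by
    by_cases h0 : ζ = 0
    · exact ⟨1, one_pos, fun h => absurd h0 h⟩
    · exact ⟨‖ζ‖ / 2, by positivity, fun _ => le_rfl⟩
  set b : ℝ := min (min b0 b1) (min 1 ((R - ‖ζ‖) / 2)) with hb
  have hbpos : 0 < b := lt_min (lt_min hb00 hb1) (lt_min one_pos (by linarith))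
  have hbb0 : b ≤ b0 := (min_le_left _ _).trans (min_le_left _ _)
  have hbb1 : b ≤ b1 := (min_le_left _ _).trans (min_le_right _ _)
  have hb1 : b ≤ 1 := (min_le_right _ _).trans (min_le_left _ _)
  have hbR : b ≤ (R - ‖ζ‖) / 2 := (min_le_right _ _).trans (min_le_right _ _)
  have hMR : ‖ζ‖ + b < R := by linarith
  have hM : ∀ z : ℂ, dist z ζ < b → ‖z‖ ≤ ‖ζ‖ + b := by
    intro z hz
    rw [dist_eq_norm] at hz
    have := norm_sub_norm_le z ζ
    linarith
  have hμ : ∀ z : ℂ, b / 2 ≤ dist z ζ → dist z ζ < b → b / 2 ≤ ‖z‖ := by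
    intro z hz1 hz2
    by_cases h0 : ζ = 0
    · rw [h0, dist_zero_right] at hz1
      exact hz1
    · have h1 := hb1' h0
      rw [dist_eq_norm, norm_sub_rev] at hz2
      have := norm_sub_norm_le ζ z
      linarith
  obtain ⟨C, hC0, hC⟩ := h.exists_interior_bound hR hB hG hGb (ζ := ζ) (a := b / 2) (b := b)
    (μ := b / 2) (M := ‖ζ‖ + b) (by linarith) (by linarith) (by linarith)
    (by have := norm_nonneg ζ; linarith) hMR (fun z hz1 hz2 => ⟨hμ z hz1.le hz2, hM z hz2,
      ((hb0 z (Metric.mem_ball.2 (hz2.trans_le hbb0))).1 (by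
        rintro rfl; rw [dist_self] at hz1; linarith)).2⟩)
  refine h.eventually_exists_star_zero hR hB hc hΛ hcount (a := b / 2) (b := b)
    (μ := b / 2) (C := C) (H := H) (by linarith) (by linarith) (by linarith) (by linarith) hμ ?_ ?_
  · filter_upwards [eventually_ge_atTop m] with n hn
    have hHd : DifferentiableOn ℂ H (Metric.ball ζ b) := fun z hz =>
      (hb0 z (Metric.ball_subset_ball hbb0 hz)).2.1.differentiableAt.differentiableWithinAt
    by_cases h0 : ζ = 0
    · obtain ⟨rfl, rfl⟩ := hκ h0
      subst h0
      rw [norm_zero, zero_add] at hMR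
      obtain ⟨K, hK⟩ := hGb b hbpos hMR
      have hq1 : ∀ z ∈ Metric.ball (0 : ℂ) b, q.eval z ≠ 0 := fun z hz =>
        (hb0 z (Metric.ball_subset_ball hbb0 hz)).2.2 rfl
      refine ⟨fun z => psum (G n) z / q.eval z,
        (hK n hn).differentiableOn_psum.div q.differentiable.differentiableOn hq1, fun z hz => ?_⟩
      have h1 := hG n hn z ((mem_ball_zero_iff.1 hz).trans hMR)
      rw [mul_div_assoc', h1]
      have := hq1 z hz
      field_simp
    · exact exists_quotient s p lam (by have := hb1' h0; have := norm_nonneg ζ; linarith) hHd n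
  · filter_upwards [hC] with n hn
    obtain ⟨ρ, h1, h2, h3⟩ := hn
    refine ⟨ρ, h1.le, h2, fun z hz => ?_⟩
    have hzζ : z ≠ ζ := by rintro rfl; rw [dist_self] at hz; linarith
    have h4 := ((hb0 z (Metric.mem_ball.2 (by linarith))).1 hzζ).1
    have h5 := h3 z hz
    rw [← h4]
    have e : (normPoly (s n)).eval z * ((z - ζ) ^ κ *
        (psum ((q : PowerSeries ℂ) * f) z / q.eval z)) - (z - ζ) ^ κ * (p n).eval z =
        (z - ζ) ^ κ * ((normPoly (s n)).eval z *
          (psum ((q : PowerSeries ℂ) * f) z / q.eval z) - (p n).eval z) := by ring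
    rw [e, norm_mul, norm_pow, ← dist_eq_norm, hz]
    refine le_trans (mul_le_of_le_one_left (norm_nonneg _) (pow_le_one₀ ?_ ?_)) h5 <;> linarith

end IsRow

/-! ### Boundedness across the critical line -/

lemma norm_le_of_rectangle {g : ℂ → ℂ} {a b d r C : ℝ} (hd : 0 < d) (hr : 0 < r)
    (hg : ∀ w : ℂ, |w.re - a| ≤ d → |w.im - b| ≤ r → DifferentiableAt ℂ g w)
    (hside : ∀ w : ℂ, |w.re - a| = d → |w.im - b| ≤ r → ‖g w‖ ≤ C)
    (htop : ∀ w : ℂ, |w.re - a| ≤ d → |w.im - b| = r → ‖g w‖ ≤ C) {w : ℂ}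
    (h1 : |w.re - a| ≤ d) (h2 : |w.im - b| ≤ r) : ‖g w‖ ≤ C := by
  have hcl : closure (Set.Ioo (a - d) (a + d) ×ℂ Set.Ioo (b - r) (b + r)) =
      Set.Icc (a - d) (a + d) ×ℂ Set.Icc (b - r) (b + r) := by
    rw [Complex.closure_reProdIm, closure_Ioo (by linarith), closure_Ioo (by linarith)]
  have hmem : ∀ v : ℂ, v ∈ Set.Icc (a - d) (a + d) ×ℂ Set.Icc (b - r) (b + r) ↔
      |v.re - a| ≤ d ∧ |v.im - b| ≤ r := by
    intro v
    rw [Complex.mem_reProdIm, Set.mem_Icc, Set.mem_Icc, abs_le, abs_le]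
    constructor <;> rintro ⟨⟨_, _⟩, _, _⟩ <;> refine ⟨⟨?_, ?_⟩, ?_, ?_⟩ <;> linarith
  refine Complex.norm_le_of_forall_mem_frontier_norm_le
    (U := Set.Ioo (a - d) (a + d) ×ℂ Set.Ioo (b - r) (b + r)) ?_ ?_ (fun v hv => ?_) ?_
  · exact (Metric.isBounded_Ioo _ _).reProdIm (Metric.isBounded_Ioo _ _)
  · refine DifferentiableOn.diffContOnCl fun v hv => ?_
    rw [hcl, hmem] at hv
    exact (hg v hv.1 hv.2).differentiableWithinAt
  · rw [Complex.frontier_reProdIm, closure_Ioo (by linarith), closure_Ioo (by linarith),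
      frontier_Ioo (by linarith), frontier_Ioo (by linarith)] at hv
    rcases hv with hv | hv
    · rw [Complex.mem_reProdIm, Set.mem_Icc, Set.mem_insert_iff, Set.mem_singleton_iff] at hv
      refine htop v (by rw [abs_le]; constructor <;> linarith [hv.1.1, hv.1.2]) ?_
      rcases hv.2 with h | h <;> rw [h] <;> simp [abs_of_pos hr]
    · rw [Complex.mem_reProdIm, Set.mem_Icc, Set.mem_insert_iff, Set.mem_singleton_iff] at hv
      refine hside v ?_ (by rw [abs_le]; constructor <;> linarith [hv.2.1, hv.2.2])
      rcases hv.1 with h | h <;> rw [h] <;> simp [abs_of_pos hd]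
  · rw [hcl, hmem]
    exact ⟨h1, h2⟩

/-- In a thin vertical strip a bound on the long sides propagates inside, the bound on the short
sides being damped exponentially: multiplication by `exp (-ε cos ((w - c) / d))`. -/
lemma norm_le_of_thin_rectangle {g : ℂ → ℂ} {a b d r η C ℓ : ℝ} (hd : 0 < d) (hη : 0 ≤ η)
    (hr : 0 < r) (hC : 0 ≤ C) (hℓ : 0 ≤ ℓ)
    (hg : ∀ w : ℂ, |w.re - a| ≤ d → |w.im - b| ≤ r → DifferentiableAt ℂ g w)
    (hside : ∀ w : ℂ, |w.re - a| = d → |w.im - b| ≤ r → ‖g w‖ ≤ C)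
    (htop : ∀ w : ℂ, |w.re - a| ≤ d → |w.im - b| = r → ‖g w‖ ≤ C * Real.exp ℓ) {w : ℂ}
    (h1 : |w.re - a| ≤ d) (h2 : |w.im - b| ≤ r - η) :
    ‖g w‖ ≤ C * Real.exp (4 * ℓ * Real.exp (-(η / d))) := by
  -- on the short sides the factor `exp (-ε cos ((w - c) / d))` is at most `exp (-ℓ)`, as `cos ≥ 1 / 2`
  -- on `[-1, 1]`
  set ε : ℝ := 2 * ℓ / Real.cosh (r / d) with hε
  have hε0 : 0 ≤ ε := div_nonneg (by linarith) (Real.cosh_pos _).le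
  set c : ℂ := ⟨a, b⟩ with hc
  set E : ℂ → ℂ := fun w => Complex.exp (-(ε : ℂ) * Complex.cos ((w - c) / d)) with hE
  have hnorm : ∀ v : ℂ, ‖E v‖ =
      Real.exp (-(ε * (Real.cos ((v.re - a) / d) * Real.cosh ((v.im - b) / d)))) := by
    intro v
    rw [hE, Complex.norm_exp, Complex.cos_eq]
    congr 1
    have e1 : ((v - c) / d).re = (v.re - a) / d := by simp [hc]
    have e2 : ((v - c) / d).im = (v.im - b) / d := by simp [hc]
    rw [e1, e2, neg_mul, Complex.neg_re, Complex.re_ofReal_mul, ← Complex.ofReal_cos,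
      ← Complex.ofReal_cosh, ← Complex.ofReal_sin, ← Complex.ofReal_sinh, ← Complex.ofReal_mul,
      ← Complex.ofReal_mul, Complex.sub_re, Complex.ofReal_re, Complex.re_ofReal_mul]
    simp
  have hcos : ∀ v : ℂ, |v.re - a| ≤ d → 1 / 2 ≤ Real.cos ((v.re - a) / d) := by
    intro v hv
    have h3 : |(v.re - a) / d| ≤ 1 := by
      rw [abs_div, abs_of_pos hd]; exact (div_le_one hd).2 hv
    have h4 := Real.one_sub_sq_div_two_le_cos (x := (v.re - a) / d)
    have h5 : ((v.re - a) / d) ^ 2 ≤ 1 := by rwa [sq_le_one_iff_abs_le_one]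
    linarith
  have key : ‖g w * E w‖ ≤ C := by
    refine norm_le_of_rectangle hd hr (g := fun w => g w * E w) (fun v hv1 hv2 => ?_)
      (fun v hv1 hv2 => ?_) (fun v hv1 hv2 => ?_) h1 (by linarith)
    · refine (hg v hv1 hv2).mul ?_
      have : Differentiable ℂ E := by rw [hE]; fun_prop
      exact this v
    · rw [norm_mul]
      refine (mul_le_of_le_one_right (norm_nonneg _) ?_).trans (hside v hv1 hv2)
      rw [hnorm]
      refine Real.exp_le_one_iff.2 ?_
      have := hcos v hv1.le
      have := Real.cosh_pos ((v.im - b) / d)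
      rw [neg_nonpos]
      positivity
    · rw [norm_mul, hnorm]
      have h3 := htop v hv1 hv2
      have h4 : Real.cosh ((v.im - b) / d) = Real.cosh (r / d) := by
        rw [← Real.cosh_abs, abs_div, hv2, abs_of_pos hd]
      have h5 : ℓ ≤ ε * (Real.cos ((v.re - a) / d) * Real.cosh ((v.im - b) / d)) := by
        rw [h4, hε]
        have h6 := hcos v hv1
        have h7 := Real.cosh_pos (r / d)
        have : 2 * ℓ / Real.cosh (r / d) * (Real.cos ((v.re - a) / d) * Real.cosh (r / d)) =
            2 * ℓ * Real.cos ((v.re - a) / d) := by field_simp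
        rw [this]
        nlinarith
      calc _ ≤ C * Real.exp ℓ * Real.exp (-ℓ) := by gcongr
        _ = C := by rw [mul_assoc, ← Real.exp_add]; simp
  rw [norm_mul, hnorm] at key
  have h8 : ε * (Real.cos ((w.re - a) / d) * Real.cosh ((w.im - b) / d)) ≤
      4 * ℓ * Real.exp (-(η / d)) := by
    have h9 : Real.cosh ((w.im - b) / d) ≤ Real.exp ((r - η) / d) := by
      rw [← Real.cosh_abs, abs_div, abs_of_pos hd]
      have h10 : |w.im - b| / d ≤ (r - η) / d := by gcongr
      have h11 : 0 ≤ |w.im - b| / d := by positivity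
      rw [Real.cosh_eq]
      have h12 : Real.exp (|w.im - b| / d) ≤ Real.exp ((r - η) / d) := Real.exp_le_exp.2 h10
      have h13 : Real.exp (-(|w.im - b| / d)) ≤ Real.exp ((r - η) / d) :=
        Real.exp_le_exp.2 (by linarith)
      linarith
    have h14 : Real.exp (r / d) / 2 ≤ Real.cosh (r / d) := by
      rw [Real.cosh_eq]
      have := Real.exp_pos (-(r / d))
      linarith
    have h15 : ε ≤ 4 * ℓ * Real.exp (-(r / d)) := by
      rw [hε, div_le_iff₀ (Real.cosh_pos _)]
      calc 2 * ℓ = 4 * ℓ * Real.exp (-(r / d)) * (Real.exp (r / d) / 2) := by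
            have : Real.exp (-(r / d)) * Real.exp (r / d) = 1 := by
              rw [← Real.exp_add]; simp
            linear_combination (-(2 * ℓ)) * this
        _ ≤ _ := by gcongr
    have h16 := Real.cos_le_one ((w.re - a) / d)
    have h17 := hcos w h1
    have h18 := Real.cosh_pos ((w.im - b) / d)
    calc ε * (Real.cos ((w.re - a) / d) * Real.cosh ((w.im - b) / d))
        ≤ (4 * ℓ * Real.exp (-(r / d))) * (1 * Real.exp ((r - η) / d)) := by gcongr
      _ = 4 * ℓ * (Real.exp (-(r / d)) * Real.exp ((r - η) / d)) := by ring
      _ = _ := by rw [← Real.exp_add]; congr 2; ring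
  calc ‖g w‖ = ‖g w‖ * Real.exp (-(ε * (Real.cos ((w.re - a) / d) *
        Real.cosh ((w.im - b) / d)))) * Real.exp (ε * (Real.cos ((w.re - a) / d) *
        Real.cosh ((w.im - b) / d))) := by
        rw [mul_assoc, ← Real.exp_add]; simp
    _ ≤ _ := by gcongr

/-! ### Growth of the weights -/

/-- Concavity of `log (B n / n!)`: the increments of `log B` grow at most like those of
`log n!`. -/
lemma log_increment_le {m : ℕ} {B : ℕ → ℝ} (hpos : ∀ n, m ≤ n → 0 < B n)
    (hconc : ∀ n, m ≤ n →
      Real.log (B n / (n.factorial : ℝ)) + Real.log (B (n + 2) / ((n + 2).factorial : ℝ)) ≤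
        2 * Real.log (B (n + 1) / ((n + 1).factorial : ℝ))) {n : ℕ} (hn : m ≤ n) (i : ℕ) :
    Real.log (B (n + i + 1)) - Real.log (B (n + i)) ≤
      Real.log (B (n + 1)) - Real.log (B n) + i / (n + 1) := by
  have hlog : ∀ k, m ≤ k → Real.log (B k / (k.factorial : ℝ)) =
      Real.log (B k) - Real.log (k.factorial : ℝ) := fun k hk =>
    Real.log_div (hpos k hk).ne' (by exact_mod_cast k.factorial_ne_zero)
  have hfac : ∀ k : ℕ, Real.log ((k + 1).factorial : ℝ) =
      Real.log (k + 1) + Real.log (k.factorial : ℝ) := by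
    intro k
    rw [Nat.factorial_succ]
    push_cast
    rw [Real.log_mul (by positivity) (by exact_mod_cast k.factorial_ne_zero)]
  have hstep : ∀ k, m ≤ k → Real.log (B (k + 2)) - Real.log (B (k + 1)) - Real.log (k + 2) ≤
      Real.log (B (k + 1)) - Real.log (B k) - Real.log (k + 1) := by
    intro k hk
    have := hconc k hk
    rw [hlog k hk, hlog (k + 1) (by omega), hlog (k + 2) (by omega), hfac (k + 1), hfac k] at this
    push_cast at this
    rw [show (k : ℝ) + 1 + 1 = k + 2 by ring] at this
    linarith
  have hsum : ∀ i : ℕ, Real.log (B (n + i + 1)) - Real.log (B (n + i)) - Real.log (n + i + 1) ≤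
      Real.log (B (n + 1)) - Real.log (B n) - Real.log (n + 1) := by
    intro i
    induction i with
    | zero => simp
    | succ i ih =>
      refine le_trans ?_ ih
      have := hstep (n + i) (by omega)
      push_cast at this ⊢
      rw [show (n : ℝ) + (i + 1) + 1 = n + i + 2 by ring]
      exact this
  have h1 : Real.log (n + i + 1) - Real.log (n + 1) ≤ i / (n + 1) := by
    rw [← Real.log_div (by positivity) (by positivity)]
    refine (Real.log_le_sub_one_of_pos (by positivity)).trans (le_of_eq ?_)
    field_simp
    ring
  have := hsum i
  linarith

/-- Concavity of `log (B n / n!)` bounds `B` near the index `n` by a geometric sequence, up to a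
Gaussian factor. -/
lemma gaussian_growth {m : ℕ} {B : ℕ → ℝ} (hpos : ∀ n, m ≤ n → 0 < B n)
    (hconc : ∀ n, m ≤ n →
      Real.log (B n / (n.factorial : ℝ)) + Real.log (B (n + 2) / ((n + 2).factorial : ℝ)) ≤
        2 * Real.log (B (n + 1) / ((n + 1).factorial : ℝ))) {n : ℕ} (hn : 2 * m + 1 ≤ n) {i : ℕ}
    (hi : 2 * i ≤ n) :
    B (n + i) ≤ B n * Real.exp (i * (Real.log (B (n + 1)) - Real.log (B n)) + 2 * i ^ 2 / n) ∧
    B (n - i) ≤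
      B n * Real.exp (-(i * (Real.log (B (n + 1)) - Real.log (B n))) + 2 * i ^ 2 / n) := by
  set τ := Real.log (B (n + 1)) - Real.log (B n) with hτ
  have hn0 : (0 : ℝ) < n := by exact_mod_cast (by omega : 0 < n)
  have key : ∀ {k : ℕ} {e : ℝ}, m ≤ k → Real.log (B k) ≤ Real.log (B n) + e →
      B k ≤ B n * Real.exp e := by
    intro k e hk hle
    rw [← Real.exp_log (hpos k hk), ← Real.exp_log (hpos n (by omega)), ← Real.exp_add]
    exact Real.exp_le_exp.2 (by simpa using hle)
  constructor
  · refine key (by omega) ?_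
    clear hi
    induction i with
    | zero => simp
    | succ i ih =>
      have h1 := log_increment_le hpos hconc (by omega : m ≤ n) i
      have h2 : (i : ℝ) / (n + 1) ≤ i / n := by gcongr; linarith
      have h3 : 2 * (i : ℝ) ^ 2 / n + i / n ≤ 2 * ((i + 1 : ℕ) : ℝ) ^ 2 / n := by
        rw [← add_div]
        gcongr
        push_cast
        have : (0 : ℝ) ≤ i := Nat.cast_nonneg i
        nlinarith
      rw [← add_assoc]
      push_cast at h3 ⊢
      linarith
  · refine key (by omega) ?_
    induction i with
    | zero => simp
    | succ i ih =>
      have ih := ih (by omega)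
      have h1 := log_increment_le hpos hconc (by omega : m ≤ n - (i + 1)) (i + 1)
      rw [Nat.sub_add_cancel (by omega : i + 1 ≤ n), ← hτ,
        show n - (i + 1) + 1 = n - i by omega] at h1
      have h4 : ((i + 1 : ℕ) : ℝ) / (((n - (i + 1) : ℕ) : ℝ) + 1) ≤ 2 * (i + 1) / n := by
        rw [Nat.cast_sub (by omega)]
        have h5 : (2 : ℝ) * (i + 1) ≤ n := by exact_mod_cast hi
        have h6 : (n : ℝ) / 2 ≤ (n : ℝ) - ((i + 1 : ℕ) : ℝ) + 1 := by push_cast; linarith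
        rw [div_le_div_iff₀ (by linarith) hn0]
        push_cast at h6 ⊢
        have : (0 : ℝ) ≤ i := Nat.cast_nonneg i
        nlinarith
      have h3 : 2 * (i : ℝ) ^ 2 / n + 2 * (i + 1) / n ≤ 2 * ((i + 1 : ℕ) : ℝ) ^ 2 / n := by
        rw [← add_div]
        gcongr
        push_cast
        have : (0 : ℝ) ≤ i := Nat.cast_nonneg i
        nlinarith
      push_cast at h3 ⊢
      linarith

lemma inv_one_sub_exp_le {t : ℝ} (h0 : 0 < t) (h1 : t ≤ 1) : (1 - Real.exp (-t))⁻¹ ≤ 2 / t := by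
  have h2 : t / 2 ≤ 1 - Real.exp (-t) := by
    have h3 : Real.exp (-t) ≤ 1 / (1 + t) := by
      rw [Real.exp_neg, ← one_div]
      exact one_div_le_one_div_of_le (by linarith) (by linarith [Real.add_one_le_exp t])
    have h4 : 1 / (1 + t) ≤ 1 - t / 2 := by
      rw [div_le_iff₀ (by linarith)]; nlinarith
    linarith
  calc (1 - Real.exp (-t))⁻¹ ≤ (t / 2)⁻¹ := inv_anti₀ (by linarith) h2
    _ = 2 / t := by rw [inv_div]

/-- A growth hypothesis on a sequence of weights: near the index `n` they are dominated by a
geometric sequence with logarithmic ratio `τ n`, up to a Gaussian factor. -/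
def GaussianGrowth (B τ : ℕ → ℝ) (N : ℕ) : Prop :=
  ∀ n, N ≤ n → ∀ i : ℕ, 2 * i ≤ n → B (n + i) ≤ B n * Real.exp (i * τ n + 2 * i ^ 2 / n) ∧
    B (n - i) ≤ B n * Real.exp (-(i * τ n) + 2 * i ^ 2 / n)

/-- At distance `|x + τ n|` from the critical line of index `n`, a crude bound on `v k` for the
indices `k` comparable with `n` improves to the sharp bound: go from `n` to
`k = n ± |x + τ n| n / 4` and use the increments. -/
lemma norm_le_of_crude {B τ : ℕ → ℝ} {N : ℕ} (hB : ∀ n, N ≤ n → 0 < B n)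
    (hgr : GaussianGrowth B τ N) {v : ℕ → ℂ} {x K : ℝ} (hK : 0 ≤ K)
    (hinc : ∀ k, N ≤ k → ‖v (k + 1) - v k‖ ≤ K * (B k * Real.exp (k * x))) {n : ℕ}
    (hn : 2 * N + 1 ≤ n) (hs0 : 0 < |x + τ n|) (hs1 : |x + τ n| ≤ 1)
    (hcrude : ∀ k, n ≤ 2 * k → k ≤ 2 * n →
      ‖v k‖ ≤ Real.exp (|x + τ n| ^ 2 * n / 8) * (B k * Real.exp (k * x))) :
    ‖v n‖ ≤ (4 * K + 2) / |x + τ n| * (B n * Real.exp (n * x)) := by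
  set σ := |x + τ n| with hσ
  have hn0 : (0 : ℝ) < n := by exact_mod_cast (by omega : 0 < n)
  have hBn := hB n (by omega)
  set W := B n * Real.exp (n * x) with hW
  have hW0 : 0 < W := by positivity
  set i1 : ℕ := ⌊σ * n / 4⌋₊ with hi1
  have hi1le : (i1 : ℝ) ≤ σ * n / 4 := Nat.floor_le (by positivity)
  have hi1ge : σ * n / 4 - 1 < i1 := by
    have := Nat.lt_floor_add_one (σ * n / 4); linarith
  have hi1n : 4 * i1 ≤ n := by
    have : (4 : ℝ) * i1 ≤ n := by nlinarith
    exact_mod_cast this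
  have hgauss : ∀ i : ℕ, i ≤ i1 → -(i * σ) + 2 * (i : ℝ) ^ 2 / n ≤ -(σ / 2) * i := by
    intro i hi
    have h1 : (i : ℝ) ≤ σ * n / 4 := le_trans (by exact_mod_cast hi) hi1le
    have h2 : 2 * (i : ℝ) ^ 2 / n ≤ i * σ / 2 := by
      rw [div_le_iff₀ hn0]
      have : (0 : ℝ) ≤ i := Nat.cast_nonneg i
      nlinarith
    linarith
  have hend : Real.exp (σ ^ 2 * n / 8) * Real.exp (-(σ / 2) * i1) ≤ 2 := by
    rw [← Real.exp_add]
    have h1 : σ ^ 2 * n / 8 + -(σ / 2) * i1 ≤ 1 / 2 := by nlinarith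
    refine (Real.exp_le_exp.2 h1).trans ?_
    have := Real.exp_bound_div_one_sub_of_interval (x := 1 / 2) (by norm_num) (by norm_num)
    linarith
  set y := Real.exp (-(σ / 2)) with hy
  have hy0 : 0 < y := Real.exp_pos _
  have hy1 : y < 1 := by rw [hy, Real.exp_lt_one_iff]; linarith
  have hyi : ∀ i : ℕ, Real.exp (-(σ / 2) * i) = y ^ i := by
    intro i; rw [hy, ← Real.exp_nat_mul]; congr 1; ring
  have hgeo : ∑ i ∈ Finset.range i1, K * W * y ^ i ≤ K * W * (4 / σ) := by
    have h1 : ∑ i ∈ Finset.range i1, K * W * y ^ i ≤ K * W * (1 - y)⁻¹ :=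
      sum_le_hasSum _ (fun k _ => by positivity)
        ((hasSum_geometric_of_lt_one hy0.le hy1).mul_left _)
    refine h1.trans ?_
    have h2 := inv_one_sub_exp_le (t := σ / 2) (by linarith) (by linarith)
    gcongr
    refine h2.trans (le_of_eq ?_)
    field_simp
    norm_num
  -- both signs of `x + τ n` lead to the same two estimates
  suffices hmain : ∃ k, n ≤ 2 * k ∧ k ≤ 2 * n ∧
      B k * Real.exp (k * x) ≤ W * Real.exp (-(σ / 2) * i1) ∧
      dist (v n) (v k) ≤ ∑ i ∈ Finset.range i1, K * W * y ^ i by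
    obtain ⟨k, hk1, hk2, hk3, hk4⟩ := hmain
    have h1 := hcrude k hk1 hk2
    have h2 : ‖v k‖ ≤ 2 * W := by
      calc ‖v k‖ ≤ Real.exp (σ ^ 2 * n / 8) * (W * Real.exp (-(σ / 2) * i1)) := by
            refine h1.trans ?_; gcongr
        _ = (Real.exp (σ ^ 2 * n / 8) * Real.exp (-(σ / 2) * i1)) * W := by ring
        _ ≤ _ := by gcongr
    have h3 := norm_sub_norm_le (v n) (v k)
    rw [dist_eq_norm] at hk4
    have h4 : 2 * W ≤ 2 / σ * W := by
      gcongr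
      rw [le_div_iff₀ hs0]; linarith
    calc ‖v n‖ ≤ 2 * W + K * W * (4 / σ) := by linarith
      _ ≤ 2 / σ * W + K * W * (4 / σ) := by linarith
      _ = _ := by ring
  rcases le_total (x + τ n) 0 with hneg | hpos
  · have hσe : σ = -(x + τ n) := by rw [hσ, abs_of_nonpos hneg]
    have hterm : ∀ i : ℕ, i ≤ i1 →
        B (n + i) * Real.exp (((n + i : ℕ) : ℝ) * x) ≤ W * Real.exp (-(σ / 2) * i) := by
      intro i hi
      have h1 := (hgr n (by omega) i (by omega)).1
      calc B (n + i) * Real.exp (((n + i : ℕ) : ℝ) * x)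
          ≤ B n * Real.exp (i * τ n + 2 * i ^ 2 / n) * Real.exp (((n + i : ℕ) : ℝ) * x) := by gcongr
        _ = W * Real.exp (-(i * σ) + 2 * (i : ℝ) ^ 2 / n) := by
          rw [hW, mul_assoc, mul_assoc, ← Real.exp_add, ← Real.exp_add, hσe]
          congr 2
          push_cast
          ring
        _ ≤ _ := by gcongr; exact hgauss i hi
    refine ⟨n + i1, by omega, by omega, hterm i1 le_rfl, ?_⟩
    refine dist_le_range_sum_of_dist_le (f := fun i => v (n + i)) i1 fun {i} hi => ?_
    rw [dist_comm, dist_eq_norm]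
    refine (hinc (n + i) (by omega)).trans ?_
    rw [mul_assoc, ← hyi]
    exact mul_le_mul_of_nonneg_left (hterm i hi.le) hK
  · have hσe : σ = x + τ n := by rw [hσ, abs_of_nonneg hpos]
    have hterm : ∀ i : ℕ, i ≤ i1 →
        B (n - i) * Real.exp (((n - i : ℕ) : ℝ) * x) ≤ W * Real.exp (-(σ / 2) * i) := by
      intro i hi
      have h1 := (hgr n (by omega) i (by omega)).2
      calc B (n - i) * Real.exp (((n - i : ℕ) : ℝ) * x)
          ≤ B n * Real.exp (-(i * τ n) + 2 * i ^ 2 / n) * Real.exp (((n - i : ℕ) : ℝ) * x) := by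
            gcongr
        _ = W * Real.exp (-(i * σ) + 2 * (i : ℝ) ^ 2 / n) := by
          rw [hW, mul_assoc, mul_assoc, ← Real.exp_add, ← Real.exp_add, hσe]
          congr 2
          rw [Nat.cast_sub (by omega)]
          ring
        _ ≤ _ := by gcongr; exact hgauss i hi
    refine ⟨n - i1, by omega, by omega, hterm i1 le_rfl, ?_⟩
    refine dist_le_range_sum_of_dist_le (f := fun i => v (n - i)) i1 fun {i} hi => ?_
    rw [dist_eq_norm]
    have h1 := hinc (n - (i + 1)) (by omega)
    rw [show n - (i + 1) + 1 = n - i by omega] at h1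
    refine h1.trans ?_
    rw [mul_assoc]
    refine mul_le_mul_of_nonneg_left ((hterm (i + 1) (by omega)).trans ?_) hK
    rw [hyi]
    exact mul_le_mul_of_nonneg_left (pow_le_pow_of_le_one hy0.le hy1.le (by omega)) hW0.le

/-- The scheme of improvements near the critical line: if the increments of `u n` are dominated by
the weights `B n * exp (n * re w)` and `u n` itself is at most `exp (o(n))` times these weights,
then `u n` is bounded by the weights divided by the distance of `w` to the critical line
`re w = -τ n`.  The bound `exp (κ n / 16 ^ j)`, valid for `n ≥ 32 ^ j * N`, improves to the sharp
one at distance `≥ D / 4 ^ j` from the critical line (`norm_le_of_crude`), and the strip of this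
half-width is handled by `norm_le_of_thin_rectangle`, at the cost of a slightly smaller height. -/
lemma exists_bound_near_critical_line {B τ : ℕ → ℝ} {N₀ : ℕ} (hB : ∀ n, N₀ ≤ n → 0 < B n)
    (hgr : GaussianGrowth B τ N₀) (hτ : Tendsto τ atTop (𝓝 0)) {u : ℕ → ℂ → ℂ} {X y η K : ℝ}
    (hX : 0 < X) (hX1 : X ≤ 1 / 2) (hη : 0 < η) (hK : 0 ≤ K)
    (hd : ∀ n, N₀ ≤ n → ∀ w : ℂ, |w.re| ≤ X → |w.im - y| ≤ 2 * η → DifferentiableAt ℂ (u n) w)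
    (hinc : ∀ n, N₀ ≤ n → ∀ w : ℂ, |w.re| ≤ X → |w.im - y| ≤ 2 * η →
      ‖u (n + 1) w - u n w‖ ≤ K * (B n * Real.exp (n * w.re)))
    (hcr : ∀ ε > 0, ∃ N, ∀ n, N ≤ n → ∀ w : ℂ, |w.re| ≤ X → |w.im - y| ≤ 2 * η →
      ‖u n w‖ ≤ Real.exp (ε * n) * (B n * Real.exp (n * w.re))) :
    ∃ C N, 0 ≤ C ∧ ∀ n, N ≤ n → ∀ w : ℂ, |w.re| ≤ X → w.im = y →
      |w.re + τ n| * ‖u n w‖ ≤ C * (B n * Real.exp (n * w.re)) := by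
  -- `D ≤ X / 2` keeps the strips in the domain, `D ≤ η / 10` makes the damping of the strip lemma
  -- strong enough; `κ = D ^ 2 / 16` is what `norm_le_of_crude` tolerates at distance `D`
  set D : ℝ := min (X / 2) (η / 10) with hD
  have hD0 : 0 < D := lt_min (by linarith) (by linarith)
  have hDX : D ≤ X / 2 := min_le_left _ _
  have hDη : D ≤ η / 10 := min_le_right _ _
  set κ : ℝ := D ^ 2 / 16 with hκ
  have hκ0 : 0 < κ := by positivity
  set C₁ : ℝ := 4 * K + 2 with hC₁
  have hC₁0 : 0 < C₁ := by linarith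
  obtain ⟨N₁, hN₁⟩ := hcr κ hκ0
  obtain ⟨N₂, hN₂⟩ := Metric.tendsto_atTop.1 hτ (X / 2) (by linarith)
  obtain ⟨N₃, hN₃⟩ := exists_nat_ge ((|Real.log (C₁ / D)| + 2) / κ)
  set N : ℕ := N₀ + N₁ + N₂ + N₃ + 1 with hN
  have hκN : |Real.log (C₁ / D)| + 2 ≤ κ * N := by
    rw [div_le_iff₀ hκ0] at hN₃
    have : (N₃ : ℝ) ≤ N := by exact_mod_cast (by omega)
    nlinarith
  have hτX : ∀ n, N ≤ n → |τ n| ≤ X / 2 := fun n hn => by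
    have := hN₂ n (by omega)
    rw [Real.dist_eq, sub_zero] at this
    exact this.le
  have hp1 : ∀ j : ℕ, 1 ≤ 32 ^ j := fun j => Nat.one_le_pow _ _ (by norm_num)
  have hNj : ∀ j : ℕ, N ≤ N * 32 ^ j := fun j => Nat.le_mul_of_pos_right _ (hp1 j)
  have hr2 : ∀ j : ℕ, η + η / 2 ^ j ≤ 2 * η := fun j => by
    have : η / 2 ^ j ≤ η := div_le_self hη.le (one_le_pow₀ (by norm_num))
    linarith
  have hconst : ∀ j n : ℕ, N * 32 ^ (j + 1) ≤ n →
      C₁ / (D / 4 ^ j) ≤ Real.exp (κ / 16 ^ j * n / 32) := by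
    intro j n hn
    have h1 : C₁ / (D / 4 ^ j) = C₁ / D * 4 ^ j := by field_simp
    have h2 : (0 : ℝ) < C₁ / D := by positivity
    rw [h1, ← Real.log_le_iff_le_exp (by positivity), Real.log_mul h2.ne' (by positivity),
      Real.log_pow]
    have h3 : Real.log 4 ≤ 2 := by
      have := Real.log_two_lt_d9
      rw [show (4 : ℝ) = 2 ^ 2 by norm_num, Real.log_pow]
      push_cast; linarith
    have h4 : (N : ℝ) * 32 ^ (j + 1) ≤ n := by exact_mod_cast hn
    have h5 : κ * N * 2 ^ j ≤ κ / 16 ^ j * n / 32 := by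
      calc κ * N * 2 ^ j = κ / 16 ^ j * (N * 32 ^ (j + 1)) / 32 := by
            rw [pow_succ, show (32 : ℝ) = 2 * 16 by norm_num, mul_pow]; field_simp
        _ ≤ _ := by gcongr
    have h6 : (1 : ℝ) + j ≤ 2 ^ j := by
      have := one_add_mul_le_pow (by norm_num : (-2 : ℝ) ≤ 1) j
      norm_num at this; linarith
    have h7 : κ * N * (1 + j) ≤ κ * N * 2 ^ j := by gcongr
    have h8 := le_abs_self (Real.log (C₁ / D))
    have h9 : (0 : ℝ) ≤ j := Nat.cast_nonneg j
    nlinarith [abs_nonneg (Real.log (C₁ / D))]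
  -- sharp bound away from the critical line
  have hV : ∀ j : ℕ, (∀ n, N * 32 ^ j ≤ n → ∀ w : ℂ, |w.re| ≤ X → |w.im - y| ≤ η + η / 2 ^ j →
        ‖u n w‖ ≤ Real.exp (κ / 16 ^ j * n) * (B n * Real.exp (n * w.re))) →
      ∀ n, N * 32 ^ (j + 1) ≤ n → ∀ w : ℂ, |w.re| ≤ X → |w.im - y| ≤ η + η / 2 ^ j →
        D / 4 ^ j ≤ |w.re + τ n| →
        ‖u n w‖ ≤ C₁ / |w.re + τ n| * (B n * Real.exp (n * w.re)) := by
    intro j hT n hn w hw1 hw2 hs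
    have hnN := hNj j
    have hn' : 32 * (N * 32 ^ j) ≤ n := by rw [pow_succ] at hn; linarith
    have hs0 : 0 < D / 4 ^ j := by positivity
    refine norm_le_of_crude (v := fun k => u k w) hB hgr hK
      (fun k hk => hinc k hk w hw1 (hw2.trans (hr2 j))) (by omega) (hs0.trans_le hs) ?_ ?_
    · have := abs_add_le w.re (τ n)
      have := hτX n (by omega)
      linarith
    · intro k hk1 hk2
      refine (hT k (by omega) w hw1 hw2).trans ?_
      have hBk := hB k (by omega)
      gcongr
      have h1 : (k : ℝ) ≤ 2 * n := by exact_mod_cast hk2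
      have h2 : (D / 4 ^ j) ^ 2 ≤ |w.re + τ n| ^ 2 := by gcongr
      calc κ / 16 ^ j * k ≤ κ / 16 ^ j * (2 * n) := by gcongr
        _ = (D / 4 ^ j) ^ 2 * n / 8 := by
          rw [hκ, div_pow, ← pow_mul, mul_comm j 2, pow_mul]; norm_num; ring
        _ ≤ _ := by gcongr
  -- the strip around the critical line
  have hS : ∀ j : ℕ, (∀ n, N * 32 ^ j ≤ n → ∀ w : ℂ, |w.re| ≤ X → |w.im - y| ≤ η + η / 2 ^ j →
        ‖u n w‖ ≤ Real.exp (κ / 16 ^ j * n) * (B n * Real.exp (n * w.re))) →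
      ∀ n, N * 32 ^ (j + 1) ≤ n → ∀ w : ℂ, |w.im - y| ≤ η + η / 2 ^ (j + 1) →
        |w.re + τ n| ≤ D / 4 ^ j →
        ‖u n w‖ ≤ C₁ / (D / 4 ^ j) * Real.exp (4 * (κ / 16 ^ j * n) * Real.exp (-(5 * 2 ^ j))) *
          (B n * Real.exp (n * w.re)) := by
    intro j hT n hn w hw2 hs
    have hnN := hNj j
    have hn' : 32 * (N * 32 ^ j) ≤ n := by rw [pow_succ] at hn; linarith
    have hs0 : 0 < D / 4 ^ j := by positivity
    have hdj : D / 4 ^ j ≤ X / 2 := (div_le_self hD0.le (one_le_pow₀ (by norm_num))).trans hDX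
    have hre : ∀ v : ℂ, |v.re - -τ n| ≤ D / 4 ^ j → |v.re| ≤ X := fun v hv => by
      have h1 := hτX n (by omega)
      rw [sub_neg_eq_add, abs_le] at hv
      rw [abs_le] at h1 ⊢
      constructor <;> linarith [hv.1, hv.2, h1.1, h1.2]
    have hBn := hB n (by omega)
    have hnorm : ∀ v : ℂ, ‖u n v * Complex.exp (-(n * v)) / (B n : ℂ)‖ =
        ‖u n v‖ / (B n * Real.exp (n * v.re)) := by
      intro v
      rw [norm_div, norm_mul, Complex.norm_exp, Complex.norm_real, Real.norm_of_nonneg hBn.le]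
      have : (-((n : ℂ) * v)).re = -(n * v.re) := by simp
      rw [this, Real.exp_neg]
      field_simp
    have hle1 : 1 ≤ C₁ / (D / 4 ^ j) := by
      rw [le_div_iff₀ hs0]; linarith
    have h4 : η + η / 2 ^ (j + 1) = η + η / 2 ^ j - η / 2 ^ (j + 1) := by
      rw [pow_succ]; field_simp; ring
    have key := norm_le_of_thin_rectangle
      (g := fun v => u n v * Complex.exp (-(n * v)) / (B n : ℂ)) (a := -τ n) (b := y)
      (d := D / 4 ^ j) (r := η + η / 2 ^ j) (η := η / 2 ^ (j + 1)) (C := C₁ / (D / 4 ^ j))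
      (ℓ := κ / 16 ^ j * n) hs0 (by positivity) (by positivity) (by positivity) (by positivity)
      (fun v hv1 hv2 => ?_) (fun v hv1 hv2 => ?_) (fun v hv1 hv2 => ?_) (w := w)
      (by rwa [sub_neg_eq_add]) (by rwa [← h4])
    · rw [hnorm, div_le_iff₀ (by positivity)] at key
      refine key.trans ?_
      gcongr
      rw [le_div_iff₀ hs0]
      calc 5 * 2 ^ j * (D / 4 ^ j) ≤ 5 * 2 ^ j * (η / 10 / 4 ^ j) := by gcongr
        _ = η / 2 ^ (j + 1) := by
          rw [show (4 : ℝ) = 2 * 2 by norm_num, mul_pow, pow_succ]; field_simp; norm_num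
    · have := hd n (by omega) v (hre v hv1) (hv2.trans (hr2 j))
      fun_prop
    · have h1 := hV j hT n hn v (hre v hv1.le) hv2 (by rw [← hv1, sub_neg_eq_add])
      rw [hnorm, div_le_iff₀ (by positivity)]
      rwa [← sub_neg_eq_add, hv1] at h1
    · rw [hnorm, div_le_iff₀ (by positivity)]
      refine (hT n (by omega) v (hre v hv1) hv2.le).trans ?_
      have : (0 : ℝ) < B n * Real.exp (n * v.re) := by positivity
      rw [mul_assoc]
      exact le_mul_of_one_le_left (by positivity) hle1
  have hT : ∀ j : ℕ, ∀ n, N * 32 ^ j ≤ n → ∀ w : ℂ, |w.re| ≤ X → |w.im - y| ≤ η + η / 2 ^ j →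
        ‖u n w‖ ≤ Real.exp (κ / 16 ^ j * n) * (B n * Real.exp (n * w.re)) := by
    intro j
    induction j with
    | zero =>
      intro n hn w hw1 hw2
      simp only [pow_zero, mul_one, div_one] at hn hw2 ⊢
      exact hN₁ n (by omega) w hw1 (by linarith)
    | succ j ih =>
      intro n hn w hw1 hw2
      have hNN := hNj (j + 1)
      have hBn := hB n (by omega)
      have hs0 : 0 < D / 4 ^ j := by positivity
      have h0 : κ / 16 ^ (j + 1) * n = κ / 16 ^ j * n / 32 + κ / 16 ^ j * n / 32 := by
        rw [pow_succ]; field_simp; ring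
      have hpos : 0 ≤ κ / 16 ^ j * n := by positivity
      rcases le_total (D / 4 ^ j) |w.re + τ n| with hs | hs
      · have hw3 : |w.im - y| ≤ η + η / 2 ^ j := hw2.trans (by gcongr <;> norm_num)
        refine (hV j ih n hn w hw1 hw3 hs).trans ?_
        gcongr
        calc C₁ / |w.re + τ n| ≤ C₁ / (D / 4 ^ j) := by gcongr
          _ ≤ _ := hconst j n hn
          _ ≤ _ := Real.exp_le_exp.2 (by linarith)
      · refine (hS j ih n hn w hw2 hs).trans ?_
        gcongr
        rw [h0, Real.exp_add]
        gcongr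
        · exact hconst j n hn
        · have h1 : Real.exp (-(5 * 2 ^ j)) ≤ 1 / 128 := by
            have h2 : (1 : ℝ) ≤ 2 ^ j := one_le_pow₀ (by norm_num)
            have h3 : (128 : ℝ) ≤ Real.exp 5 := by
              have := Real.exp_one_gt_d9
              rw [show (5 : ℝ) = (5 : ℕ) * 1 by norm_num, Real.exp_nat_mul]
              calc (128 : ℝ) ≤ 2.7 ^ 5 := by norm_num
                _ ≤ _ := by gcongr; linarith
            rw [Real.exp_neg, ← one_div]
            exact one_div_le_one_div_of_le (by norm_num)
              (h3.trans (Real.exp_le_exp.2 (by linarith)))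
          nlinarith
  refine ⟨C₁ * Real.exp (4096 * κ * N), N * 32, by positivity, fun n hn w hw1 hw2 => ?_⟩
  have hBn := hB n (by omega)
  obtain ⟨j, hj1, hj2⟩ : ∃ j : ℕ, N * 32 ^ (j + 1) ≤ n ∧ n < N * 32 ^ (j + 2) := by
    have hN0 : 0 < N := by omega
    have h1 : 32 ≤ n / N := (Nat.le_div_iff_mul_le hN0).2 (by linarith)
    have h2 : 1 ≤ Nat.log 32 (n / N) := Nat.log_pos (by norm_num) h1
    refine ⟨Nat.log 32 (n / N) - 1, ?_, ?_⟩
    · rw [Nat.sub_add_cancel h2]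
      have := Nat.pow_log_le_self 32 (by omega : n / N ≠ 0)
      rw [Nat.le_div_iff_mul_le hN0] at this
      linarith
    · have := Nat.lt_pow_succ_log_self (by norm_num : 1 < 32) (n / N)
      rw [Nat.div_lt_iff_lt_mul hN0] at this
      rw [show Nat.log 32 (n / N) - 1 + 2 = (Nat.log 32 (n / N)).succ by omega]
      linarith
  have hs0 : 0 < D / 4 ^ j := by positivity
  rcases le_total (D / 4 ^ j) |w.re + τ n| with hs | hs
  · have h1 := hV j (hT j) n hj1 w hw1 (by rw [hw2, sub_self, abs_zero]; positivity) hs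
    calc |w.re + τ n| * ‖u n w‖
        ≤ |w.re + τ n| * (C₁ / |w.re + τ n| * (B n * Real.exp (n * w.re))) := by gcongr
      _ = C₁ * 1 * (B n * Real.exp (n * w.re)) := by field_simp [(hs0.trans_le hs).ne']
      _ ≤ _ := by
        gcongr
        exact Real.one_le_exp (by positivity)
  · have h1 := hS j (hT j) n hj1 w (by rw [hw2, sub_self, abs_zero]; positivity) hs
    calc |w.re + τ n| * ‖u n w‖ ≤ D / 4 ^ j * (C₁ / (D / 4 ^ j) *
          Real.exp (4 * (κ / 16 ^ j * n) * Real.exp (-(5 * 2 ^ j))) *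
          (B n * Real.exp (n * w.re))) := by gcongr
      _ = C₁ * Real.exp (4 * (κ / 16 ^ j * n) * Real.exp (-(5 * 2 ^ j))) *
          (B n * Real.exp (n * w.re)) := by field_simp
      _ ≤ _ := by
        refine mul_le_mul_of_nonneg_right
          (mul_le_mul_of_nonneg_left (Real.exp_le_exp.2 ?_) hC₁0.le) (by positivity)
        have h2 : (n : ℝ) ≤ N * 32 ^ (j + 2) := by exact_mod_cast hj2.le
        have h3 : (2 : ℝ) ^ j * Real.exp (-(5 * 2 ^ j)) ≤ 1 := by
          have h4 := Real.add_one_le_exp ((5 : ℝ) * 2 ^ j)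
          have h5 : (0 : ℝ) < 2 ^ j := by positivity
          rw [Real.exp_neg, ← div_eq_mul_inv, div_le_one (Real.exp_pos _)]
          linarith
        calc 4 * (κ / 16 ^ j * n) * Real.exp (-(5 * 2 ^ j))
            ≤ 4 * (κ / 16 ^ j * (N * 32 ^ (j + 2))) * Real.exp (-(5 * 2 ^ j)) := by gcongr
          _ = 4096 * κ * N * (2 ^ j * Real.exp (-(5 * 2 ^ j))) := by
            rw [pow_add, show (32 : ℝ) ^ j = 2 ^ j * 16 ^ j by rw [← mul_pow]; norm_num]
            field_simp; ring
          _ ≤ 4096 * κ * N * 1 := by gcongr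
          _ = _ := mul_one _

/-! ### Bounds off the critical circle -/

lemma norm_le_of_increment_le_of_le_mul_succ {v : ℕ → ℂ} {W : ℕ → ℝ} {N : ℕ} {K ρ D : ℝ}
    (hK : 0 ≤ K) (hρ1 : ρ < 1) (hW : ∀ k, N ≤ k → 0 < W k)
    (hr : ∀ k, N ≤ k → W k ≤ ρ * W (k + 1))
    (hinc : ∀ k, N ≤ k → ‖v (k + 1) - v k‖ ≤ K * W k) (hD0 : 0 ≤ D) (hD : ‖v N‖ ≤ D * W N) {n : ℕ}
    (hn : N ≤ n) : ‖v n‖ ≤ (D + K / (1 - ρ)) * W n := by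
  have h1 : 0 < 1 - ρ := by linarith
  induction n, hn using Nat.le_induction with
  | base =>
    refine hD.trans ?_
    have := hW N le_rfl
    gcongr
    have : 0 ≤ K / (1 - ρ) := by positivity
    linarith
  | succ n hn ih =>
    have h2 := norm_le_norm_add_norm_sub' (v (n + 1)) (v n)
    have h3 := hW n hn
    have h4 := hW (n + 1) (by omega)
    have h5 : ρ * (K / (1 - ρ) + K) ≤ K / (1 - ρ) := by
      rw [div_add' _ _ _ h1.ne', ← mul_div_assoc]
      gcongr
      nlinarith [sq_nonneg (1 - ρ)]
    calc ‖v (n + 1)‖ ≤ (D + K / (1 - ρ)) * W n + K * W n := by linarith [hinc n hn]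
      _ = (D + (K / (1 - ρ) + K)) * W n := by ring
      _ ≤ (D + (K / (1 - ρ) + K)) * (ρ * W (n + 1)) := by gcongr; exact hr n hn
      _ = (ρ * D + ρ * (K / (1 - ρ) + K)) * W (n + 1) := by ring
      _ ≤ _ := by gcongr; nlinarith

lemma norm_le_of_increment_le_of_le_mul_succ' {v : ℕ → ℂ} {W : ℕ → ℝ} {N : ℕ} {K ρ D : ℝ}
    (hK : 0 ≤ K) (hρ1 : 1 ≤ ρ) (hW : ∀ k, N ≤ k → 0 < W k)
    (hr : ∀ k, N ≤ k → W k ≤ ρ * W (k + 1))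
    (hinc : ∀ k, N ≤ k → ‖v (k + 1) - v k‖ ≤ K * W k) (hD0 : 0 ≤ D) (hD : ‖v N‖ ≤ D * W N) {n : ℕ}
    (hn : N ≤ n) : ‖v n‖ ≤ (D + K * n) * ρ ^ n * W n := by
  have hρ : 0 ≤ ρ := by linarith
  induction n, hn using Nat.le_induction with
  | base =>
    refine hD.trans ?_
    have := hW N le_rfl
    have h1 : 1 ≤ ρ ^ N := one_le_pow₀ hρ1
    have h2 : 0 ≤ K * N := by positivity
    gcongr
    nlinarith
  | succ n hn ih =>
    have h2 := norm_le_norm_add_norm_sub' (v (n + 1)) (v n)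
    have h3 := hW n hn
    have h1 : 1 ≤ ρ ^ n := one_le_pow₀ hρ1
    calc ‖v (n + 1)‖ ≤ (D + K * n) * ρ ^ n * W n + K * 1 * W n := by linarith [hinc n hn]
      _ ≤ (D + K * n) * ρ ^ n * W n + K * ρ ^ n * W n := by gcongr
      _ = (D + K * (n + 1)) * ρ ^ n * W n := by ring
      _ ≤ (D + K * (n + 1)) * ρ ^ n * (ρ * W (n + 1)) := by gcongr; exact hr n hn
      _ = _ := by push_cast; ring

lemma norm_le_of_increment_le_of_tendsto {v : ℕ → ℂ} {W : ℕ → ℝ} {N : ℕ} {K ρ : ℝ}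
    (hK : 0 ≤ K) (hρ : 0 ≤ ρ) (hρ1 : ρ < 1)
    (hr : ∀ k, N ≤ k → W (k + 1) ≤ ρ * W k)
    (hinc : ∀ k, N ≤ k → ‖v (k + 1) - v k‖ ≤ K * W k) (hlim : Tendsto v atTop (𝓝 0)) {n : ℕ}
    (hn : N ≤ n) : ‖v n‖ ≤ K / (1 - ρ) * W n := by
  have hgeo : ∀ i, W (n + i) ≤ ρ ^ i * W n := by
    intro i
    induction i with
    | zero => simp
    | succ i ih =>
      calc W (n + i + 1) ≤ ρ * W (n + i) := hr _ (by omega)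
        _ ≤ ρ * (ρ ^ i * W n) := by gcongr
        _ = _ := by ring
  have h := dist_le_of_le_geometric_of_tendsto₀ (f := fun i => v (n + i)) ρ (K * W n) hρ1
    (fun i => ?_) (a := 0) ?_
  · rw [dist_zero_right] at h
    exact h.trans_eq (by ring)
  · rw [dist_comm, dist_eq_norm]
    refine (hinc (n + i) (by omega)).trans ?_
    calc K * W (n + i) ≤ K * (ρ ^ i * W n) := by gcongr; exact hgeo i
      _ = _ := by ring
  · have := (tendsto_add_atTop_iff_nat n).2 hlim
    simpa only [add_comm] using this

lemma Dominates.exists_ratio_bounds {m : ℕ} {R : ℝ} {A : ℕ → ℂ} {B : ℕ → ℝ} (hB : Dominates m R A B)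
    {σ : ℝ} (hσ : 0 < σ) :
    ∃ N, m ≤ N ∧ ∀ n, N ≤ n → B n ≤ Real.exp σ * B (n + 1) ∧ B (n + 1) ≤ Real.exp σ * B n := by
  obtain ⟨N, hmN, hN⟩ := hB.exists_growth (Real.exp_pos (-σ))
    (by rw [Real.exp_lt_one_iff]; linarith)
  refine ⟨N, hmN, fun n hn => ?_⟩
  have h1 := hN n hn 1
  rw [pow_one, Real.exp_neg, ← div_eq_mul_inv, ← div_eq_mul_inv, div_le_iff₀ (Real.exp_pos σ),
    div_le_iff₀ (Real.exp_pos σ)] at h1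
  exact ⟨by rw [mul_comm]; exact h1.2, by rw [mul_comm]; exact h1.1⟩

/-- Away from the critical line `re w = 0` the sequence `u n` is dominated by the weights. -/
lemma Dominates.exists_bound_off_critical_line {m : ℕ} {R : ℝ} {A : ℕ → ℂ} {B : ℕ → ℝ}
    (hB : Dominates m R A B) {u : ℕ → ℂ → ℂ} {S : Set ℂ} {N₀ : ℕ} {K : ℝ} (hK : 0 ≤ K)
    (hinc : ∀ n, N₀ ≤ n → ∀ w ∈ S, ‖u (n + 1) w - u n w‖ ≤ K * (B n * Real.exp (n * w.re)))
    (hbdd : ∀ n, N₀ ≤ n → ∃ D, 0 ≤ D ∧ ∀ w ∈ S, ‖u n w‖ ≤ D)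
    (hlim : ∀ w ∈ S, w.re < 0 → Tendsto (fun n => u n w) atTop (𝓝 0)) {x : ℝ} (hx : 0 < x) :
    ∃ C N, ∀ n, N ≤ n → ∀ w ∈ S, x ≤ |w.re| → ‖u n w‖ ≤ C * (B n * Real.exp (n * w.re)) := by
  obtain ⟨N₁, hm1, hN₁⟩ := hB.exists_ratio_bounds (half_pos hx)
  set N := max N₀ N₁ with hN
  obtain ⟨D, hD0, hD⟩ := hbdd N (le_max_left _ _)
  set ρ := Real.exp (-(x / 2)) with hρ
  have hρ0 : 0 < ρ := Real.exp_pos _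
  have hρ1 : ρ < 1 := by rw [hρ, Real.exp_lt_one_iff]; linarith
  have h1ρ : 0 < 1 - ρ := by linarith
  have hBN := hB.pos N (hm1.trans (le_max_right _ _))
  have hpos : ∀ k, N ≤ k → 0 < B k := fun k hk => hB.pos k (by omega)
  refine ⟨D / (B N * Real.exp (-N)) + K / (1 - ρ), N, fun n hn w hw hwx => ?_⟩
  have hBn := hpos n hn
  rcases le_total 0 w.re with h0 | h0
  · rw [abs_of_nonneg h0] at hwx
    refine norm_le_of_increment_le_of_le_mul_succ (v := fun n => u n w)
      (W := fun n => B n * Real.exp (n * w.re)) hK hρ1 (fun k hk => ?_) (fun k hk => ?_)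
      (fun k hk => hinc k (by omega) w hw) (by positivity) ?_ hn
    · have := hpos k hk
      positivity
    · have h2 := (hN₁ k (by omega)).1
      have h3 := hpos (k + 1) (by omega)
      calc B k * Real.exp (k * w.re) ≤ Real.exp (x / 2) * B (k + 1) * Real.exp (k * w.re) := by
            gcongr
        _ = B (k + 1) * Real.exp (x / 2 + k * w.re) := by rw [Real.exp_add]; ring
        _ ≤ B (k + 1) * Real.exp (-(x / 2) + ((k + 1 : ℕ) : ℝ) * w.re) := by
            refine mul_le_mul_of_nonneg_left (Real.exp_le_exp.2 ?_) h3.le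
            push_cast
            linarith
        _ = _ := by rw [Real.exp_add]; ring
    · refine (hD w hw).trans ?_
      rw [div_mul_eq_mul_div, le_div_iff₀ (by positivity)]
      gcongr
      have : (0 : ℝ) ≤ N := Nat.cast_nonneg N
      nlinarith
  · rw [abs_of_nonpos h0] at hwx
    have h4 := norm_le_of_increment_le_of_tendsto (v := fun n => u n w)
      (W := fun n => B n * Real.exp (n * w.re)) hK hρ0.le hρ1 (fun k hk => ?_)
      (fun k hk => hinc k ((le_max_left _ _).trans hk) w hw) (hlim w hw (by linarith)) hn
    · refine h4.trans ?_
      have : 0 ≤ D / (B N * Real.exp (-N)) := by positivity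
      gcongr
      linarith
    · have h2 := (hN₁ k (by omega)).2
      have h3 := hpos k hk
      calc B (k + 1) * Real.exp ((k + 1 : ℕ) * w.re)
          ≤ Real.exp (x / 2) * B k * Real.exp ((k + 1 : ℕ) * w.re) := by gcongr
        _ = B k * Real.exp (x / 2 + (k + 1 : ℕ) * w.re) := by rw [Real.exp_add]; ring
        _ ≤ B k * Real.exp (-(x / 2) + k * w.re) := by
            refine mul_le_mul_of_nonneg_left (Real.exp_le_exp.2 ?_) h3.le
            push_cast
            linarith
        _ = _ := by rw [Real.exp_add]; ring

lemma exists_forall_add_mul_le_exp {D K ε : ℝ} (hD : 0 ≤ D) (hε : 0 < ε) :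
    ∃ N : ℕ, ∀ n : ℕ, N ≤ n → D + K * n ≤ Real.exp (ε * n) := by
  obtain ⟨N, hN⟩ := exists_nat_ge (2 * (D + K) / ε ^ 2)
  refine ⟨N + 1, fun n hn => ?_⟩
  have h1 : (1 : ℝ) ≤ n := by exact_mod_cast (by omega : 1 ≤ n)
  have h2 : (N : ℝ) ≤ n := by exact_mod_cast (by omega : N ≤ n)
  have h3 := Real.quadratic_le_exp_of_nonneg (by positivity : 0 ≤ ε * n)
  rw [div_le_iff₀ (by positivity)] at hN
  have h4 : 2 * (D + K) * n ≤ n * ε ^ 2 * n := by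
    have h7 : 2 * (D + K) ≤ n * ε ^ 2 := hN.trans (by gcongr)
    gcongr
  have h5 : D * 1 ≤ D * n := by gcongr
  have h6 : 0 ≤ ε * n := by positivity
  nlinarith

/-- Everywhere near the critical line `u n` is at most `exp (o(n))` times the weights. -/
lemma Dominates.exists_crude_bound {m : ℕ} {R : ℝ} {A : ℕ → ℂ} {B : ℕ → ℝ}
    (hB : Dominates m R A B) {u : ℕ → ℂ → ℂ} {S : Set ℂ} {N₀ : ℕ} {K : ℝ} (hK : 0 ≤ K)
    (hS : ∀ w ∈ S, |w.re| ≤ 1)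
    (hinc : ∀ n, N₀ ≤ n → ∀ w ∈ S, ‖u (n + 1) w - u n w‖ ≤ K * (B n * Real.exp (n * w.re)))
    (hbdd : ∀ n, N₀ ≤ n → ∃ D, 0 ≤ D ∧ ∀ w ∈ S, ‖u n w‖ ≤ D)
    (hlim : ∀ w ∈ S, w.re < 0 → Tendsto (fun n => u n w) atTop (𝓝 0)) {ε : ℝ} (hε : 0 < ε) :
    ∃ N, ∀ n, N ≤ n → ∀ w ∈ S, ‖u n w‖ ≤ Real.exp (ε * n) * (B n * Real.exp (n * w.re)) := by
  have hε4 : 0 < ε / 4 := by positivity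
  obtain ⟨C, N₁, hN₁⟩ := hB.exists_bound_off_critical_line hK hinc hbdd hlim hε4
  obtain ⟨N₂, hm2, hN₂⟩ := hB.exists_ratio_bounds hε4
  set N := max N₀ N₂ with hN
  obtain ⟨D, hD0, hD⟩ := hbdd N (le_max_left _ _)
  have hpos : ∀ k, N ≤ k → 0 < B k := fun k hk => hB.pos k (by omega)
  have hBN := hpos N le_rfl
  set D' := D / (B N * Real.exp (-N)) with hD'
  have hD'0 : 0 ≤ D' := by positivity
  obtain ⟨N₃, hN₃⟩ := exists_forall_add_mul_le_exp (K := 0) (abs_nonneg C) hε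
  obtain ⟨N₄, hN₄⟩ := exists_forall_add_mul_le_exp (K := K) hD'0 (half_pos hε)
  refine ⟨N + N₁ + N₃ + N₄, fun n hn w hw => ?_⟩
  have hBn := hpos n (by omega)
  rcases le_total (ε / 4) |w.re| with hx | hx
  · refine (hN₁ n (by omega) w hw hx).trans ?_
    gcongr
    have := hN₃ n (by omega)
    rw [zero_mul, add_zero] at this
    exact (le_abs_self C).trans this
  · have h1 := norm_le_of_increment_le_of_le_mul_succ' (v := fun n => u n w)
      (W := fun n => B n * Real.exp (n * w.re)) (ρ := Real.exp (ε / 2)) (D := D') hK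
      (Real.one_le_exp (by positivity)) (fun k hk => ?_) (fun k hk => ?_)
      (fun k hk => hinc k ((le_max_left _ _).trans hk) w hw) hD'0 ?_ (by omega : N ≤ n)
    · refine h1.trans ?_
      gcongr
      calc (D' + K * n) * Real.exp (ε / 2) ^ n ≤ Real.exp (ε / 2 * n) * Real.exp (ε / 2) ^ n := by
            gcongr; exact hN₄ n (by omega)
        _ = Real.exp (ε * n) := by
            rw [← Real.exp_nat_mul, ← Real.exp_add]; congr 1; ring
    · have := hpos k hk
      positivity
    · have h2 := (hN₂ k (by omega)).1
      have h3 := hpos (k + 1) (by omega)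
      calc B k * Real.exp (k * w.re) ≤ Real.exp (ε / 4) * B (k + 1) * Real.exp (k * w.re) := by
            gcongr
        _ = B (k + 1) * Real.exp (ε / 4 + k * w.re) := by rw [Real.exp_add]; ring
        _ ≤ B (k + 1) * Real.exp (ε / 2 + ((k + 1 : ℕ) : ℝ) * w.re) := by
            refine mul_le_mul_of_nonneg_left (Real.exp_le_exp.2 ?_) h3.le
            push_cast
            linarith [(abs_le.1 hx).1]
        _ = _ := by rw [Real.exp_add]; ring
    · refine (hD w hw).trans ?_
      rw [hD', div_mul_eq_mul_div, le_div_iff₀ (by positivity)]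
      gcongr
      have : (0 : ℝ) ≤ N := Nat.cast_nonneg N
      nlinarith [(abs_le.1 (hS w hw)).1]

/-- Locally uniform lower bounds for polynomials that converge coefficientwise. -/
lemma exists_uniform_lower_bound {m : ℕ} {s : ℕ → Multiset ℂ} (hs : ∀ n, m ≤ n → (s n).card ≤ m)
    {L : ℂ[X]} (hL : ∀ i, Tendsto (fun n => (normPoly (s n)).coeff i) atTop (𝓝 (L.coeff i)))
    {S : Set ℂ} (hS : IsCompact S) (hne : ∀ z ∈ S, L.eval z ≠ 0) :
    ∃ c > 0, ∃ N, m ≤ N ∧ ∀ n, N ≤ n → ∀ z ∈ S, c ≤ ‖(normPoly (s n)).eval z‖ := by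
  obtain ⟨c, hc0, hc⟩ : ∃ c > 0, ∀ z ∈ S, c ≤ ‖L.eval z‖ := by
    rcases S.eq_empty_or_nonempty with rfl | hne'
    · exact ⟨1, one_pos, by simp⟩
    · obtain ⟨z, hz, hmin⟩ := hS.exists_isMinOn hne' L.continuous.norm.continuousOn
      exact ⟨‖L.eval z‖, norm_pos_iff.2 (hne z hz), fun w hw => hmin hw⟩
  obtain ⟨M, hM⟩ := hS.isBounded.exists_norm_le
  set d := max m L.natDegree + 1 with hd
  have hlim : Tendsto
      (fun n => ∑ i ∈ Finset.range d, ‖(normPoly (s n)).coeff i - L.coeff i‖ * |M| ^ i) atTop (𝓝 0) := by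
    have : Tendsto (fun n => ∑ i ∈ Finset.range d, ‖(normPoly (s n)).coeff i - L.coeff i‖ * |M| ^ i)
        atTop (𝓝 (∑ i ∈ Finset.range d, 0 * |M| ^ i)) :=
      tendsto_finsetSum _ fun i _ =>
        (tendsto_iff_norm_sub_tendsto_zero.1 (hL i)).mul_const _
    simpa using this
  obtain ⟨N, hN⟩ := eventually_atTop.1 (hlim.eventually (gt_mem_nhds (half_pos hc0)))
  refine ⟨c / 2, half_pos hc0, max N m, le_max_right _ _, fun n hn z hz => ?_⟩
  have h1 : ‖(normPoly (s n)).eval z - L.eval z‖ ≤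
      ∑ i ∈ Finset.range d, ‖(normPoly (s n)).coeff i - L.coeff i‖ * |M| ^ i := by
    rw [eval_eq_sum_range' (n := d) (by
        rw [natDegree_normPoly]; have := hs n ((le_max_right _ _).trans hn); omega),
      eval_eq_sum_range' (n := d) (p := L) (by omega), ← Finset.sum_sub_distrib]
    refine norm_sum_le_of_le _ fun i _ => ?_
    rw [← sub_mul, norm_mul, norm_pow]
    gcongr
    exact (hM z hz).trans (le_abs_self M)
  have h2 := hN n ((le_max_left _ _).trans hn)
  have h3 := hc z hz
  have h4 := norm_sub_norm_le (L.eval z) ((normPoly (s n)).eval z)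
  rw [norm_sub_rev] at h4
  linarith

/-! ### Limits of poles on the critical circle -/

/-- A bound with a singularity on the critical line `re w = -τ n` is regularized by multiplication
with a polynomial that vanishes where this line meets the horizontal sides of a square. -/
lemma exists_bound_across_critical_line {B τ : ℕ → ℝ} (hτ : Tendsto τ atTop (𝓝 0)) {N₀ : ℕ}
    (hB : ∀ n, N₀ ≤ n → 0 < B n) {Φ : ℕ → ℂ → ℂ} {ω C₁ C₂ : ℝ} (hω : 0 < ω) (hω1 : ω ≤ 1 / 2)
    (hC₁ : 0 ≤ C₁) (hC₂ : 0 ≤ C₂)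
    (hd : ∀ n, N₀ ≤ n → ∀ w : ℂ, |w.re| ≤ ω → |w.im| ≤ ω → DifferentiableAt ℂ (Φ n) w)
    (hside : ∀ n, N₀ ≤ n → ∀ w : ℂ, ω / 4 ≤ |w.re| → |w.re| ≤ ω → |w.im| ≤ ω →
      ‖Φ n w‖ ≤ C₁ * (B n * Real.exp (n * w.re)))
    (htop : ∀ n, N₀ ≤ n → ∀ w : ℂ, |w.re| ≤ ω → |w.im| = ω / 2 →
      |w.re + τ n| * ‖Φ n w‖ ≤ C₂ * (B n * Real.exp (n * w.re))) :
    ∃ C N, ∀ n, N ≤ n → ∀ w : ℂ, ‖w‖ ≤ ω / 4 → ‖Φ n w‖ ≤ C * (B n * Real.exp (n * w.re)) := by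
  obtain ⟨N₁, hN₁⟩ := Metric.tendsto_atTop.1 hτ (ω / 16) (by linarith)
  refine ⟨3 * (C₁ + C₂) / (ω ^ 2 / 8), max N₀ N₁, fun n hn w hw => ?_⟩
  have hτn : |τ n| ≤ ω / 16 := by
    have := hN₁ n ((le_max_right _ _).trans hn)
    rw [Real.dist_eq, sub_zero] at this
    exact this.le
  have hn0 : N₀ ≤ n := (le_max_left _ _).trans hn
  have hBn := hB n hn0
  have hτ1 := abs_le.1 hτn
  set Ψ : ℂ → ℂ := fun v =>
    ((v + τ n) ^ 2 + (ω / 2) ^ 2) * (Φ n v * Complex.exp (-(n * v)) / (B n : ℂ))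
    with hΨ
  have hnorm : ∀ v : ℂ, ‖Ψ v‖ =
      ‖(v + τ n) ^ 2 + ((ω : ℂ) / 2) ^ 2‖ * (‖Φ n v‖ / (B n * Real.exp (n * v.re))) := by
    intro v
    rw [hΨ, norm_mul, norm_div, norm_mul, Complex.norm_exp, Complex.norm_real,
      Real.norm_of_nonneg hBn.le]
    have : (-((n : ℂ) * v)).re = -(n * v.re) := by simp
    rw [this, Real.exp_neg]
    field_simp
  have hre : ∀ v : ℂ, |v.re - -τ n| ≤ ω / 2 → |v.re| ≤ ω := fun v hv => by
    rw [sub_neg_eq_add, abs_le] at hv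
    rw [abs_le]
    constructor <;> linarith [hv.1, hv.2, hτ1.1, hτ1.2]
  have hC : 0 ≤ 3 * (C₁ + C₂) := by positivity
  have key : ‖Ψ w‖ ≤ 3 * (C₁ + C₂) := by
    refine norm_le_of_rectangle (a := -τ n) (b := 0) (d := ω / 2) (r := ω / 2) (by linarith)
      (by linarith) (fun v hv1 hv2 => ?_) (fun v hv1 hv2 => ?_) (fun v hv1 hv2 => ?_) ?_ ?_
    · rw [sub_zero] at hv2
      have := hd n hn0 v (hre v hv1) (by linarith)
      fun_prop
    · rw [sub_zero] at hv2
      have h1 := hside n hn0 v ?_ (hre v hv1.le) (by linarith)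
      · rw [hnorm]
        have h2 : ‖(v + τ n) ^ 2 + ((ω : ℂ) / 2) ^ 2‖ ≤ 3 := by
          have h3 : ‖v + τ n‖ ≤ 1 := by
            refine (Complex.norm_le_abs_re_add_abs_im _).trans ?_
            rw [Complex.add_re, Complex.add_im, Complex.ofReal_re, Complex.ofReal_im, add_zero]
            rw [sub_neg_eq_add] at hv1
            linarith
          refine (norm_add_le _ _).trans ?_
          rw [norm_pow, norm_pow, norm_div, Complex.norm_real, Real.norm_of_nonneg hω.le,
            Complex.norm_ofNat]
          nlinarith [norm_nonneg (v + τ n)]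
        calc _ ≤ 3 * C₁ := by
              gcongr
              rw [div_le_iff₀ (by positivity)]
              exact h1
          _ ≤ _ := by linarith
      · rw [sub_neg_eq_add] at hv1
        have := abs_add_le v.re (τ n)
        linarith
    · rw [sub_zero] at hv2
      have h1 := htop n hn0 v (hre v hv1) hv2
      rw [hnorm]
      have h2 : ‖(v + τ n) ^ 2 + ((ω : ℂ) / 2) ^ 2‖ ≤ 3 * |v.re + τ n| := by
        have h3 : (v + τ n) ^ 2 + ((ω : ℂ) / 2) ^ 2 =
            ((v.re + τ n : ℝ) : ℂ) * ((v.re + τ n : ℝ) + 2 * (v.im : ℂ) * Complex.I) := by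
          have h4 : ((ω : ℂ) / 2) ^ 2 = (v.im : ℂ) ^ 2 := by
            have h5 : (ω / 2) ^ 2 = v.im ^ 2 := by rw [← hv2, sq_abs]
            exact_mod_cast congrArg (fun x : ℝ => (x : ℂ)) h5
          have h6 : v + (τ n : ℂ) = ((v.re + τ n : ℝ) : ℂ) + v.im * Complex.I := by
            push_cast
            linear_combination -Complex.re_add_im v
          rw [h4, h6]
          linear_combination (v.im : ℂ) ^ 2 * Complex.I_sq
        rw [h3, norm_mul, Complex.norm_real, Real.norm_eq_abs, mul_comm]
        gcongr
        refine (norm_add_le _ _).trans ?_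
        rw [norm_mul, norm_mul, Complex.norm_I, Complex.norm_real, Complex.norm_real,
          Real.norm_eq_abs, Real.norm_eq_abs, hv2, Complex.norm_ofNat]
        rw [sub_neg_eq_add] at hv1
        linarith
      calc _ ≤ 3 * |v.re + τ n| * (‖Φ n v‖ / (B n * Real.exp (n * v.re))) := by gcongr
        _ = 3 * ((|v.re + τ n| * ‖Φ n v‖) / (B n * Real.exp (n * v.re))) := by ring
        _ ≤ 3 * C₂ := by
          gcongr
          rw [div_le_iff₀ (by positivity)]
          exact h1
        _ ≤ _ := by linarith
    · rw [sub_neg_eq_add, abs_le]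
      have := abs_le.1 ((Complex.abs_re_le_norm w).trans hw)
      constructor <;> linarith [this.1, this.2]
    · rw [sub_zero]
      exact ((Complex.abs_im_le_norm w).trans hw).trans (by linarith)
  have hlow : ω ^ 2 / 8 ≤ ‖(w + τ n) ^ 2 + ((ω : ℂ) / 2) ^ 2‖ := by
    have h1 : ‖w + τ n‖ ≤ 5 * ω / 16 := by
      refine (norm_add_le _ _).trans ?_
      rw [Complex.norm_real, Real.norm_eq_abs]
      linarith
    have h2 := norm_sub_norm_le (((ω : ℂ) / 2) ^ 2) (-(w + τ n) ^ 2)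
    rw [sub_neg_eq_add, norm_neg, norm_pow, norm_pow, norm_div, Complex.norm_real,
      Real.norm_of_nonneg hω.le, Complex.norm_ofNat, add_comm (((ω : ℂ) / 2) ^ 2)] at h2
    have h3 : ‖w + τ n‖ ^ 2 ≤ (5 * ω / 16) ^ 2 := by gcongr
    nlinarith
  rw [hnorm] at key
  have h4 : ω ^ 2 / 8 * (‖Φ n w‖ / (B n * Real.exp (n * w.re))) ≤ 3 * (C₁ + C₂) :=
    (mul_le_mul_of_nonneg_right hlow (by positivity)).trans key
  rw [← div_le_iff₀ (by positivity), le_div_iff₀' (by positivity)]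
  exact h4

/-- Logarithmic coordinates `z = ζ exp w` near a point `ζ ≠ 0`. -/
lemma exists_square_of_eventually {ζ : ℂ} {p : ℂ → Prop} (hp : ∀ᶠ z in 𝓝 ζ, p z) :
    ∃ ω, 0 < ω ∧ ω ≤ 1 / 2 ∧ ∀ w : ℂ, |w.re| ≤ ω → |w.im| ≤ ω → p (ζ * Complex.exp w) := by
  have h1 : Tendsto (fun w : ℂ => ζ * Complex.exp w) (𝓝 0) (𝓝 ζ) := by
    have : Continuous fun w : ℂ => ζ * Complex.exp w := by fun_prop
    simpa using this.tendsto 0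
  obtain ⟨δ, hδ, h2⟩ := Metric.eventually_nhds_iff.1 (h1.eventually hp)
  refine ⟨min (δ / 4) (1 / 2), by positivity, min_le_right _ _, fun w hw1 hw2 => h2 ?_⟩
  rw [dist_zero_right]
  have h3 := Complex.norm_le_abs_re_add_abs_im w
  have := min_le_left (δ / 4) (1 / 2 : ℝ)
  linarith

lemma exp_ne_one_of_small {w : ℂ} (hw : w ≠ 0) (h : |w.im| ≤ 1) : Complex.exp w ≠ 1 := by
  intro h1
  obtain ⟨n, hn⟩ := Complex.exp_eq_one_iff.1 h1
  have h2 : w.im = n * (2 * Real.pi) := by rw [hn]; simp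
  have h3 : n = 0 := by
    by_contra h4
    have h5 : (1 : ℝ) ≤ |(n : ℝ)| := by
      have := Int.one_le_abs h4
      exact_mod_cast this
    rw [h2, abs_mul, abs_of_pos (by positivity : 0 < 2 * Real.pi)] at h
    nlinarith [Real.pi_gt_three]
  rw [h3] at hn
  simp at hn
  exact hw hn

namespace IsRow

variable {f : PowerSeries ℂ} {m m' : ℕ} {s : ℕ → Multiset ℂ} {p : ℕ → ℂ[X]} {lam : ℕ → ℕ}
  {A : ℕ → ℂ} {t : ℕ → Multiset ℂ} {R : ℝ}

/-- The sharp bound for the remainders near a regular point on the critical circle, with the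
holomorphic continuation `g` of `f` in the place of `f`. -/
theorem exists_boundary_bound (h : IsRow f m m' s p lam A t) {B : ℕ → ℝ} (hR : 0 < R)
    (hB : Dominates m R A B)
    (hconc : ∀ n, m ≤ n →
      Real.log (B n / (n.factorial : ℝ)) + Real.log (B (n + 2) / ((n + 2).factorial : ℝ)) ≤
        2 * Real.log (B (n + 1) / ((n + 1).factorial : ℝ))) {L : ℂ[X]}
    (hL : ∀ i, Tendsto (fun n => (normPoly (s n)).coeff i) atTop (𝓝 (L.coeff i))) (hL0 : L ≠ 0)
    (hq : ∀ r, 0 < r → r < R → ∃ C, PowerBound (L * f) r C) {ζ : ℂ} (hζ : ‖ζ‖ = R) {g : ℂ → ℂ}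
    (hg : AnalyticAt ℂ g ζ)
    (hgF : ∀ᶠ z in 𝓝 ζ, ‖z‖ < R → L.eval z * g z = psum ((L : PowerSeries ℂ) * f) z) :
    ∃ C N, ∃ b > 0, ∀ n, N ≤ n → ∀ z, dist z ζ < b →
      ‖(normPoly (s n)).eval z * g z - (p n).eval z‖ ≤ C * (B n * (‖z‖ / R) ^ n) := by
  have hζ0 : ζ ≠ 0 := norm_pos_iff.1 (hζ ▸ hR)
  obtain ⟨ω, hω, hω1, hsq⟩ := exists_square_of_eventually (hg.eventually_analyticAt.and
    (hgF.and (eventually_nhdsWithin_iff.1 (eventually_eval_ne_zero hL0 ζ))))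
  set e : ℂ → ℂ := fun w => ζ * Complex.exp w with he
  have hed : Differentiable ℂ e := by fun_prop
  have hnorm : ∀ w, ‖e w‖ = R * Real.exp w.re := fun w => by
    rw [he, norm_mul, hζ, Complex.norm_exp]
  have hpow : ∀ (n : ℕ) w, (‖e w‖ / R) ^ n = Real.exp (n * w.re) := fun n w => by
    rw [hnorm, mul_div_cancel_left₀ _ hR.ne', Real.exp_nat_mul]
  have hne : ∀ w : ℂ, w ≠ 0 → |w.im| ≤ ω → e w ≠ ζ := fun w hw hi he' =>
    exp_ne_one_of_small hw (hi.trans (by linarith))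
      (mul_left_cancel₀ hζ0 (he'.trans (mul_one ζ).symm))
  -- the square without a neighbourhood of its centre
  set S : Set ℂ := {w | |w.re| ≤ ω ∧ |w.im| ≤ ω ∧ (ω / 4 ≤ |w.re| ∨ ω / 4 ≤ |w.im|)} with hS
  have hScpt : IsCompact S := by
    refine Metric.isCompact_of_isClosed_isBounded ?_ ?_
    · have h1 : Continuous fun w : ℂ => |w.re| := by fun_prop
      have h2 : Continuous fun w : ℂ => |w.im| := by fun_prop
      exact (isClosed_le h1 continuous_const).inter ((isClosed_le h2 continuous_const).inter
        ((isClosed_le continuous_const h1).union (isClosed_le continuous_const h2)))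
    · refine isBounded_iff_forall_norm_le.2 ⟨2 * ω, fun w hw => ?_⟩
      linarith [Complex.norm_le_abs_re_add_abs_im w, hw.1, hw.2.1]
  have hS0 : ∀ w ∈ S, w ≠ 0 := by
    rintro w ⟨-, -, h3⟩ rfl
    simp only [Complex.zero_re, Complex.zero_im, abs_zero, or_self] at h3
    linarith
  have hre1 : ∀ w ∈ S, |w.re| ≤ 1 := fun w hw => hw.1.trans (by linarith)
  obtain ⟨c, hc, N₀, hm0, hlow⟩ := exists_uniform_lower_bound h.card_le hL
    (hScpt.image hed.continuous) (by
      rintro _ ⟨w, hw, rfl⟩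
      exact (hsq w hw.1 hw.2.1).2.2 (hne w (hS0 w hw) hw.2.1))
  have hlow : ∀ n, N₀ ≤ n → ∀ w ∈ S, c ≤ ‖(normPoly (s n)).eval (e w)‖ := fun n hn w hw =>
    hlow n hn _ ⟨w, hw, rfl⟩
  have hqne : ∀ n, N₀ ≤ n → ∀ w ∈ S, (normPoly (s n)).eval (e w) ≠ 0 := fun n hn w hw =>
    norm_pos_iff.1 (hc.trans_le (hlow n hn w hw))
  set u : ℕ → ℂ → ℂ := fun n w => g (e w) - rat s p n (e w) with hu
  have hgd : ∀ w : ℂ, |w.re| ≤ ω → |w.im| ≤ ω → DifferentiableAt ℂ (fun w => g (e w)) w :=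
    fun w hw1 hw2 => (hsq w hw1 hw2).1.differentiableAt.comp w hed.differentiableAt
  have hpd : ∀ (r : ℂ[X]) w, DifferentiableAt ℂ (fun w => r.eval (e w)) w := fun r w =>
    r.differentiable.differentiableAt.comp w hed.differentiableAt
  have hud : ∀ n, N₀ ≤ n → ∀ w ∈ S, DifferentiableAt ℂ (u n) w := fun n hn w hw =>
    (hgd w hw.1 hw.2.1).sub ((hpd _ w).div (hpd _ w) (hqne n hn w hw))
  obtain ⟨K₁, hK₁0, hK₁⟩ := h.exists_norm_rat_sub_le (μ := R * Real.exp (-1)) (by positivity)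
    (R * Real.exp 1)
  have hinc : ∀ n, N₀ ≤ n → ∀ w ∈ S,
      ‖u (n + 1) w - u n w‖ ≤ K₁ / (c * c) * (B n * Real.exp (n * w.re)) := by
    intro n hn w hw
    have hw1 := abs_le.1 (hre1 w hw)
    have h1 := hK₁ n (hm0.trans hn) (e w) (by rw [hnorm]; gcongr; exact hw1.1)
      (by rw [hnorm]; gcongr; exact hw1.2) c c hc hc (hlow n hn w hw) (hlow (n + 1) (by omega) w hw)
    have h2 : u (n + 1) w - u n w = -(rat s p (n + 1) (e w) - rat s p n (e w)) := by
      rw [hu]; ring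
    rw [h2, norm_neg]
    refine h1.trans ?_
    have h3 : ‖A n‖ * ‖e w‖ ^ n ≤ B n * Real.exp (n * w.re) := by
      rw [← hpow]
      calc ‖A n‖ * ‖e w‖ ^ n = (‖A n‖ * R ^ n) * (‖e w‖ / R) ^ n := by
            rw [div_pow]; field_simp
        _ ≤ _ := by gcongr; exact hB.le n (hm0.trans hn)
    calc K₁ * (‖A n‖ * ‖e w‖ ^ n) / (c * c) ≤ K₁ * (B n * Real.exp (n * w.re)) / (c * c) := by
          gcongr
      _ = _ := by ring
  have hbdd : ∀ n, N₀ ≤ n → ∃ D, 0 ≤ D ∧ ∀ w ∈ S, ‖u n w‖ ≤ D := by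
    intro n hn
    obtain ⟨D, hD⟩ := hScpt.exists_bound_of_continuousOn (f := u n) fun w hw =>
      (hud n hn w hw).continuousAt.continuousWithinAt
    exact ⟨|D|, abs_nonneg D, fun w hw => (hD w hw).trans (le_abs_self D)⟩
  obtain ⟨G, hG, hGb⟩ := h.exists_remainder (fun r hr hrR => hB.exists_bound hr hrR) hq
  have hlim : ∀ w ∈ S, w.re < 0 → Tendsto (fun n => u n w) atTop (𝓝 0) := by
    intro w hw hneg
    have hlt : ‖e w‖ < R := by
      rw [hnorm]
      exact mul_lt_of_lt_one_right hR (Real.exp_lt_one_iff.2 hneg)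
    have he0 : e w ≠ 0 := mul_ne_zero hζ0 (Complex.exp_ne_zero w)
    have hLne := (hsq w hw.1 hw.2.1).2.2 (hne w (hS0 w hw) hw.2.1)
    obtain ⟨θ, hθ1, hθ2⟩ := exists_between ((div_lt_one hR).2 hlt)
    have hθ0 : 0 < θ := lt_of_le_of_lt (by positivity) hθ1
    have h1 := h.tendsto_rat hG hGb he0 hlt hLne hc hθ0
      (by rwa [div_lt_iff₀ hθ0, mul_comm, ← div_lt_iff₀ hR])
      (eventually_atTop.2 ⟨N₀, fun n hn => (mul_le_of_le_one_right hc.le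
        (pow_le_one₀ hθ0.le hθ2.le)).trans (hlow n hn w hw)⟩)
    rw [← (hsq w hw.1 hw.2.1).2.1 hlt, mul_div_cancel_left₀ _ hLne] at h1
    have h2 := h1.const_sub (g (e w))
    rwa [show g (ζ * Complex.exp w) = g (e w) from rfl, sub_self] at h2
  have hK0 : 0 ≤ K₁ / (c * c) := by positivity
  set τ : ℕ → ℝ := fun n => Real.log (B (n + 1)) - Real.log (B n) with hτ
  have hτ0 : Tendsto τ atTop (𝓝 0) := by
    have h1 := (Real.continuousAt_log one_ne_zero).tendsto.comp hB.ratio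
    rw [Real.log_one] at h1
    have h2 := h1.neg
    rw [neg_zero] at h2
    refine h2.congr' ?_
    filter_upwards [eventually_ge_atTop m] with n hn
    rw [Function.comp_apply, Real.log_div (hB.pos n hn).ne' (hB.pos (n + 1) (by omega)).ne', hτ]
    ring
  set N₁ := max N₀ (2 * m + 1) with hN₁
  have hN₀₁ : N₀ ≤ N₁ := le_max_left _ _
  have hm1 : m ≤ N₁ := hm0.trans hN₀₁
  have hgr : GaussianGrowth B τ N₁ := fun n hn i hi =>
    gaussian_growth hB.pos hconc ((le_max_right _ _).trans hn) hi
  have hline : ∀ y : ℝ, |y| = ω / 2 → ∃ C N, 0 ≤ C ∧ ∀ n, N ≤ n → ∀ w : ℂ, |w.re| ≤ ω →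
      w.im = y → |w.re + τ n| * ‖u n w‖ ≤ C * (B n * Real.exp (n * w.re)) := by
    intro y hy
    have hmem : ∀ w : ℂ, |w.re| ≤ ω → |w.im - y| ≤ 2 * (ω / 8) → w ∈ S := fun w hw1 hw2 => by
      have h1 := abs_sub_abs_le_abs_sub w.im y
      have h2 := abs_sub_abs_le_abs_sub y w.im
      rw [abs_sub_comm] at h2
      exact ⟨hw1, by linarith, Or.inr (by linarith)⟩
    refine exists_bound_near_critical_line (fun n hn => hB.pos n (hm1.trans hn)) hgr hτ0 hω hω1
      (by linarith : 0 < ω / 8) hK0 (fun n hn w hw1 hw2 => hud n (hN₀₁.trans hn) w (hmem w hw1 hw2))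
      (fun n hn w hw1 hw2 => hinc n (hN₀₁.trans hn) w (hmem w hw1 hw2)) fun ε hε => ?_
    obtain ⟨N, hN⟩ := hB.exists_crude_bound hK0 hre1 hinc hbdd hlim hε
    exact ⟨N, fun n hn w hw1 hw2 => hN n hn w (hmem w hw1 hw2)⟩
  obtain ⟨C₁, N₂, hC₁, hN₂⟩ := hline (ω / 2) (abs_of_pos (by linarith))
  obtain ⟨C₂, N₃, hC₂, hN₃⟩ := hline (-(ω / 2)) (by rw [abs_neg, abs_of_pos (by linarith)])
  obtain ⟨C₃, N₄, hN₄⟩ := hB.exists_bound_off_critical_line hK0 hinc hbdd hlim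
    (by linarith : 0 < ω / 4)
  set M : ℝ := (1 + R * Real.exp 1) ^ m with hM
  have hM0 : 0 ≤ M := by positivity
  have hΦ : ∀ n, N₀ ≤ n → ∀ w ∈ S,
      ‖(normPoly (s n)).eval (e w) * g (e w) - (p n).eval (e w)‖ ≤ M * ‖u n w‖ := by
    intro n hn w hw
    have h1 : (normPoly (s n)).eval (e w) * g (e w) - (p n).eval (e w) =
        (normPoly (s n)).eval (e w) * u n w := by
      have := hqne n hn w hw
      simp only [hu, rat]
      field_simp
    rw [h1, norm_mul]
    gcongr
    refine (norm_eval_normPoly_le _ _ (h.card_le n (hm0.trans hn))).trans ?_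
    rw [hnorm, hM]
    gcongr
    exact (abs_le.1 (hre1 w hw)).2
  have hside : ∀ n, N₁ + N₂ + N₃ + N₄ ≤ n → ∀ w : ℂ, ω / 4 ≤ |w.re| → |w.re| ≤ ω → |w.im| ≤ ω →
      ‖(normPoly (s n)).eval (e w) * g (e w) - (p n).eval (e w)‖ ≤
        M * |C₃| * (B n * Real.exp (n * w.re)) := by
    intro n hn w hw0 hw1 hw2
    have hw : w ∈ S := ⟨hw1, hw2, Or.inl hw0⟩
    have hBn := hB.pos n (by omega)
    calc _ ≤ M * ‖u n w‖ := hΦ n (by omega) w hw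
      _ ≤ M * (|C₃| * (B n * Real.exp (n * w.re))) := by
        gcongr
        refine (hN₄ n (by omega) w hw hw0).trans ?_
        gcongr
        exact le_abs_self C₃
      _ = _ := by ring
  have htop : ∀ n, N₁ + N₂ + N₃ + N₄ ≤ n → ∀ w : ℂ, |w.re| ≤ ω → |w.im| = ω / 2 →
      |w.re + τ n| * ‖(normPoly (s n)).eval (e w) * g (e w) - (p n).eval (e w)‖ ≤
        M * (C₁ + C₂) * (B n * Real.exp (n * w.re)) := by
    intro n hn w hw1 hw2
    have hw : w ∈ S := ⟨hw1, by linarith, Or.inr (by linarith)⟩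
    have hBn := hB.pos n (by omega)
    have h1 : |w.re + τ n| * ‖u n w‖ ≤ (C₁ + C₂) * (B n * Real.exp (n * w.re)) := by
      rcases eq_or_eq_neg_of_abs_eq hw2 with h2 | h2
      · refine (hN₂ n (by omega) w hw1 h2).trans ?_
        gcongr; linarith
      · refine (hN₃ n (by omega) w hw1 h2).trans ?_
        gcongr; linarith
    calc _ ≤ |w.re + τ n| * (M * ‖u n w‖) := by gcongr; exact hΦ n (by omega) w hw
      _ = M * (|w.re + τ n| * ‖u n w‖) := by ring
      _ ≤ M * ((C₁ + C₂) * (B n * Real.exp (n * w.re))) := by gcongr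
      _ = _ := by ring
  obtain ⟨C, N, hN⟩ := exists_bound_across_critical_line hτ0 (N₀ := N₁ + N₂ + N₃ + N₄)
    (fun n hn => hB.pos n (by omega))
    (Φ := fun n w => (normPoly (s n)).eval (e w) * g (e w) - (p n).eval (e w)) hω hω1
    (by positivity) (by positivity)
    (fun n _ w hw1 hw2 => ((hpd _ w).mul (hgd w hw1 hw2)).sub (hpd _ w)) hside htop
  have h1 : Tendsto (fun z => Complex.log (z / ζ)) (𝓝 ζ) (𝓝 0) := by
    have h2 : ContinuousAt (fun z => Complex.log (z / ζ)) ζ :=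
      ContinuousAt.clog (by fun_prop) (by rw [div_self hζ0]; exact Complex.one_mem_slitPlane)
    have := h2.tendsto
    rwa [div_self hζ0, Complex.log_one] at this
  obtain ⟨b, hb, hb'⟩ := Metric.eventually_nhds_iff.1 ((h1.eventually
    (Metric.closedBall_mem_nhds 0 (by linarith : 0 < ω / 4))).and (eventually_ne_nhds hζ0))
  refine ⟨C, N, b, hb, fun n hn z hz => ?_⟩
  obtain ⟨h3, h4⟩ := hb' hz
  rw [dist_zero_right] at h3
  have h5 : e (Complex.log (z / ζ)) = z := by
    rw [he]
    simp only
    rw [Complex.exp_log (div_ne_zero h4 hζ0), mul_div_cancel₀ _ hζ0]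
  have h6 := hN n hn _ h3
  rwa [← hpow, h5] at h6

/-- On the critical circle: take for `H` the holomorphic continuation `g` of `f` to `ζ`, a regular
point. -/
theorem star_zero_of_boundary (h : IsRow f m m' s p lam A t) {B : ℕ → ℝ} (hR : 0 < R)
    (hB : Dominates m R A B)
    (hconc : ∀ n, m ≤ n →
      Real.log (B n / (n.factorial : ℝ)) + Real.log (B (n + 2) / ((n + 2).factorial : ℝ)) ≤
        2 * Real.log (B (n + 1) / ((n + 1).factorial : ℝ))) {Λ : Set ℕ} {c : ℝ} (hc : 0 < c)
    (hΛ : ∀ n ∈ Λ, m ≤ n ∧ c * B n ≤ ‖A n‖ * R ^ n) {L : ℂ[X]}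
    (hL : ∀ i, Tendsto (fun n => (normPoly (s n)).coeff i) atTop (𝓝 (L.coeff i))) (hL0 : L ≠ 0)
    (hq : ∀ r, 0 < r → r < R → ∃ C, PowerBound (L * f) r C) {ζ : ℂ} (hζ : ‖ζ‖ = R)
    (hcount : ∀ ε > 0, ∀ᶠ n in atTop, 1 ≤ (s n).countP fun z => dist z ζ < ε) {g : ℂ → ℂ}
    (hg : AnalyticAt ℂ g ζ)
    (hgF : ∀ᶠ z in 𝓝 ζ, ‖z‖ < R → L.eval z * g z = psum ((L : PowerSeries ℂ) * f) z) :
    ∀ ε > 0, ∀ᶠ n in atTop ⊓ 𝓟 Λ, ∃ ξ ∈ t n, dist ζ ξ < ε := by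
  obtain ⟨C, N, b₁, hb₁, hbd⟩ := h.exists_boundary_bound hR hB hconc hL hL0 hq hζ hg hgF
  obtain ⟨b₂, hb₂, hga⟩ := Metric.eventually_nhds_iff.1 hg.eventually_analyticAt
  set b := min (min b₁ b₂) (min (R / 2) 1) with hb
  have hb0 : 0 < b := by positivity
  have hbR : b ≤ R / 2 := (min_le_right _ _).trans (min_le_left _ _)
  have hb1 : b ≤ 1 := (min_le_right _ _).trans (min_le_right _ _)
  refine h.eventually_exists_star_zero hR hB hc hΛ (κ := 0) (H := g) (C := C) hcount
    (a := b / 2) (b := b) (μ := R / 2) (by linarith) (by linarith) (by linarith) (by linarith)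
    (fun z _ hz => ?_) (Eventually.of_forall fun n => ?_)
    (eventually_atTop.2 ⟨N, fun n hn => ⟨b / 2, le_rfl, by linarith, fun z hz => ?_⟩⟩)
  · have h1 := norm_sub_norm_le ζ z
    rw [dist_comm, dist_eq_norm] at hz
    linarith
  · refine exists_quotient s p lam (by linarith) (fun z hz => ?_) n
    exact (hga ((Metric.mem_ball.1 hz).trans_le
      ((min_le_left _ _).trans (min_le_right _ _)))).differentiableAt.differentiableWithinAt
  · rw [pow_zero, one_mul]
    refine hbd n hn z (hz.trans_lt ?_)
    have : b ≤ b₁ := (min_le_left _ _).trans (min_le_left _ _)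
    linarith

end IsRow

/-! ### Existence of regularizing sequences -/

/-- Small weights `δ j`, decreasing slowly, whose partial sums compensate for the possible decay of
a sequence `α` along a subsequence. -/
lemma exists_slowly_decreasing {α : ℕ → ℝ} (hα : ∀ k : ℕ, ∃ n : ℕ, (k : ℝ) ≤ α n + n / (k + 1)) :
    ∃ δ : ℕ → ℝ, Tendsto δ atTop (𝓝 0) ∧
      (∀ n, δ n - δ (n + 1) ≤ Real.log (n + 2) - Real.log (n + 1)) ∧
      ∀ k : ℕ, ∃ n, (k : ℝ) ≤ α n + ∑ j ∈ Finset.range n, δ j := by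
  choose N hN using hα
  set w : ℕ → ℕ → ℝ := fun k n =>
    max 0 (1 / ((k : ℝ) + 1) - max 0 (Real.log (n + 1) - Real.log (N k + 1))) with hw
  have hw0 : ∀ k n, 0 ≤ w k n := fun k n => le_max_left _ _
  have hwη : ∀ k n, w k n ≤ 1 / ((k : ℝ) + 1) := fun k n =>
    max_le (by positivity) (by linarith [le_max_left 0 (Real.log (n + 1) - Real.log (N k + 1))])
  have hη1 : ∀ k : ℕ, 1 / ((k : ℝ) + 1) ≤ 1 := fun k => by
    rw [div_le_one (by positivity)]; linarith [(Nat.cast_nonneg k : (0 : ℝ) ≤ k)]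
  have hbdd : ∀ n, BddAbove (Set.range fun k => w k n) := fun n =>
    ⟨1, by rintro _ ⟨k, rfl⟩; exact (hwη k n).trans (hη1 k)⟩
  have hle : ∀ k n, w k n ≤ ⨆ k, w k n := fun k n => le_ciSup (hbdd n) k
  refine ⟨fun n => ⨆ k, w k n, ?_, fun n => ?_, fun k => ⟨N k, ?_⟩⟩
  · rw [Metric.tendsto_atTop]
    intro ε hε
    obtain ⟨K, hK⟩ := exists_nat_one_div_lt (half_pos hε)
    have hlog : Tendsto (fun n : ℕ => Real.log ((n : ℝ) + 1)) atTop atTop :=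
      Real.tendsto_log_atTop.comp (tendsto_atTop_add_const_right _ _ tendsto_natCast_atTop_atTop)
    have hev : ∀ᶠ n : ℕ in atTop, ∀ k ∈ Finset.range K,
        1 + Real.log (N k + 1) ≤ Real.log ((n : ℝ) + 1) :=
      (Finset.eventually_all _).2 fun k _ => hlog.eventually_ge_atTop _
    obtain ⟨M, hM⟩ := eventually_atTop.1 hev
    refine ⟨M, fun n hn => ?_⟩
    have h1 : (⨆ k, w k n) ≤ ε / 2 := by
      refine ciSup_le fun k => ?_
      rcases lt_or_ge k K with hk | hk
      · have h2 := hM n hn k (Finset.mem_range.2 hk)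
        refine max_le (by linarith) ?_
        linarith [le_max_right 0 (Real.log (n + 1) - Real.log (N k + 1)), hη1 k]
      · refine (hwη k n).trans (le_trans ?_ hK.le)
        gcongr
    rw [Real.dist_eq, sub_zero, abs_of_nonneg ((hw0 0 n).trans (hle 0 n))]
    linarith
  · simp only
    rw [sub_le_iff_le_add]
    refine ciSup_le fun k => ?_
    have h1 := hle k (n + 1)
    have h2 : Real.log ((n : ℝ) + 1) ≤ Real.log (n + 2) :=
      Real.log_le_log (by positivity) (by linarith)
    have h3 : w k n ≤ Real.log (n + 2) - Real.log (n + 1) + w k (n + 1) := by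
      simp only [hw]
      push_cast
      rw [show (n : ℝ) + 1 + 1 = n + 2 by ring]
      refine max_le (by linarith [le_max_left 0 (1 / ((k : ℝ) + 1) -
        max 0 (Real.log (n + 2) - Real.log (N k + 1)))]) ?_
      have h4 := le_max_right 0 (1 / ((k : ℝ) + 1) - max 0 (Real.log (n + 2) - Real.log (N k + 1)))
      have h5 : max 0 (Real.log (n + 2) - Real.log (N k + 1)) ≤
          max 0 (Real.log (n + 1) - Real.log (N k + 1)) + (Real.log (n + 2) - Real.log (n + 1)) :=
        max_le (by linarith [le_max_left 0 (Real.log (n + 1) - Real.log (N k + 1))])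
          (by linarith [le_max_right 0 (Real.log (n + 1) - Real.log (N k + 1))])
      linarith
    linarith
  · refine (hN k).trans ?_
    have h1 : ∀ j ∈ Finset.range (N k), 1 / ((k : ℝ) + 1) ≤ ⨆ k, w k j := by
      intro j hj
      refine le_trans ?_ (hle k j)
      have h2 : Real.log ((j : ℝ) + 1) ≤ Real.log (N k + 1) :=
        Real.log_le_log (by positivity) (by
          have : (j : ℝ) ≤ N k := by exact_mod_cast (Finset.mem_range.1 hj).le
          linarith)
      simp only [hw]
      rw [max_eq_left (by linarith : Real.log ((j : ℝ) + 1) - Real.log (N k + 1) ≤ 0), sub_zero]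
      exact le_max_right _ _
    have h2 := Finset.card_nsmul_le_sum _ _ _ h1
    rw [Finset.card_range, nsmul_eq_mul, mul_one_div] at h2
    linarith

/-- The least concave majorant of an unbounded sequence `v` with `v n ≤ o(n)` has increments tending
to zero and touches `v` infinitely often. -/
lemma exists_concave_majorant {v : ℕ → ℝ} (hv : ∀ ε > 0, ∀ᶠ n : ℕ in atTop, v n ≤ ε * n)
    (hub : ∀ k : ℕ, ∃ n, (k : ℝ) ≤ v n) :
    ∃ H : ℕ → ℝ, (∀ n, v n ≤ H n) ∧ (∀ n, H n + H (n + 2) ≤ 2 * H (n + 1)) ∧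
      Tendsto (fun n => H (n + 1) - H n) atTop (𝓝 0) ∧
      ∀ N, ∃ n, N ≤ n ∧ H n = v n ∧ v 0 ≤ v n := by
  have hmax : ∀ σ : Set.Ioi (0 : ℝ), ∃ n : ℕ, ∀ j, v j - σ * j ≤ v n - σ * n := by
    rintro ⟨σ, hσ⟩
    rw [Set.mem_Ioi] at hσ
    refine Filter.Tendsto.exists_forall_ge (f := fun j : ℕ => v j - σ * j) ?_
    rw [Nat.cofinite_eq_atTop]
    have h1 : Tendsto (fun n : ℕ => -(σ / 2) * (n : ℝ)) atTop atBot :=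
      tendsto_natCast_atTop_atTop.const_mul_atTop_of_neg (by linarith)
    refine tendsto_atBot_mono' atTop ?_ h1
    filter_upwards [hv (σ / 2) (half_pos hσ)] with n hn
    linarith
  choose ν hν using hmax
  -- the supporting affine functions with slope `σ > 0`, touching `v` at `ν σ`
  set L : ℕ → Set.Ioi (0 : ℝ) → ℝ := fun n σ => σ * n + (v (ν σ) - σ * ν σ) with hL
  have hvL : ∀ n σ, v n ≤ L n σ := fun n σ => by
    have := hν σ n
    simp only [hL]; linarith
  have hbdd : ∀ n, BddBelow (Set.range (L n)) := fun n =>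
    ⟨v n, by rintro _ ⟨σ, rfl⟩; exact hvL n σ⟩
  have : Nonempty (Set.Ioi (0 : ℝ)) := ⟨⟨1, Set.mem_Ioi.2 one_pos⟩⟩
  set H : ℕ → ℝ := fun n => ⨅ σ, L n σ with hH
  have hHL : ∀ n σ, H n ≤ L n σ := fun n σ => ciInf_le (hbdd n) σ
  have hvH : ∀ n, v n ≤ H n := fun n => le_ciInf (hvL n)
  have hconc : ∀ n, H n + H (n + 2) ≤ 2 * H (n + 1) := fun n => by
    rw [← div_le_iff₀' two_pos]
    refine le_ciInf fun σ => ?_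
    have h1 := hHL n σ
    have h2 := hHL (n + 2) σ
    simp only [hL] at h1 h2 ⊢
    push_cast at h1 h2 ⊢
    linarith
  have hmono : ∀ n, 0 ≤ H (n + 1) - H n := fun n => by
    rw [sub_nonneg]
    refine le_ciInf fun σ => (hHL n σ).trans ?_
    have : (0 : ℝ) < σ := σ.2
    simp only [hL]
    push_cast
    linarith
  have hanti : Antitone fun n => H (n + 1) - H n := antitone_nat_of_succ_le fun n => by
    have := hconc n
    linarith
  refine ⟨H, hvH, hconc, ?_, fun N => ?_⟩
  · rw [Metric.tendsto_atTop]
    intro ε hε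
    by_contra hcon
    have hge : ∀ n, ε ≤ H (n + 1) - H n := by
      intro n
      by_contra hlt
      refine hcon ⟨n, fun k hk => ?_⟩
      rw [Real.dist_eq, sub_zero, abs_of_nonneg (hmono k)]
      exact lt_of_le_of_lt (hanti hk) (not_le.1 hlt)
    have hlin : ∀ n : ℕ, H 0 + ε * n ≤ H n := by
      intro n
      induction n with
      | zero => simp
      | succ n ih => have := hge n; push_cast; linarith
    set σ : Set.Ioi (0 : ℝ) := ⟨ε / 2, half_pos hε⟩ with hσ
    obtain ⟨n, hn⟩ := exists_nat_gt ((v (ν σ) - σ * ν σ - H 0) / (ε / 2))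
    have h1 := hHL n σ
    have h2 := hlin n
    rw [div_lt_iff₀ (half_pos hε)] at hn
    simp only [hL] at h1
    have h3 : (σ : ℝ) = ε / 2 := rfl
    rw [h3] at h1 hn
    linarith
  · have htouch : ∀ σ, H (ν σ) = v (ν σ) := fun σ => by
      refine le_antisymm ((hHL _ σ).trans_eq ?_) (hvH _)
      simp only [hL]; ring
    have hv0 : ∀ σ, v 0 ≤ v (ν σ) := fun σ => by
      have h1 := hν σ 0
      have h2 : (0 : ℝ) < σ := σ.2
      have h3 : (0 : ℝ) ≤ σ * ν σ := by positivity
      simp only [Nat.cast_zero, mul_zero, sub_zero] at h1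
      linarith
    by_contra hcon
    have hlt : ∀ σ, ν σ < N := fun σ => by
      by_contra h1
      exact hcon ⟨ν σ, not_lt.1 h1, htouch σ, hv0 σ⟩
    set V := ∑ i ∈ Finset.range N, |v i| with hV
    have hVle : ∀ i, i < N → v i ≤ V := fun i hi => (le_abs_self _).trans
      (Finset.single_le_sum (f := fun i => |v i|) (fun _ _ => abs_nonneg _) (Finset.mem_range.2 hi))
    obtain ⟨k, hk⟩ := exists_nat_gt (V + 1)
    obtain ⟨n, hn⟩ := hub k
    set σ : Set.Ioi (0 : ℝ) := ⟨1 / ((n : ℝ) + 1), by rw [Set.mem_Ioi]; positivity⟩ with hσ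
    have h1 := hν σ n
    have h2 := hVle _ (hlt σ)
    have h3 : (0 : ℝ) < σ := σ.2
    have h4 : (0 : ℝ) ≤ σ * ν σ := by positivity
    have h5 : (σ : ℝ) * n ≤ 1 := by
      have : (σ : ℝ) = 1 / ((n : ℝ) + 1) := rfl
      rw [this, one_div_mul_eq_div, div_le_one (by positivity)]
      linarith
    linarith

/-- A sequence with `limsup (a n) ^ (1 / n) = 1` has a regularization. -/
theorem exists_isRegularization (m : ℕ) {a : ℕ → ℝ} (ha : ∀ n, 0 ≤ a n)
    (hU : ∀ ε > 0, ∀ᶠ n : ℕ in atTop, a n ≤ Real.exp (ε * n))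
    (hLow : ∀ ε > 0, ∃ᶠ n : ℕ in atTop, Real.exp (-(ε * n)) ≤ a n) :
    ∃ B Λ, IsRegularization m a B Λ := by
  -- the lower cutoff `exp (-n)` makes the logarithm meaningful where `a n` vanishes
  set α : ℕ → ℝ := fun n => Real.log (max (a n) (Real.exp (-n))) with hα
  have hexp : ∀ n, Real.exp (α n) = max (a n) (Real.exp (-n)) := fun n =>
    Real.exp_log (lt_max_of_lt_right (Real.exp_pos _))
  obtain ⟨δ, hδ, hδ1, hδ2⟩ := exists_slowly_decreasing (α := α) (by
    intro k
    have hk : (0 : ℝ) < 1 / (2 * (k + 1)) := by positivity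
    obtain ⟨n, hn, h1⟩ := frequently_atTop.1 (hLow _ hk) (2 * k * (k + 1))
    refine ⟨n, ?_⟩
    have h2 : -(1 / (2 * ((k : ℝ) + 1)) * n) ≤ α n := by
      rw [← Real.exp_le_exp, hexp]
      exact h1.trans (le_max_left _ _)
    have h3 : (2 * k * (k + 1) : ℝ) ≤ n := by exact_mod_cast hn
    have h4 : (k : ℝ) ≤ 1 / (2 * ((k : ℝ) + 1)) * n := by
      rw [one_div_mul_eq_div, le_div_iff₀ (by positivity)]; linarith
    have h5 : (n : ℝ) / (k + 1) = 2 * (1 / (2 * ((k : ℝ) + 1)) * n) := by field_simp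
    linarith)
  set γ : ℕ → ℝ := fun n => ∑ j ∈ Finset.range n, δ j with hγ
  have hγs : ∀ n, γ (n + 1) = γ n + δ n := fun n => Finset.sum_range_succ _ _
  have hγ0 : ∀ ε > 0, ∀ᶠ n : ℕ in atTop, γ n ≤ ε * n := by
    intro ε hε
    filter_upwards [hδ.cesaro.eventually (gt_mem_nhds hε), eventually_gt_atTop 0] with n hn hn0
    have : (0 : ℝ) < n := by exact_mod_cast hn0
    rw [inv_mul_lt_iff₀ this] at hn
    linarith
  obtain ⟨H, hvH, hHc, hHd, hHt⟩ := exists_concave_majorant (v := fun n => α n + γ n) (by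
    intro ε hε
    filter_upwards [hU (ε / 2) (half_pos hε), hγ0 (ε / 2) (half_pos hε)] with n h1 h2
    have h3 : α n ≤ ε / 2 * n := by
      rw [← Real.exp_le_exp, hexp]
      refine max_le h1 (Real.exp_le_exp.2 ?_)
      have : (0 : ℝ) ≤ n := Nat.cast_nonneg n
      nlinarith
    linarith) hδ2
  have hlogB : ∀ n : ℕ, Real.log (Real.exp (H n - γ n) / (n.factorial : ℝ)) =
      H n - γ n - Real.log (n.factorial : ℝ) := fun n => by
    rw [Real.log_div (Real.exp_pos _).ne' (by exact_mod_cast n.factorial_ne_zero), Real.log_exp]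
  have hfac : ∀ n : ℕ, Real.log ((n + 1).factorial : ℝ) =
      Real.log (n + 1) + Real.log (n.factorial : ℝ) := fun n => by
    rw [Nat.factorial_succ, Nat.cast_mul, Real.log_mul (by positivity)
      (by exact_mod_cast n.factorial_ne_zero)]
    push_cast; rfl
  refine ⟨fun n => Real.exp (H n - γ n), {n | m ≤ n ∧ Real.exp (H n - γ n) ≤ a n},
    fun n _ => Real.exp_pos _, ?_, fun n _ => ?_, fun n _ => ?_, ?_, 1, one_pos, fun n hn => ?_⟩
  · have h1 : Tendsto (fun n => Real.exp (δ n - (H (n + 1) - H n))) atTop (𝓝 (Real.exp (0 - 0))) :=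
      (Real.continuous_exp.tendsto _).comp (hδ.sub hHd)
    rw [sub_zero, Real.exp_zero] at h1
    refine h1.congr fun n => ?_
    rw [← Real.exp_sub, hγs]
    congr 1; ring
  · rw [hlogB, hlogB, hlogB, hfac (n + 1), hfac n, hγs (n + 1), hγs n]
    have h1 := hδ1 n
    have h2 := hHc n
    push_cast
    rw [show (n : ℝ) + 1 + 1 = n + 2 by ring]
    linarith
  · rw [abs_of_nonneg (ha n)]
    calc a n ≤ Real.exp (α n) := by rw [hexp]; exact le_max_left _ _
      _ ≤ _ := Real.exp_le_exp.2 (by have := hvH n; linarith)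
  · -- where `H` touches `α + γ`, the value `a n` is not below `exp (-n)`
    rw [Set.infinite_iff_exists_gt]
    intro N
    obtain ⟨M, hM⟩ := eventually_atTop.1 (hγ0 (1 / 2) (by norm_num))
    obtain ⟨M', hM'⟩ := exists_nat_gt (2 * -(α 0))
    obtain ⟨n, hn, h1, h2⟩ := hHt (N + M + M' + m + 1)
    refine ⟨n, ⟨by omega, ?_⟩, by omega⟩
    have h3 : H n - γ n = α n := by linarith
    rw [h3, hexp]
    refine max_le le_rfl ?_
    by_contra h4
    have h5 : α n = -n := by
      simp only [hα]
      rw [max_eq_right (not_le.1 h4).le, Real.log_exp]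
    have h6 := hM n (by omega)
    have h7 : (M' : ℝ) ≤ n := by exact_mod_cast (by omega : M' ≤ n)
    have h8 : γ 0 = 0 := Finset.sum_range_zero _
    simp only [h5, h8] at h2
    linarith
  · rw [abs_of_nonneg (ha n), one_mul]
    exact hn

/-- The normalization of a sequence by the radius given by the root test. -/
lemma root_test_bounds {A : ℕ → ℂ} {R : ℝ} (hR : 0 < R)
    (h : (limsup (fun n : ℕ => ENNReal.ofReal (‖A n‖ ^ (1 / (n : ℝ)))) atTop)⁻¹ =
      ENNReal.ofReal R) :
    (∀ ε > 0, ∀ᶠ n : ℕ in atTop, ‖A n‖ * R ^ n ≤ Real.exp (ε * n)) ∧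
    ∀ ε > 0, ∃ᶠ n : ℕ in atTop, Real.exp (-(ε * n)) ≤ ‖A n‖ * R ^ n := by
  have hlim : limsup (fun n : ℕ => ENNReal.ofReal (‖A n‖ ^ (1 / (n : ℝ)))) atTop =
      ENNReal.ofReal R⁻¹ := by
    rw [← inv_inv (limsup _ _), h, ENNReal.ofReal_inv_of_pos hR]
  have hroot : ∀ n : ℕ, 0 < n → (‖A n‖ ^ (1 / (n : ℝ))) ^ n = ‖A n‖ := fun n hn => by
    rw [one_div, Real.rpow_inv_natCast_pow (norm_nonneg _) (by omega)]
  constructor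
  · intro ε hε
    have h1 : limsup (fun n : ℕ => ENNReal.ofReal (‖A n‖ ^ (1 / (n : ℝ)))) atTop <
        ENNReal.ofReal (Real.exp ε * R⁻¹) := by
      rw [hlim]
      refine (ENNReal.ofReal_lt_ofReal_iff (by positivity)).2 ?_
      exact lt_mul_of_one_lt_left (by positivity) (Real.one_lt_exp_iff.2 hε)
    filter_upwards [eventually_lt_of_limsup_lt h1, eventually_gt_atTop 0] with n hn hn0
    have h2 := (ENNReal.ofReal_lt_ofReal_iff (by positivity)).1 hn
    calc ‖A n‖ * R ^ n = (‖A n‖ ^ (1 / (n : ℝ)) * R) ^ n := by rw [mul_pow, hroot n hn0]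
      _ ≤ (Real.exp ε * R⁻¹ * R) ^ n := by gcongr
      _ = _ := by rw [inv_mul_cancel_right₀ hR.ne', ← Real.exp_nat_mul, mul_comm]
  · intro ε hε
    have h1 : ENNReal.ofReal (Real.exp (-ε) * R⁻¹) <
        limsup (fun n : ℕ => ENNReal.ofReal (‖A n‖ ^ (1 / (n : ℝ)))) atTop := by
      rw [hlim]
      refine (ENNReal.ofReal_lt_ofReal_iff (by positivity)).2 ?_
      exact mul_lt_of_lt_one_left (by positivity) (Real.exp_lt_one_iff.2 (by linarith))
    refine ((frequently_lt_of_lt_limsup (by isBoundedDefault) h1).and_eventually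
      (eventually_gt_atTop 0)).mono fun n hn => ?_
    have h2 := (ENNReal.ofReal_lt_ofReal_iff_of_nonneg (by positivity)).1 hn.1
    calc Real.exp (-(ε * n)) = (Real.exp (-ε) * R⁻¹ * R) ^ n := by
          rw [inv_mul_cancel_right₀ hR.ne', ← Real.exp_nat_mul]; congr 1; ring
      _ ≤ (‖A n‖ ^ (1 / (n : ℝ)) * R) ^ n := by gcongr
      _ = _ := by rw [mul_pow, hroot n hn.2]

/-! ### The meromorphic continuation and its singular points -/

/-- A power series `f` such that `q f` converges in a disk, with `q 0 ≠ 0`, converges in some disk: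
estimate its coefficients by the recurrence that `q f` provides. -/
lemma exists_powerBound_of_mul {q : ℂ[X]} (hq0 : q.coeff 0 ≠ 0) {f : PowerSeries ℂ} {r C : ℝ}
    (hr : 0 < r) (h : PowerBound (q * f) r C) : ∃ ρ D, 0 < ρ ∧ ρ ≤ r ∧ PowerBound f ρ D := by
  set S : ℝ := ∑ i ∈ Finset.range (q.natDegree + 1), ‖q.coeff i‖ with hS
  have hS0 : 0 ≤ S := Finset.sum_nonneg fun i _ => norm_nonneg _
  have hSle : ∀ n, ∑ i ∈ Finset.range n, ‖q.coeff i‖ ≤ S := fun n => by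
    have h1 : S = ∑ i ∈ Finset.range (max n (q.natDegree + 1)), ‖q.coeff i‖ :=
      Finset.sum_subset (Finset.range_mono (le_max_right _ _)) fun i _ hi => by
        rw [coeff_eq_zero_of_natDegree_lt (by simpa [Nat.lt_succ_iff] using hi), norm_zero]
    rw [h1]
    exact Finset.sum_le_sum_of_subset_of_nonneg (Finset.range_mono (le_max_left _ _))
      fun _ _ _ => norm_nonneg _
  set c : ℝ := ‖q.coeff 0‖ with hc
  have hc0 : 0 < c := norm_pos_iff.2 hq0
  have hC0 : 0 ≤ C := le_trans (by positivity) (h 0)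
  set ρ : ℝ := min (min 1 r) (c / (2 * (S + 1))) with hρ
  have hρ0 : 0 < ρ := by positivity
  have hρ1 : ρ ≤ 1 := (min_le_left _ _).trans (min_le_left _ _)
  have hρr : ρ ≤ r := (min_le_left _ _).trans (min_le_right _ _)
  have hρS : ρ * S ≤ c / 2 := by
    have h1 : ρ ≤ c / (2 * (S + 1)) := min_le_right _ _
    rw [le_div_iff₀ (by positivity)] at h1
    nlinarith
  refine ⟨ρ, 2 * C / c, hρ0, hρr, fun n => ?_⟩
  induction n using Nat.strong_induction_on with
  | _ n ih =>
    have e : q.coeff 0 * PowerSeries.coeff n f = PowerSeries.coeff n ((q : PowerSeries ℂ) * f) -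
        ∑ k ∈ Finset.range n, q.coeff (k + 1) * PowerSeries.coeff (n - (k + 1)) f := by
      rw [PowerSeries.coeff_mul, Finset.Nat.sum_antidiagonal_eq_sum_range_succ
        (fun i j => PowerSeries.coeff i (q : PowerSeries ℂ) * PowerSeries.coeff j f),
        Finset.sum_range_succ']
      simp only [Polynomial.coeff_coe, Nat.sub_zero, add_sub_cancel_left]
    have h1 : ‖PowerSeries.coeff n ((q : PowerSeries ℂ) * f)‖ * ρ ^ n ≤ C :=
      le_trans (by gcongr) (h n)
    have h2 : ‖∑ k ∈ Finset.range n, q.coeff (k + 1) * PowerSeries.coeff (n - (k + 1)) f‖ * ρ ^ n ≤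
        c / 2 * (2 * C / c) := by
      calc _ ≤ (∑ k ∈ Finset.range n,
            ‖q.coeff (k + 1)‖ * ‖PowerSeries.coeff (n - (k + 1)) f‖) * ρ ^ n := by
            gcongr
            exact norm_sum_le_of_le _ fun k _ => (norm_mul _ _).le
        _ ≤ ∑ k ∈ Finset.range n, ‖q.coeff (k + 1)‖ * (ρ * (2 * C / c)) := by
            rw [Finset.sum_mul]
            refine Finset.sum_le_sum fun k hk => ?_
            have hk := Finset.mem_range.1 hk
            rw [mul_assoc]
            refine mul_le_mul_of_nonneg_left ?_ (norm_nonneg _)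
            have h3 := ih (n - (k + 1)) (by omega)
            calc _ = ρ ^ (k + 1) * (‖PowerSeries.coeff (n - (k + 1)) f‖ * ρ ^ (n - (k + 1))) := by
                  rw [mul_left_comm, ← pow_add, Nat.add_sub_cancel' (by omega)]
              _ ≤ ρ ^ (k + 1) * (2 * C / c) := by gcongr
              _ ≤ ρ ^ 1 * (2 * C / c) := by
                  refine mul_le_mul_of_nonneg_right ?_ (by positivity)
                  exact pow_le_pow_of_le_one hρ0.le hρ1 (by omega)
              _ = _ := by rw [pow_one]
        _ = (∑ k ∈ Finset.range n, ‖q.coeff (k + 1)‖) * ρ * (2 * C / c) := by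
            rw [← Finset.sum_mul, mul_assoc]
        _ ≤ S * ρ * (2 * C / c) := by
            gcongr
            have := hSle (n + 1)
            rw [Finset.sum_range_succ'] at this
            linarith [norm_nonneg (q.coeff 0)]
        _ ≤ _ := by gcongr; linarith
    have h3 : c * (‖PowerSeries.coeff n f‖ * ρ ^ n) ≤ C + c / 2 * (2 * C / c) := by
      rw [← mul_assoc, hc, ← norm_mul, e]
      calc _ ≤ (‖PowerSeries.coeff n ((q : PowerSeries ℂ) * f)‖ +
          ‖∑ k ∈ Finset.range n, q.coeff (k + 1) * PowerSeries.coeff (n - (k + 1)) f‖) * ρ ^ n := by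
            gcongr; exact norm_sub_le _ _
        _ ≤ _ := by rw [add_mul]; exact add_le_add h1 h2
    rw [le_div_iff₀ hc0]
    have h4 : c / 2 * (2 * C / c) = C := by field_simp
    linarith

section Continuation

variable {f : PowerSeries ℂ} {q : ℂ[X]} {R : ℝ}

lemma represents_quotient (hR : 0 < R) (hq0 : q.coeff 0 ≠ 0)
    (hq : ∀ r, 0 < r → r < R → ∃ C, PowerBound (q * f) r C) :
    Represents f fun z => psum ((q : PowerSeries ℂ) * f) z / q.eval z := by
  obtain ⟨C, hC⟩ := hq (R / 2) (by linarith) (by linarith)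
  obtain ⟨ρ, D, hρ, hρr, hD⟩ := exists_powerBound_of_mul hq0 (by linarith) hC
  have h0 : ∀ᶠ z in 𝓝 (0 : ℂ), q.eval z ≠ 0 := by
    refine q.continuous.continuousAt.eventually_ne ?_
    rwa [← coeff_zero_eq_eval_zero]
  filter_upwards [h0, Metric.ball_mem_nhds (0 : ℂ) hρ] with z hz hzρ
  rw [mem_ball_zero_iff] at hzρ
  have h1 := hD.hasSum hzρ
  have h2 : psum ((q : PowerSeries ℂ) * f) z = q.eval z * psum f z :=
    (hC.hasSum (hzρ.trans_le hρr)).unique (hasSum_coe_mul q h1)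
  rw [h2, mul_div_cancel_left₀ _ hz]
  exact h1

lemma analyticAt_psum {g : PowerSeries ℂ} (hg : ∀ r, 0 < r → r < R → ∃ C, PowerBound g r C) {z : ℂ}
    (hz : ‖z‖ < R) : AnalyticAt ℂ (psum g) z := by
  obtain ⟨r, hzr, hrR⟩ := exists_between hz
  obtain ⟨C, hC⟩ := hg r ((norm_nonneg z).trans_lt hzr) hrR
  exact hC.differentiableOn_psum.analyticAt (Metric.isOpen_ball.mem_nhds (by simpa using hzr))

lemma meromorphicAt_quotient (hq : ∀ r, 0 < r → r < R → ∃ C, PowerBound (q * f) r C) {z : ℂ}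
    (hz : ‖z‖ < R) :
    MeromorphicAt (fun z => psum ((q : PowerSeries ℂ) * f) z / q.eval z) z :=
  (analyticAt_psum hq hz).meromorphicAt.div
    (q.differentiable.analyticAt z).meromorphicAt

lemma meromorphicOn_quotient (hq : ∀ r, 0 < r → r < R → ∃ C, PowerBound (q * f) r C) :
    MeromorphicOn (fun z => psum ((q : PowerSeries ℂ) * f) z / q.eval z) (Metric.ball 0 R) :=
  fun _ hz => meromorphicAt_quotient hq (by simpa using hz)

end Continuation

/-- Uniqueness of the meromorphic continuation in a disk. -/
lemma Represents.eventuallyEq {f : PowerSeries ℂ} {g₁ g₂ : ℂ → ℂ} (h₁ : Represents f g₁)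
    (h₂ : Represents f g₂) {ρ : ℝ} (hm₁ : MeromorphicOn g₁ (Metric.ball 0 ρ))
    (hm₂ : MeromorphicOn g₂ (Metric.ball 0 ρ)) {z : ℂ} (hz : ‖z‖ < ρ) : g₁ =ᶠ[𝓝[≠] z] g₂ := by
  have hρ : 0 < ρ := (norm_nonneg z).trans_lt hz
  have h0 : meromorphicOrderAt (g₁ - g₂) 0 = ⊤ := by
    rw [meromorphicOrderAt_eq_top_iff]
    refine eventually_nhdsWithin_of_eventually_nhds ?_
    filter_upwards [h₁, h₂] with w hw₁ hw₂
    rw [Pi.sub_apply, hw₁.unique hw₂, sub_self]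
  have hz' : meromorphicOrderAt (g₁ - g₂) z = ⊤ := by
    by_contra hne
    exact MeromorphicOn.meromorphicOrderAt_ne_top_of_isPreconnected (hm₁.sub hm₂)
      (convex_ball (0 : ℂ) ρ).isPreconnected (x := z) (y := 0) (by simpa using hz)
      (by simpa using hρ)
      hne h0
  filter_upwards [meromorphicOrderAt_eq_top_iff.1 hz'] with w hw
  exact sub_eq_zero.1 hw

/-- A pole is not a regular point. -/
lemma IsPoleOfOrder.not_isRegularPoint {f : PowerSeries ℂ} {ζ : ℂ} {k : ℕ} (h : IsPoleOfOrder f ζ k)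
    {R : ℝ} (hζ : ‖ζ‖ < R) : ¬ IsRegularPoint f R ζ := by
  rintro ⟨ε, hε, g, hg, hga, hgf⟩
  obtain ⟨hk, ρ, hρ, g', hg', hgf', hord⟩ := h
  have h1 : g' =ᶠ[𝓝[≠] ζ] g := hgf'.eventuallyEq hgf
    (hg'.mono_set (Metric.ball_subset_ball (min_le_left ρ R)))
    (hg.mono_set ((Metric.ball_subset_ball (min_le_right ρ R)).trans Set.subset_union_left))
    (lt_min hρ hζ)
  have h2 := (hga ζ (Metric.mem_ball_self hε)).meromorphicOrderAt_nonneg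
  rw [← meromorphicOrderAt_congr h1, hord] at h2
  have h3 : (0 : ℤ) ≤ -(k : ℤ) := by exact_mod_cast h2
  omega

/-- A point `ζ ≠ 0` of the disk is regular if the meromorphic continuation has no pole there. -/
lemma isRegularPoint_of_order_nonneg {f : PowerSeries ℂ} {F : ℂ → ℂ} {R : ℝ} {ζ : ℂ}
    (hF : MeromorphicOn F (Metric.ball 0 R)) (hf : Represents f F) (hζ : ‖ζ‖ < R) (hζ0 : ζ ≠ 0)
    (hord : 0 ≤ meromorphicOrderAt F ζ) : IsRegularPoint f R ζ := by
  have hFζ := hF ζ (by simpa using hζ)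
  have ha := hFζ.meromorphicOrderAt_nonneg_iff_analyticAt_toMeromorphicNFAt.1 hord
  have heq : ∀ z, z ≠ ζ → F =ᶠ[𝓝 z] toMeromorphicNFAt F ζ := fun z hz => by
    filter_upwards [eventually_ne_nhds hz] with w hw
    exact hFζ.eqOn_compl_singleton_toMeromorphicNFAt hw
  obtain ⟨ε, hε, hεa⟩ := Metric.eventually_nhds_iff.1 ha.eventually_analyticAt
  refine ⟨ε, hε, toMeromorphicNFAt F ζ, ?_, fun z hz => hεa hz, ?_⟩
  · rintro z (hz | hz)
    · by_cases h : z = ζ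
      · rw [h]; exact ha.meromorphicAt
      · exact (hF z hz).congr ((heq z h).filter_mono nhdsWithin_le_nhds)
    · exact (hεa hz).meromorphicAt
  · filter_upwards [hf, (heq 0 hζ0.symm)] with z hz hz'
    rwa [← hz']

/-- At a regular point on the critical circle the continuation satisfies the functional equation
that defines it inside the disk. -/
lemma IsRegularPoint.exists_analyticAt {f : PowerSeries ℂ} {q : ℂ[X]} {R : ℝ} (hR : 0 < R)
    (hq0 : q.coeff 0 ≠ 0) (hq : ∀ r, 0 < r → r < R → ∃ C, PowerBound (q * f) r C) {ζ : ℂ}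
    (h : IsRegularPoint f R ζ) :
    ∃ g : ℂ → ℂ, AnalyticAt ℂ g ζ ∧
      ∀ᶠ z in 𝓝 ζ, ‖z‖ < R → q.eval z * g z = psum ((q : PowerSeries ℂ) * f) z := by
  obtain ⟨ε, hε, g, hg, hga, hgf⟩ := h
  have hqne : q ≠ 0 := by rintro rfl; simp at hq0
  refine ⟨g, hga ζ (Metric.mem_ball_self hε), ?_⟩
  filter_upwards [Metric.ball_mem_nhds ζ hε] with z hz hzR
  have h1 := hgf.eventuallyEq (represents_quotient hR hq0 hq) (hg.mono_set Set.subset_union_left)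
    (meromorphicOn_quotient hq) hzR
  have h2 : (fun w => q.eval w * g w) =ᶠ[𝓝[≠] z] psum ((q : PowerSeries ℂ) * f) := by
    filter_upwards [h1, IsRow.eventually_eval_ne_zero hqne z] with w hw hw'
    rw [hw, mul_div_cancel₀ _ hw']
  have h3 : ContinuousAt (fun w => q.eval w * g w) z :=
    q.continuous.continuousAt.mul (hga z hz).continuousAt
  have h4 :=
    (h3.eventuallyEq_nhds_iff_eventuallyEq_nhdsNE (analyticAt_psum hq hzR).continuousAt).1 h2
  exact h4.self_of_nhds

/-! ### Limits of zeros and of poles -/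

section Limits

variable {P Q : ℕ → ℂ[X]}

lemma IsLimitOfPoles.eventually_exists {ζ : ℂ} (h : IsLimitOfPoles P Q ζ) {ε : ℝ} (hε : 0 < ε) :
    ∀ᶠ n in atTop, ∃ z ∈ (redDen (P n) (Q n)).roots, dist z ζ < ε := by
  have h1 : ∀ᶠ n in atTop,
      Metric.infEDist ζ {z | (redDen (P n) (Q n)).IsRoot z} < ENNReal.ofReal ε :=
    h.eventually (gt_mem_nhds (ENNReal.ofReal_pos.2 hε))
  filter_upwards [h1] with n hn
  obtain ⟨z, hz, hzε⟩ := Metric.infEDist_lt_iff.1 hn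
  refine ⟨z, (mem_roots (normPoly_ne_zero _)).2 hz, ?_⟩
  rwa [edist_comm, edist_dist, ENNReal.ofReal_lt_ofReal_iff hε] at hzε

lemma isLimitOfStarZeros_of_forall {Λ : Set ℕ} {ζ : ℂ}
    (h : ∀ ε > 0, ∀ᶠ n in atTop ⊓ 𝓟 Λ, ∃ ξ ∈ (teleNum P Q n).roots, dist ζ ξ < ε) :
    IsLimitOfStarZeros P Q Λ ζ := by
  refine ENNReal.tendsto_nhds_zero.2 fun ε hε => ?_
  obtain ⟨δ, hδ, hδε⟩ := ENNReal.lt_iff_exists_real_btwn.1 hε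
  have hδ0 : 0 < δ := ENNReal.ofReal_pos.1 hδε.1
  filter_upwards [h δ hδ0] with n hn
  obtain ⟨ξ, hξ, hd⟩ := hn
  have h1 : ξ ∈ {z | (qStar P Q n).IsRoot z} := by
    refine ((mem_roots (normPoly_ne_zero _)).1 ?_ : (qStar P Q n).IsRoot ξ)
    rwa [roots_normPoly]
  calc Metric.infEDist ζ {z | (qStar P Q n).IsRoot z} ≤ edist ζ ξ :=
        Metric.infEDist_le_edist_of_mem h1
    _ ≤ ENNReal.ofReal δ := by rw [edist_dist]; exact ENNReal.ofReal_le_ofReal hd.le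
    _ ≤ ε := hδε.2.le

lemma IsLimitOfStarZeros.eventually_exists {Λ : Set ℕ} {ζ : ℂ} (h : IsLimitOfStarZeros P Q Λ ζ)
    {ε : ℝ} (hε : 0 < ε) : ∀ᶠ n in atTop ⊓ 𝓟 Λ, ∃ ξ ∈ (teleNum P Q n).roots, dist ξ ζ < ε := by
  have h1 : ∀ᶠ n in atTop ⊓ 𝓟 Λ,
      Metric.infEDist ζ {z | (qStar P Q n).IsRoot z} < ENNReal.ofReal ε :=
    h.eventually (gt_mem_nhds (ENNReal.ofReal_pos.2 hε))
  filter_upwards [h1] with n hn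
  obtain ⟨z, hz, hzε⟩ := Metric.infEDist_lt_iff.1 hn
  have h2 := (mem_roots (normPoly_ne_zero _)).2 (show (qStar P Q n).IsRoot z from hz)
  rw [roots_normPoly] at h2
  refine ⟨z, h2, ?_⟩
  rwa [edist_comm, edist_dist, ENNReal.ofReal_lt_ofReal_iff hε] at hzε

lemma one_le_countP {s : Multiset ℂ} {ζ : ℂ} {ε : ℝ} (h : ∃ z ∈ s, dist z ζ < ε) :
    1 ≤ s.countP fun z => dist z ζ < ε :=
  Multiset.countP_pos.2 h

/-- The supremum that defines `limitCount` is attained. -/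
lemma limitCount_spec {m : ℕ} (hcard : ∀ n, m ≤ n → (redDen (P n) (Q n)).roots.card ≤ m) (ζ : ℂ) :
    (∀ ε > 0, ∀ᶠ n in atTop,
      limitCount P Q ζ ≤ (redDen (P n) (Q n)).roots.countP fun z => dist z ζ < ε) ∧
    (IsLimitOfPoles P Q ζ → 1 ≤ limitCount P Q ζ) := by
  set S : Set ℕ := {k : ℕ | ∀ ε > 0, ∀ᶠ n in atTop,
    k ≤ (redDen (P n) (Q n)).roots.countP fun z => dist z ζ < ε} with hS
  have hbdd : BddAbove S := by
    refine ⟨m, fun k hk => ?_⟩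
    obtain ⟨n, hn, hmn⟩ := ((hk 1 one_pos).and (eventually_ge_atTop m)).exists
    exact hn.trans ((Multiset.countP_le_card _ _).trans (hcard n hmn))
  have heq : limitCount P Q ζ = sSup S := by
    rw [limitCount, hS]
  rw [heq]
  refine ⟨?_, fun h => le_csSup hbdd fun ε hε => ?_⟩
  · have h0 : (0 : ℕ) ∈ S := fun ε _ => Eventually.of_forall fun n => Nat.zero_le _
    exact Nat.sSup_mem (s := S) ⟨0, h0⟩ hbdd
  · filter_upwards [h.eventually_exists hε] with n hn
    exact one_le_countP hn

end Limits

/-- Multiplication with a power of `z - ζ` below the number of poles that tend to `ζ` removes a pole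
of lower order. -/
lemma exists_regular_multiple {F : ℂ → ℂ} {ζ : ℂ} (hF : MeromorphicAt F ζ) {l : ℕ} (hl : 1 ≤ l)
    (hord : ∀ k : ℕ, 1 ≤ k → meromorphicOrderAt F ζ = ((-(k : ℤ) : ℤ) : WithTop ℤ) → k < l) :
    ∃ κ H, κ + 1 ≤ l ∧ AnalyticAt ℂ H ζ ∧ ∀ᶠ z in 𝓝[≠] ζ, (z - ζ) ^ κ * F z = H z := by
  rcases le_or_gt 0 (meromorphicOrderAt F ζ) with h | h
  · obtain ⟨H, hH, hFH⟩ := hF.meromorphicOrderAt_nonneg_iff.1 h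
    refine ⟨0, H, by omega, hH, ?_⟩
    filter_upwards [hFH] with z hz
    rw [pow_zero, one_mul, hz]
  · obtain ⟨n, hn⟩ := WithTop.ne_top_iff_exists.1 h.ne_top
    have hn0 : n < 0 := by rw [← hn] at h; exact_mod_cast h
    obtain ⟨k, hk⟩ := Int.eq_ofNat_of_zero_le (by omega : 0 ≤ -n)
    obtain rfl : n = -(k : ℤ) := by omega
    obtain ⟨H, hH, -, hFH⟩ := (meromorphicOrderAt_eq_int_iff hF).1 hn.symm
    refine ⟨k, H, hord k (by omega) hn.symm, hH, ?_⟩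
    filter_upwards [hFH, self_mem_nhdsWithin] with z hz hzζ
    have h0 : z - ζ ≠ 0 := sub_ne_zero.2 hzζ
    rw [hz, smul_eq_mul, ← mul_assoc, zpow_neg, zpow_natCast, mul_inv_cancel₀ (pow_ne_zero _ h0),
      one_mul]

lemma IsRegularization.dominates {m : ℕ} {A : ℕ → ℂ} {R : ℝ} {B : ℕ → ℝ} {Λ : Set ℕ}
    (h : IsRegularization m (fun n => ‖A n‖ * R ^ n) B Λ) : Dominates m R A B :=
  ⟨h.pos, h.ratio, fun n hn => (le_abs_self _).trans (h.le n hn)⟩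

/-- The alternative at one limit of poles.  The denominator `q` of the continuation may have zeros in
the disk that are not poles of `f`; only the true order of the pole of `f` at `ζ` matters. -/
theorem limit_of_poles_alternative {f : PowerSeries ℂ} {m m' : ℕ} (hm : m' ≤ m) {P Q : ℕ → ℂ[X]}
    (hPQ : ∀ n, m ≤ n → IsApproximant f n m m' (P n) (Q n)) {R : ℝ} (hR : 0 < R) {B : ℕ → ℝ}
    {Λ : Set ℕ} (hreg : IsRegularization m (fun n => ‖teleConst P Q n‖ * R ^ n) B Λ) {ζ : ℂ}
    (hζ : IsLimitOfPoles P Q ζ) :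
    (R < ‖ζ‖ → IsLimitOfStarZeros P Q Λ ζ) ∧
    (‖ζ‖ < R → IsLimitOfStarZeros P Q Λ ζ ∨
      ∃ k, limitCount P Q ζ ≤ k ∧ IsPoleOfOrder f ζ k) ∧
    (∀ qm : ℂ[X], DenTendsto P Q qm → qm.eval 0 ≠ 0 → ‖ζ‖ = R →
      IsLimitOfStarZeros P Q Λ ζ ∨ IsSingularPoint f R ζ) := by
  have h := isRow_of_isApproximant hm hPQ
  have habs : ∀ n, |‖teleConst P Q n‖ * R ^ n| = ‖teleConst P Q n‖ * R ^ n := fun n =>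
    abs_of_nonneg (by positivity)
  have hB := hreg.dominates
  obtain ⟨c, hc, hΛ⟩ := hreg.ge
  simp only [habs] at hΛ
  obtain ⟨hcount, hcount1⟩ := limitCount_spec h.card_le ζ
  have hcount1 := hcount1 hζ
  have hone : ∀ ε > 0, ∀ᶠ n in atTop,
      1 ≤ (redDen (P n) (Q n)).roots.countP fun z => dist z ζ < ε := fun ε hε => by
    filter_upwards [hcount ε hε] with n hn
    exact hcount1.trans hn
  obtain ⟨q, hq0, hqL, hq⟩ := h.exists_denominator fun r hr hrR => hB.exists_bound hr hrR
  refine ⟨fun hlt => ?_, fun hlt => ?_, fun qm hqm hqm0 heq => ?_⟩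
  · exact isLimitOfStarZeros_of_forall (h.star_zero_of_exterior hR hB hc hΛ hlt hone)
  · rw [or_iff_not_imp_right]
    intro hpole
    refine isLimitOfStarZeros_of_forall ?_
    rcases eq_or_ne ζ 0 with rfl | hζ0
    · refine h.star_zero_of_interior hR hB hc hΛ hq0 hq hlt (κ := 0) hone
        (H := fun z => psum ((q : PowerSeries ℂ) * f) z / q.eval z)
        ((analyticAt_psum hq hlt).div (q.differentiable.analyticAt _) ?_)
        (Eventually.of_forall fun z => by rw [pow_zero, one_mul]) fun _ => ⟨rfl, rfl⟩
      rwa [← coeff_zero_eq_eval_zero]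
    · obtain ⟨κ, H, hκ, hH, hHF⟩ := exists_regular_multiple (meromorphicAt_quotient hq hlt) hcount1
        fun k hk hk' => not_le.1 fun hle => hpole ⟨k, hle, hk, R, hlt, _, meromorphicOn_quotient hq,
          represents_quotient hR hq0 hq, hk'⟩
      refine h.star_zero_of_interior hR hB hc hΛ hq0 hq hlt (κ := κ) (fun ε hε => ?_) hH hHF
        fun h0 => absurd h0 hζ0
      filter_upwards [hcount ε hε] with n hn
      exact hκ.trans hn
  · have hL : ∀ i, Tendsto (fun n => (normPoly (redDen (P n) (Q n)).roots).coeff i) atTop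
        (𝓝 (qm.coeff i)) := by
      simp only [← redDen_eq_normPoly_roots]
      exact hqm
    have hqq : q = qm := hqL qm hL (by rwa [coeff_zero_eq_eval_zero])
    rw [or_iff_not_imp_right]
    intro hsing
    have hregp : IsRegularPoint f R ζ := by
      by_contra hcon
      exact hsing ⟨⟨_, meromorphicOn_quotient hq, represents_quotient hR hq0 hq⟩, heq.le, hcon⟩
    obtain ⟨g, hg, hgF⟩ := hregp.exists_analyticAt hR hq0 hq
    refine isLimitOfStarZeros_of_forall (h.star_zero_of_boundary hR hB hreg.concave hc hΛ (L := q)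
      (hqq ▸ hL) (by rintro rfl; simp at hq0) hq heq hone hg hgF)

/-- The zeros of a limit of denominators are limits of poles. -/
lemma isLimitOfPoles_of_isRoot {m : ℕ} {P Q : ℕ → ℂ[X]}
    (hcard : ∀ n, m ≤ n → (redDen (P n) (Q n)).roots.card ≤ m) {qm : ℂ[X]}
    (hqm : DenTendsto P Q qm) {ζ : ℂ} (hζ : qm.IsRoot ζ) : IsLimitOfPoles P Q ζ := by
  have hlim : Tendsto (fun n => (redDen (P n) (Q n)).eval ζ) atTop (𝓝 0) := by
    set d := max m qm.natDegree + 1 with hd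
    have h1 : Tendsto (fun n => ∑ i ∈ Finset.range d, (redDen (P n) (Q n)).coeff i * ζ ^ i) atTop
        (𝓝 (∑ i ∈ Finset.range d, qm.coeff i * ζ ^ i)) :=
      tendsto_finsetSum _ fun i _ => (hqm i).mul_const _
    rw [← eval_eq_sum_range' (by omega : qm.natDegree < d), hζ.eq_zero] at h1
    refine h1.congr' ?_
    filter_upwards [eventually_ge_atTop m] with n hn
    rw [eval_eq_sum_range']
    have := hcard n hn
    rw [IsAlgClosed.card_roots_eq_natDegree] at this
    omega
  refine ENNReal.tendsto_nhds_zero.2 fun ε hε => ?_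
  obtain ⟨δ, hδ, hδε⟩ := ENNReal.lt_iff_exists_real_btwn.1 hε
  have hδ0 : 0 < δ := ENNReal.ofReal_pos.1 hδε.1
  set δ' := min δ 1 with hδ'
  have hδ'0 : 0 < δ' := lt_min hδ0 one_pos
  have hpos : 0 < (δ' / (1 + ‖ζ‖)) ^ m := by positivity
  filter_upwards [(tendsto_zero_iff_norm_tendsto_zero.1 hlim).eventually (gt_mem_nhds hpos),
    eventually_ge_atTop m] with n hn hmn
  have hex : ∃ a ∈ (redDen (P n) (Q n)).roots, dist ζ a < δ' := by
    by_contra! hcon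
    have := le_norm_eval_normPoly (hcard n hmn) hδ'0.le (min_le_right _ _) hcon
    rw [← redDen_eq_normPoly_roots] at this
    linarith
  obtain ⟨a, ha, had⟩ := hex
  calc Metric.infEDist ζ {z | (redDen (P n) (Q n)).IsRoot z} ≤ edist ζ a :=
        Metric.infEDist_le_edist_of_mem (isRoot_of_mem_roots ha)
    _ ≤ ENNReal.ofReal δ := by
        rw [edist_dist]; exact ENNReal.ofReal_le_ofReal (had.le.trans (min_le_left _ _))
    _ ≤ ε := hδε.2.le

/-! ### Simple zeros of the limit denominator -/

/-- At a simple zero of the denominator a quotient has a removable singularity or a simple pole. -/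
lemma order_div_of_simple_root {F : ℂ → ℂ} {q : ℂ[X]} {ζ : ℂ} (hF : AnalyticAt ℂ F ζ)
    (hq : q.rootMultiplicity ζ = 1) :
    0 ≤ meromorphicOrderAt (fun z => F z / q.eval z) ζ ∨
      meromorphicOrderAt (fun z => F z / q.eval z) ζ = ((-1 : ℤ) : WithTop ℤ) := by
  have hq0 : q ≠ 0 := by rintro rfl; simp at hq
  obtain ⟨r, hr, hrζ⟩ := exists_eq_pow_rootMultiplicity_mul_and_not_dvd q hq0 ζ
  rw [hq, pow_one] at hr
  have hr0 : r.eval ζ ≠ 0 := fun h0 => hrζ (dvd_iff_isRoot.2 h0)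
  have hH : AnalyticAt ℂ (fun z => F z / r.eval z) ζ :=
    hF.div (r.differentiable.analyticAt ζ) hr0
  set H : ℂ → ℂ := fun z => F z / r.eval z with hHdef
  have hmer : MeromorphicAt (fun z => F z / q.eval z) ζ :=
    hF.meromorphicAt.div (q.differentiable.analyticAt ζ).meromorphicAt
  have heq : ∀ z, F z / q.eval z = (z - ζ)⁻¹ * H z := fun z => by
    rw [hr, hHdef, eval_mul, eval_sub, eval_X, eval_C, div_mul_eq_div_div_swap]
    ring
  by_cases h0 : H ζ = 0
  · left
    obtain ⟨p, hp⟩ := hH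
    refine hmer.meromorphicOrderAt_nonneg_iff.2
      ⟨dslope H ζ, ⟨_, hp.has_fpower_series_dslope_fslope⟩, ?_⟩
    filter_upwards [self_mem_nhdsWithin] with z hz
    rw [dslope_of_ne _ hz, slope_def_module, h0, sub_zero, smul_eq_mul, heq]
  · right
    refine (meromorphicOrderAt_eq_int_iff hmer).2 ⟨H, hH, h0, Eventually.of_forall fun z => ?_⟩
    rw [heq, zpow_neg_one, smul_eq_mul]

/-- Distinct limits of zeros of multisets of cardinality at most `N` number at most `N`. -/
lemma card_le_of_forall_limit {t : ℕ → Multiset ℂ} {N : ℕ} {l : Filter ℕ} [l.NeBot]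
    (ht : ∀ᶠ n in l, (t n).card ≤ N) {T : Finset ℂ}
    (hT : ∀ ζ ∈ T, ∀ ε > 0, ∀ᶠ n in l, ∃ ξ ∈ t n, dist ξ ζ < ε) : T.card ≤ N := by
  classical
  obtain ⟨U, hU, hdisj⟩ := T.finite_toSet.t2_separation
  have h1 : ∀ᶠ n in l, ∀ ζ ∈ T, ∃ ξ ∈ t n, ξ ∈ U ζ := by
    refine (Finset.eventually_all T).2 fun ζ hζ => ?_
    obtain ⟨ε, hε, hball⟩ := Metric.isOpen_iff.1 (hU ζ).2 ζ (hU ζ).1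
    filter_upwards [hT ζ hζ ε hε] with n hn
    obtain ⟨ξ, hξ, hd⟩ := hn
    exact ⟨ξ, hξ, hball hd⟩
  obtain ⟨n, hn, hcard⟩ := (h1.and ht).exists
  choose! ξ hξ hξU using hn
  calc T.card ≤ (t n).toFinset.card := by
        refine Finset.card_le_card_of_injOn ξ (fun ζ hζ => Multiset.mem_toFinset.2 (hξ ζ hζ)) ?_
        intro a ha b hb hab
        by_contra hne
        exact Set.disjoint_left.1 (hdisj ha hb hne) (hξU a ha) (hab ▸ hξU b hb)
    _ ≤ (t n).card := Multiset.toFinset_card_le _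
    _ ≤ N := hcard

end IncompletePade

theorem mainTheorem1 (f : PowerSeries ℂ) (m m' : ℕ) (hm' : 1 ≤ m') (hm : m' ≤ m)
    (P Q : ℕ → Polynomial ℂ)
    (hPQ : ∀ n, m ≤ n → IncompletePade.IsApproximant f n m m' (P n) (Q n))
    (R : ℝ) (hR : 0 < R) (hRStar : IncompletePade.RStar P Q = ENNReal.ofReal R) :
    -- regularizing sequences exist
    (∃ B Λ, IncompletePade.IsRegularization m
      (fun n => ‖IncompletePade.teleConst P Q n‖ * R ^ n) B Λ) ∧
    -- the behaviour at one limit of zeros of the denominators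
    (∀ (B : ℕ → ℝ) (Λ : Set ℕ),
      IncompletePade.IsRegularization m
        (fun n => ‖IncompletePade.teleConst P Q n‖ * R ^ n) B Λ →
      ∀ ζ : ℂ, IncompletePade.IsLimitOfPoles P Q ζ →
        (R < ‖ζ‖ → IncompletePade.IsLimitOfStarZeros P Q Λ ζ) ∧
        (‖ζ‖ < R → IncompletePade.IsLimitOfStarZeros P Q Λ ζ ∨
          ∃ k, IncompletePade.limitCount P Q ζ ≤ k ∧ IncompletePade.IsPoleOfOrder f ζ k) ∧
        (∀ qm : Polynomial ℂ, IncompletePade.DenTendsto P Q qm → qm.natDegree = m →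
          qm.eval 0 ≠ 0 → ‖ζ‖ = R →
            IncompletePade.IsLimitOfStarZeros P Q Λ ζ ∨
              IncompletePade.IsSingularPoint f R ζ)) ∧
    -- convergent denominators whose limit has distinct zeros
    (∀ qm : Polynomial ℂ, IncompletePade.DenTendsto P Q qm → qm.natDegree = m →
      qm.eval 0 ≠ 0 → qm.roots.Nodup →
        m' ≤ {ζ : ℂ | qm.IsRoot ζ ∧ IncompletePade.IsSingularPoint f R ζ}.ncard ∧
        ∀ ζ : ℂ, qm.IsRoot ζ → IncompletePade.IsSingularPoint f R ζ → ‖ζ‖ < R →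
          IncompletePade.IsPoleOfOrder f ζ 1) := by
  have h := IncompletePade.isRow_of_isApproximant hm hPQ
  obtain ⟨hU, hLow⟩ := IncompletePade.root_test_bounds hR hRStar
  have hex := IncompletePade.exists_isRegularization m
    (a := fun n => ‖IncompletePade.teleConst P Q n‖ * R ^ n) (fun n => by positivity) hU hLow
  have halt := fun (B : ℕ → ℝ) (Λ : Set ℕ) hreg (ζ : ℂ) hζ =>
    IncompletePade.limit_of_poles_alternative (B := B) (Λ := Λ) (ζ := ζ) hm hPQ hR hreg hζ
  refine ⟨hex, fun B Λ hreg ζ hζ => ⟨(halt B Λ hreg ζ hζ).1, (halt B Λ hreg ζ hζ).2.1,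
    fun qm hqm _ hqm0 => (halt B Λ hreg ζ hζ).2.2 qm hqm hqm0⟩,
    fun qm hqm hdeg hqm0 hnodup => ?_⟩
  obtain ⟨B, Λ, hreg⟩ := hex
  have hne : qm ≠ 0 := by rintro rfl; simp at hqm0
  -- the denominator of the meromorphic continuation is `qm`
  obtain ⟨q, hq0, hqL, hq⟩ := h.exists_denominator fun r hr hrR =>
    hreg.dominates.exists_bound hr hrR
  obtain rfl : qm = q := (hqL qm
    (fun i => by simpa only [← IncompletePade.redDen_eq_normPoly_roots] using hqm i)
    (by rwa [Polynomial.coeff_zero_eq_eval_zero])).symm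
  have hmer := IncompletePade.meromorphicOn_quotient hq
  have hrep := IncompletePade.represents_quotient hR hq0 hq
  have hroot : ∀ ζ, qm.IsRoot ζ → IncompletePade.IsLimitOfPoles P Q ζ := fun ζ hζ =>
    IncompletePade.isLimitOfPoles_of_isRoot h.card_le hqm hζ
  constructor
  · -- the regular zeros of `qm` are limits of zeros of the telescoping polynomials
    classical
    have hreg_star : ∀ ζ, qm.IsRoot ζ → ¬ IncompletePade.IsSingularPoint f R ζ →
        IncompletePade.IsLimitOfStarZeros P Q Λ ζ := by
      intro ζ hζ hns
      obtain ⟨h1, h2, h3⟩ := halt B Λ hreg ζ (hroot ζ hζ)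
      rcases lt_trichotomy ‖ζ‖ R with hlt | heq | hgt
      · refine (h2 hlt).resolve_right ?_
        rintro ⟨k, -, hk⟩
        exact hns ⟨⟨_, hmer, hrep⟩, hlt.le, hk.not_isRegularPoint hlt⟩
      · exact (h3 qm hqm hqm0 heq).resolve_right hns
      · exact h1 hgt
    set T := qm.roots.toFinset.filter fun ζ => ¬ IncompletePade.IsSingularPoint f R ζ with hT
    set S := qm.roots.toFinset.filter fun ζ => IncompletePade.IsSingularPoint f R ζ with hS
    have hcard : S.card + T.card = m := by
      rw [hS, hT, Finset.card_filter_add_card_filter_not, Multiset.toFinset_card_of_nodup hnodup,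
        IsAlgClosed.card_roots_eq_natDegree, hdeg]
    have hset : {ζ : ℂ | qm.IsRoot ζ ∧ IncompletePade.IsSingularPoint f R ζ} = S := by
      ext ζ
      simp [hS, hne]
    have hNeBot : (atTop ⊓ 𝓟 Λ : Filter ℕ).NeBot :=
      inf_principal_neBot_iff.2 fun U hU => by
        obtain ⟨N, hN⟩ := mem_atTop_sets.1 hU
        obtain ⟨n, hn, hlt⟩ := hreg.infinite.exists_gt N
        exact ⟨n, hN n hlt.le, hn⟩
    have hTcard : T.card ≤ m - m' := by
      refine IncompletePade.card_le_of_forall_limit (l := atTop ⊓ 𝓟 Λ)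
        (t := fun n => (IncompletePade.teleNum P Q n).roots)
        (((eventually_ge_atTop m).filter_mono inf_le_left).mono fun n hn => h.card_star_le n hn)
        fun ζ hζ ε hε => ?_
      rw [hT, Finset.mem_filter, Multiset.mem_toFinset] at hζ
      exact (hreg_star ζ (isRoot_of_mem_roots hζ.1) hζ.2).eventually_exists hε
    rw [hset, Set.ncard_coe_finset]
    omega
  · intro ζ hζ hsing hlt
    have hmult : qm.rootMultiplicity ζ = 1 := by
      rw [← count_roots]
      exact Multiset.count_eq_one_of_mem hnodup ((mem_roots hne).2 hζ)
    have hζ0 : ζ ≠ 0 := by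
      rintro rfl
      exact hqm0 hζ
    rcases IncompletePade.order_div_of_simple_root (IncompletePade.analyticAt_psum hq hlt) hmult
      with hord | hord
    · exact absurd (IncompletePade.isRegularPoint_of_order_nonneg hmer hrep hlt hζ0 hord) hsing.2.2
    · exact ⟨le_rfl, R, hlt, _, hmer, hrep, hord⟩
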